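/- Let $n\ge 1$ be an integer and $m\ge 2$ a real number. Let $W\in C^\infty(\mathbb{R}^n\setminus\{0\})$ be a radially symmetric attractive potential: $W(x)=w(|x|)$ for $x\neq 0$, with $w'(r)>0$ for all $r>0$. Assume that there are $k>-n$ and $C>0$ such that $w'(r)\le C r^{k-1}$ for all $r\in(0,1)$. For a probability density $\rho$ on $\mathbb{R}^n$ let $$\mathcal{E}[\rho]=\mathcal{S}[\rho]+\mathcal{I}[\rho],\qquad \mathcal{S}[\rho]=\frac{1}{m-1}\int_{\mathbb{R}^n}\rho^m\,dx,\qquad \mathcal{I}[\rho]=\frac12\int_{\mathbb{R}^n}\int_{\mathbb{R}^n}\rho(x)W(x-y)\rho(y)\,dy\,dx ,$$ as extended real numbers. Let $\rho_0\neq\rho_1$ be continuous probability densities on $\mathbb{R}^n$ that are radially decreasing, i.e. radially symmetric and non-increasing in $|x|$. For $i=0,1$ let $h_i:(0,1)\to(0,\infty)$ be the height function of $\rho_i$, defined by $\int_{\mathbb{R}^n}\min\{\rho_i(x),h_i(s)\}\,dx=s$. For $t\in[0,1]$ put $h_t=(1-t)h_0+th_1$ and $$\rho_t(x)=\int_0^1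 1_{B(0,(c_nh_t'(s))^{-1/n})}(x)\,h_t'(s)\,ds ,$$ where $c_n$ is the volume of the unit ball of $\mathbb{R}^n$ and $h_t'$ is the derivative of the convex function $h_t$, which exists outside a countable set. Then $\mathcal{E}[\rho_t]\in(-\infty,+\infty]$ for all $t\in(0,1)$, and $t\mapsto\mathcal{E}[\rho_t]$ is strictly convex on $(0,1)$, in the following sense: the set of $t\in(0,1)$ with $\mathcal{E}[\rho_t]<\infty$ is convex, and $t\mapsto\mathcal{E}[\rho_t]$ is strictly convex on this set. Moreover, if $\mathcal{E}[\rho_0]<\infty$ and $\mathcal{E}[\rho_1]<\infty$, then $\mathcal{E}[\rho_t]<\infty$ for all $t\in(0,1)$, so that $t\mapsto\mathcal{E}[\rho_t]$ is a real-valued strictly convex function on $(0,1)$. -/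

import Mathlib

open MeasureTheory Set Filter Topology
open scoped ContDiff

noncomputable section

namespace HeightInterp

/-- `ρ` is a probability density on `ℝⁿ`. -/
structure IsProbDensity {n : ℕ} (ρ : EuclideanSpace ℝ (Fin n) → ℝ) : Prop where
  nonneg : ∀ x, 0 ≤ ρ x
  integrable : Integrable ρ
  integral_eq_one : ∫ x, ρ x = 1

/-- `ρ` is radially symmetric and non-increasing in the radial variable. -/
def RadiallyDecreasing {n : ℕ} (ρ : EuclideanSpace ℝ (Fin n) → ℝ) : Prop :=
  ∀ x y, ‖x‖ ≤ ‖y‖ → ρ y ≤ ρ x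

/-- The height function of `ρ` with respect to mass: for `s ∈ (0,1)`, `heightFunction ρ s` is the
unique height `h` with `∫ min (ρ x) h dx = s` (see `heightFunction_eq_iff`). -/
def heightFunction {n : ℕ} (ρ : EuclideanSpace ℝ (Fin n) → ℝ) (s : ℝ) : ℝ :=
  sSup {h : ℝ | 0 ≤ h ∧ ∫ x, min (ρ x) h ≤ s}

lemma IsProbDensity.integrable_min {n : ℕ} {ρ : EuclideanSpace ℝ (Fin n) → ℝ}
    (hρ : IsProbDensity ρ) {h : ℝ} (hh : 0 ≤ h) : Integrable (fun x => min (ρ x) h) := by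
  refine hρ.integrable.mono
    (hρ.integrable.aestronglyMeasurable.inf aestronglyMeasurable_const) ?_
  refine ae_of_all _ fun x => ?_
  have h0 := hρ.nonneg x
  rw [Real.norm_of_nonneg (le_min h0 hh), Real.norm_of_nonneg h0]
  exact min_le_left _ _

lemma IsProbDensity.continuous_mass {n : ℕ} {ρ : EuclideanSpace ℝ (Fin n) → ℝ}
    (hρ : IsProbDensity ρ) : Continuous (fun h : ℝ => ∫ x, min (ρ x) (max h 0)) := by
  refine continuous_of_dominated (bound := ρ) (fun h => ?_) (fun h => ?_) hρ.integrable ?_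
  · exact (hρ.integrable_min (le_max_right h 0)).aestronglyMeasurable
  · refine ae_of_all _ fun x => ?_
    rw [Real.norm_of_nonneg (le_min (hρ.nonneg x) (le_max_right h 0))]
    exact min_le_left _ _
  · exact ae_of_all _ fun x => by fun_prop

lemma IsProbDensity.tendsto_mass {n : ℕ} {ρ : EuclideanSpace ℝ (Fin n) → ℝ}
    (hρ : IsProbDensity ρ) :
    Tendsto (fun h : ℝ => ∫ x, min (ρ x) (max h 0)) atTop (𝓝 1) := by
  rw [← hρ.integral_eq_one]
  refine tendsto_integral_filter_of_dominated_convergence ρ ?_ ?_ hρ.integrable ?_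
  · exact Eventually.of_forall fun h =>
      (hρ.integrable_min (le_max_right h 0)).aestronglyMeasurable
  · refine Eventually.of_forall fun h => ae_of_all _ fun x => ?_
    rw [Real.norm_of_nonneg (le_min (hρ.nonneg x) (le_max_right h 0))]
    exact min_le_left _ _
  · refine ae_of_all _ fun x => tendsto_const_nhds.congr' ?_
    filter_upwards [eventually_ge_atTop (ρ x)] with h hh
    exact (min_eq_left (hh.trans (le_max_left _ _))).symm

lemma IsProbDensity.mass_mono {n : ℕ} {ρ : EuclideanSpace ℝ (Fin n) → ℝ}
    (hρ : IsProbDensity ρ) {a b : ℝ} (ha : 0 ≤ a) (hab : a ≤ b) :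
    ∫ x, min (ρ x) a ≤ ∫ x, min (ρ x) b :=
  integral_mono (hρ.integrable_min ha) (hρ.integrable_min (ha.trans hab))
    fun _ => min_le_min le_rfl hab

lemma IsProbDensity.height_unique {n : ℕ} {ρ : EuclideanSpace ℝ (Fin n) → ℝ}
    (hρ : IsProbDensity ρ) {s a b : ℝ} (hs : s < 1) (ha : 0 ≤ a) (hab : a ≤ b)
    (h1 : ∫ x, min (ρ x) a = s) (h2 : ∫ x, min (ρ x) b = s) : a = b := by
  by_contra hne
  have hlt : a < b := lt_of_le_of_ne hab hne
  have hae : (fun x => min (ρ x) a) =ᵐ[volume] fun x => min (ρ x) b :=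
    (integral_eq_iff_of_ae_le (hρ.integrable_min ha) (hρ.integrable_min (ha.trans hab))
      (ae_of_all _ fun _ => min_le_min le_rfl hab)).1 (h1.trans h2.symm)
  have hae' : (fun x => min (ρ x) a) =ᵐ[volume] ρ := by
    filter_upwards [hae] with x hx
    refine min_eq_left ?_
    by_contra hc
    push Not at hc
    have h3 : min (ρ x) a = a := min_eq_right hc.le
    have h4 : a < min (ρ x) b := lt_min hc hlt
    linarith
  have := integral_congr_ae hae'
  rw [hρ.integral_eq_one, h1] at this
  linarith

/-- The height function solves its implicit equation. -/
theorem heightFunction_spec {n : ℕ} {ρ : EuclideanSpace ℝ (Fin n) → ℝ}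
    (hρ : IsProbDensity ρ) {s : ℝ} (hs : s ∈ Ioo (0 : ℝ) 1) :
    0 < heightFunction ρ s ∧ ∫ x, min (ρ x) (heightFunction ρ s) = s := by
  obtain ⟨b, hb⟩ := ((hρ.tendsto_mass.eventually (lt_mem_nhds hs.2)).and
    (eventually_ge_atTop (0 : ℝ))).exists
  have hzero : ∫ x, min (ρ x) (max (0 : ℝ) 0) = 0 := by
    have : (fun x => min (ρ x) (max (0 : ℝ) 0)) = fun _ => 0 := by
      funext x
      simpa using hρ.nonneg x
    rw [this, integral_zero]
  obtain ⟨h, hh, hhs⟩ := intermediate_value_Icc hb.2 hρ.continuous_mass.continuousOn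
    (show s ∈ Icc _ _ from ⟨by rw [hzero]; exact hs.1.le, hb.1.le⟩)
  simp only [max_eq_left hh.1] at hhs
  have hg : IsGreatest {h : ℝ | 0 ≤ h ∧ ∫ x, min (ρ x) h ≤ s} h := by
    refine ⟨⟨hh.1, hhs.le⟩, fun y hy => ?_⟩
    by_contra hc
    push Not at hc
    have h1 := hρ.mass_mono hh.1 hc.le
    have h2 : ∫ x, min (ρ x) y = s := le_antisymm hy.2 (by rw [← hhs]; exact h1)
    exact hc.ne (hρ.height_unique hs.2 hh.1 hc.le hhs h2)
  have hEq : heightFunction ρ s = h := hg.csSup_eq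
  rw [hEq]
  refine ⟨lt_of_le_of_ne hh.1 fun h0 => ?_, hhs⟩
  rw [← h0] at hhs
  simp only [max_self] at hzero
  have := hs.1
  linarith

/-- The height function is characterized by its implicit equation. -/
theorem heightFunction_eq_iff {n : ℕ} {ρ : EuclideanSpace ℝ (Fin n) → ℝ}
    (hρ : IsProbDensity ρ) {s h : ℝ} (hs : s ∈ Ioo (0 : ℝ) 1) (hh : 0 ≤ h) :
    heightFunction ρ s = h ↔ ∫ x, min (ρ x) h = s := by
  obtain ⟨h1, h2⟩ := heightFunction_spec hρ hs
  refine ⟨fun e => e ▸ h2, fun e => ?_⟩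
  rcases le_total (heightFunction ρ s) h with hle | hle
  · exact hρ.height_unique hs.2 h1.le hle h2 e
  · exact (hρ.height_unique hs.2 hh hle e h2).symm

/-- Linear interpolation `h_t = (1 - t) h₀ + t h₁` of the height functions. -/
def interpHeight {n : ℕ} (ρ₀ ρ₁ : EuclideanSpace ℝ (Fin n) → ℝ) (t s : ℝ) : ℝ :=
  (1 - t) * heightFunction ρ₀ s + t * heightFunction ρ₁ s

/-- `c_n`, the volume of the unit ball of `ℝⁿ`. -/
def unitBallVolume (n : ℕ) : ℝ :=
  volume.real (Metric.ball (0 : EuclideanSpace ℝ (Fin n)) 1)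

/-- The interpolation curve
`ρ_t(x) = ∫₀¹ 1_{B(0, (c_n h_t'(s))^(-1/n))}(x) h_t'(s) ds`. The height functions are convex on
`(0,1)`, so that `h_t'` exists outside a countable set. -/
def interp {n : ℕ} (ρ₀ ρ₁ : EuclideanSpace ℝ (Fin n) → ℝ) (t : ℝ) :
    EuclideanSpace ℝ (Fin n) → ℝ := fun x =>
  ∫ s in Ioo (0 : ℝ) 1,
    (Metric.ball (0 : EuclideanSpace ℝ (Fin n))
      ((unitBallVolume n * deriv (interpHeight ρ₀ ρ₁ t) s) ^ (-(1 / (n : ℝ))))).indicator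
      (fun _ => deriv (interpHeight ρ₀ ρ₁ t) s) x

/-- `W` is smooth away from the origin, radially symmetric with radial profile `w`, and attractive:
`w' > 0` on `(0,∞)`. The value of `W` at the origin is irrelevant. -/
structure IsAttractivePotential {n : ℕ} (W : EuclideanSpace ℝ (Fin n) → ℝ) (w : ℝ → ℝ) :
    Prop where
  smooth : ContDiffOn ℝ ∞ W {0}ᶜ
  radial : ∀ x, x ≠ 0 → W x = w ‖x‖
  deriv_pos : ∀ r, 0 < r → 0 < deriv w r

/-- The potential with radial profile `w` is no more singular at the origin than some locally
integrable Riesz potential: `w'(r) ≤ C r^(k-1)` on `(0,1)` for some `k > -n` and `C > 0`. -/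
def SingularityBound (n : ℕ) (w : ℝ → ℝ) : Prop :=
  ∃ k C : ℝ, -(n : ℝ) < k ∧ 0 < C ∧ ∀ r ∈ Ioo (0 : ℝ) 1, deriv w r ≤ C * r ^ (k - 1)

/-- The entropy `S[ρ] = 1/(m-1) ∫ ρ^m`, with values in `[0,∞]`. -/
def entropy {n : ℕ} (m : ℝ) (ρ : EuclideanSpace ℝ (Fin n) → ℝ) : ENNReal :=
  ENNReal.ofReal (1 / (m - 1)) * ∫⁻ x, ENNReal.ofReal (ρ x ^ m)

/-- The interaction energy `I[ρ] = 1/2 ∫ ρ (W * ρ) = 1/2 ∫∫ ρ(x) W(x-y) ρ(y) dy dx`, as an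
extended real number: the integral of the positive part minus that of the negative part
(which is `⊥` if the latter is infinite). -/
def interactionEnergy {n : ℕ} (W ρ : EuclideanSpace ℝ (Fin n) → ℝ) : EReal :=
  ((1 / 2 : ℝ) : EReal) *
    (((∫⁻ x, ∫⁻ y, ENNReal.ofReal (ρ x * (W (x - y) * ρ y)) : ENNReal) : EReal) -
      ((∫⁻ x, ∫⁻ y, ENNReal.ofReal (-(ρ x * (W (x - y) * ρ y))) : ENNReal) : EReal))

/-- The free energy `E[ρ] = S[ρ] + I[ρ]`. -/
def freeEnergy {n : ℕ} (m : ℝ) (W ρ : EuclideanSpace ℝ (Fin n) → ℝ) : EReal :=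
  (entropy m ρ : EReal) + interactionEnergy W ρ

end HeightInterp

end

/-!
The height `h : (0,1) → (0,∞)` of a continuous radially decreasing density `ρ` is convex, and its
slope at `s` is the reciprocal of the volume of the superlevel set `{ρ > h s}`, a centred ball.
Hence `ρ` is recovered by stacking balls: `stack n u`, with `u = h'`, has at mass level `s` a layer of
thickness `u s ds` on the centred ball of volume `1 / u s` (`stack_heightSlope`). The interpolation
curve is the stack of the linear interpolation of the two slopes (`interp_eq_stack`), so everything
reduces to the convexity of the two parts of the energy as functionals of the slope `u`.

*Entropy.* In the mass variable `∫ ρ ^ m = ∫₀¹ m h(s) ^ (m - 1) ds`, where `h` is the primitive of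
`u`. This is finite, and it is convex in `h` because `m - 1 ≥ 1`
(`IsSlopeProfile.entropy_interp_le`).

*Interaction.* Layer by layer, the interaction energy is the integral over `(s, r) ∈ (0,1)²` of the
mean `Φ (u s) (u r)` of the potential over two centred balls of volumes `1 / u s` and `1 / u r`. The
core of the proof is that `Φ` is strictly convex on `(0,∞)²`
(`IsRadialProfile.ballInteraction_lt`). Differentiating the volume of the intersection of two balls
with respect to the distance of the centres, and describing the cross section by a triangle with
sides `a`, `b` and enclosed angle `φ`, gives the formula
`Φ = C ∫₀^π sin(φ) ^ n R ^ (-n) (∫₀^R r ^ (n - 1) w(r) dr) dφ`, where `a`, `b` are the radii and `R`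
is the third side of the triangle (`lintegral_ball_ball_eq_angle`). When the reciprocals of the
volumes vary linearly in `t`, the second derivative in `t` of the integrand is a density that is
positive because `w' > 0`, minus the derivative in `φ` of a flux
(`IsRadiusFlow.hasDerivAt_meanIntegrandDeriv`). The flux is nonnegative and vanishes at `φ = π`;
integrating over `(δ, π)` thus gives a second derivative bounded below by a positive constant that
does not depend on `δ`, and the limit `δ → 0` yields strict convexity without any regularity of `w`
at the origin.

*Conclusion.* The bound on `w'` near the origin makes the negative part of the potential the sum of
a bounded and an integrable function, so that the negative part of the interaction is always finite:
the energy is never `-∞`, and it is finite exactly if the positive part of the interaction is.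
Convexity of `Φ` bounds the positive part at an intermediate time by the positive parts at the end
points and the negative part, so finiteness propagates
(`IsAttractivePotential.freeEnergy_interp_ne_top`). The inequality between the energies is strict
(`IsAttractivePotential.freeEnergy_interp_lt`), since two different densities have slopes that
differ on a set of positive measure.
-/

noncomputable section

namespace HeightInterp

/-! ### Slopes of the height function -/

/-- The slope of the height function: the reciprocal of the volume of the superlevel set at the
given height. Outside `(0,1)` the value `1` keeps the function positive everywhere. -/
def heightSlope {n : ℕ} (ρ : EuclideanSpace ℝ (Fin n) → ℝ) (s : ℝ) : ℝ :=
  (Ioo (0 : ℝ) 1).piecewise (fun s => (volume.real {x | heightFunction ρ s < ρ x})⁻¹)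
    (fun _ => 1) s

section Height

variable {n : ℕ} {ρ : EuclideanSpace ℝ (Fin n) → ℝ}

lemma heightFunction_lt (hρ : IsProbDensity ρ) {s s' : ℝ} (hs : s ∈ Ioo (0 : ℝ) 1)
    (hs' : s' ∈ Ioo (0 : ℝ) 1) (h : s < s') : heightFunction ρ s < heightFunction ρ s' := by
  by_contra hc
  push Not at hc
  have h1 := hρ.mass_mono (heightFunction_spec hρ hs').1.le hc
  rw [(heightFunction_spec hρ hs).2, (heightFunction_spec hρ hs').2] at h1
  linarith

lemma volume_superlevel_lt_top (hρ : IsProbDensity ρ) {η : ℝ} (hη : 0 < η) :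
    volume {x | η < ρ x} < ⊤ :=
  hρ.integrable.measure_gt_lt_top hη

/-- Between two heights, the cross sections of the subgraph of `ρ` decrease, and the volume of the
slab between them is the increment of mass. -/
lemma height_increment_bounds (hρ : IsProbDensity ρ) (hc : Continuous ρ) {s s' : ℝ}
    (hs : s ∈ Ioo (0 : ℝ) 1) (hs' : s' ∈ Ioo (0 : ℝ) 1) (h : s < s') :
    (heightFunction ρ s' - heightFunction ρ s) * volume.real {x | heightFunction ρ s' < ρ x}
      ≤ s' - s ∧
    s' - s ≤
      (heightFunction ρ s' - heightFunction ρ s) * volume.real {x | heightFunction ρ s < ρ x} := by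
  have hlt := heightFunction_lt hρ hs hs' h
  obtain ⟨ha, ha'⟩ := heightFunction_spec hρ hs
  obtain ⟨hb, hb'⟩ := heightFunction_spec hρ hs'
  set a := heightFunction ρ s
  set b := heightFunction ρ s'
  have ho : ∀ η : ℝ, MeasurableSet {x | η < ρ x} := fun η =>
    (isOpen_lt continuous_const hc).measurableSet
  have key : ∀ η : ℝ, 0 < η → ∫ x, ({x | η < ρ x}.indicator (fun _ => b - a)) x
      = (b - a) * volume.real {x | η < ρ x} := by
    intro η _
    rw [integral_indicator (ho η), setIntegral_const, smul_eq_mul, mul_comm]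
  have hint : ∀ η : ℝ, 0 < η → Integrable ({x | η < ρ x}.indicator (fun _ => b - a)) := by
    intro η hη
    exact (integrable_indicator_iff (ho η)).2
      (integrableOn_const (volume_superlevel_lt_top hρ hη).ne)
  have hsub : s' - s = ∫ x, (min (ρ x) b - min (ρ x) a) := by
    rw [integral_sub (hρ.integrable_min hb.le) (hρ.integrable_min ha.le), ha', hb']
  have hintd := (hρ.integrable_min hb.le).sub (hρ.integrable_min ha.le)
  constructor
  · rw [← key b hb, hsub]
    refine integral_mono (hint b hb) hintd fun x => ?_
    by_cases hx : b < ρ x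
    · simp [indicator, hx, min_eq_right hx.le, min_eq_right (hlt.trans hx).le]
    · simp only [indicator, mem_ofPred_eq, hx, if_false, sub_nonneg]
      exact min_le_min le_rfl hlt.le
  · rw [← key a ha, hsub]
    refine integral_mono hintd (hint a ha) fun x => ?_
    by_cases hx : a < ρ x
    · simp only [indicator, mem_ofPred_eq, hx, if_true, min_eq_right hx.le]
      have := min_le_right (ρ x) b
      linarith
    · push Not at hx
      simp [indicator, hx.not_gt, min_eq_left hx, min_eq_left (hx.trans hlt.le)]

lemma volume_superlevel_pos (hρ : IsProbDensity ρ) (hc : Continuous ρ) {s : ℝ}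
    (hs : s ∈ Ioo (0 : ℝ) 1) : 0 < volume.real {x | heightFunction ρ s < ρ x} := by
  have hs' : (s + 1) / 2 ∈ Ioo (0 : ℝ) 1 := ⟨by linarith [hs.1], by linarith [hs.2]⟩
  have h : s < (s + 1) / 2 := by linarith [hs.2]
  have h1 := (height_increment_bounds hρ hc hs hs' h).2
  by_contra hn
  have h2 := heightFunction_lt hρ hs hs' h
  have h3 : volume.real {x | heightFunction ρ s < ρ x} = 0 :=
    le_antisymm (not_lt.1 hn) measureReal_nonneg
  rw [h3] at h1
  linarith

lemma heightSlope_of_mem {s : ℝ} (hs : s ∈ Ioo (0 : ℝ) 1) :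
    heightSlope ρ s = (volume.real {x | heightFunction ρ s < ρ x})⁻¹ :=
  piecewise_eq_of_mem _ _ _ hs

lemma heightSlope_pos (hρ : IsProbDensity ρ) (hc : Continuous ρ) (s : ℝ) :
    0 < heightSlope ρ s := by
  by_cases hs : s ∈ Ioo (0 : ℝ) 1
  · rw [heightSlope_of_mem hs]
    exact inv_pos.2 (volume_superlevel_pos hρ hc hs)
  · rw [heightSlope, piecewise_eq_of_notMem _ _ _ hs]
    exact one_pos

/-- The height function is convex, in the form of a subgradient inequality from both sides. -/
lemma heightSlope_bounds (hρ : IsProbDensity ρ) (hc : Continuous ρ) {s s' : ℝ}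
    (hs : s ∈ Ioo (0 : ℝ) 1) (hs' : s' ∈ Ioo (0 : ℝ) 1) (h : s < s') :
    heightSlope ρ s * (s' - s) ≤ heightFunction ρ s' - heightFunction ρ s ∧
    heightFunction ρ s' - heightFunction ρ s ≤ heightSlope ρ s' * (s' - s) := by
  obtain ⟨h1, h2⟩ := height_increment_bounds hρ hc hs hs' h
  rw [heightSlope_of_mem hs, heightSlope_of_mem hs']
  have p := volume_superlevel_pos hρ hc hs
  have p' := volume_superlevel_pos hρ hc hs'
  constructor
  · rw [inv_mul_le_iff₀ p]; linarith
  · rw [inv_mul_eq_div, le_div_iff₀ p']; linarith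

lemma heightSlope_monotoneOn (hρ : IsProbDensity ρ) (hc : Continuous ρ) :
    MonotoneOn (heightSlope ρ) (Ioo (0 : ℝ) 1) := by
  intro s hs s' hs' h
  rcases h.eq_or_lt with rfl | h
  · exact le_rfl
  · obtain ⟨h1, h2⟩ := heightSlope_bounds hρ hc hs hs' h
    exact le_of_mul_le_mul_right (h1.trans h2) (sub_pos.2 h)

lemma heightSlope_measurable (hρ : IsProbDensity ρ) (hc : Continuous ρ) :
    Measurable (heightSlope ρ) := by
  refine measurable_of_restrict_of_restrict_compl (measurableSet_Ioo (a := (0 : ℝ)) (b := 1)) ?_ ?_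
  · refine Monotone.measurable ?_
    exact fun a b hab => heightSlope_monotoneOn hρ hc a.2 b.2 hab
  · have : (Ioo (0 : ℝ) 1)ᶜ.domRestrict (heightSlope ρ) = fun _ => 1 := by
      funext x
      have hx : (x : ℝ) ∉ Ioo (0 : ℝ) 1 := x.2
      rw [domRestrict_apply, heightSlope, piecewise_eq_of_notMem _ _ _ hx]
    rw [this]
    exact measurable_const

lemma countable_discontinuities {u : ℝ → ℝ} (hu : MonotoneOn u (Ioo (0 : ℝ) 1)) :
    {s | s ∈ Ioo (0 : ℝ) 1 ∧ ¬ ContinuousAt u s}.Countable := by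
  refine hu.countable_not_continuousWithinAt.mono ?_
  rintro s ⟨hs, h⟩
  refine ⟨hs, fun h' => h ?_⟩
  exact h'.continuousAt (Ioo_mem_nhds hs.1 hs.2)

lemma heightFunction_hasDerivAt (hρ : IsProbDensity ρ) (hc : Continuous ρ) {s : ℝ}
    (hs : s ∈ Ioo (0 : ℝ) 1) (hcont : ContinuousAt (heightSlope ρ) s) :
    HasDerivAt (heightFunction ρ) (heightSlope ρ s) s := by
  rw [hasDerivAt_iff_tendsto_slope]
  -- every difference quotient at `s` lies between the slopes at its two end points
  have h1 : Tendsto (fun s' => min (heightSlope ρ s) (heightSlope ρ s')) (𝓝[≠] s)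
      (𝓝 (heightSlope ρ s)) := by
    have := (tendsto_const_nhds (x := heightSlope ρ s)).min (hcont.tendsto)
    rw [min_self] at this
    exact this.mono_left nhdsWithin_le_nhds
  have h2 : Tendsto (fun s' => max (heightSlope ρ s) (heightSlope ρ s')) (𝓝[≠] s)
      (𝓝 (heightSlope ρ s)) := by
    have := (tendsto_const_nhds (x := heightSlope ρ s)).max (hcont.tendsto)
    rw [max_self] at this
    exact this.mono_left nhdsWithin_le_nhds
  have hev : ∀ᶠ s' in 𝓝[≠] s, s' ∈ Ioo (0 : ℝ) 1 ∧ s' ≠ s :=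
    (eventually_nhdsWithin_of_eventually_nhds (Ioo_mem_nhds hs.1 hs.2)).and
      eventually_mem_nhdsWithin
  have hb : ∀ s' ∈ Ioo (0 : ℝ) 1, s' ≠ s →
      min (heightSlope ρ s) (heightSlope ρ s') ≤ slope (heightFunction ρ) s s' ∧
      slope (heightFunction ρ) s s' ≤ max (heightSlope ρ s) (heightSlope ρ s') := by
    intro s' hs' hne
    rcases lt_or_gt_of_ne hne with h | h
    · obtain ⟨a1, a2⟩ := heightSlope_bounds hρ hc hs' hs h
      rw [slope_comm, slope_def_field]
      have hp : 0 < s - s' := sub_pos.2 h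
      exact ⟨(min_le_right _ _).trans ((le_div_iff₀ hp).2 a1),
        ((div_le_iff₀ hp).2 a2).trans (le_max_left _ _)⟩
    · obtain ⟨a1, a2⟩ := heightSlope_bounds hρ hc hs hs' h
      rw [slope_def_field]
      have hp : 0 < s' - s := sub_pos.2 h
      exact ⟨(min_le_left _ _).trans ((le_div_iff₀ hp).2 a1),
        ((div_le_iff₀ hp).2 a2).trans (le_max_right _ _)⟩
  exact tendsto_of_tendsto_of_tendsto_of_le_of_le' h1 h2
    (hev.mono fun s' h => (hb s' h.1 h.2).1) (hev.mono fun s' h => (hb s' h.1 h.2).2)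

end Height

/-! ### Densities stacked from balls -/

lemma unitBallVolume_pos (n : ℕ) : 0 < unitBallVolume n := by
  rw [unitBallVolume, measureReal_def, ENNReal.toReal_pos_iff]
  exact ⟨Metric.measure_ball_pos _ _ one_pos, measure_ball_lt_top⟩

/-- The radius of a ball of volume `1 / p` in `ℝⁿ`. -/
def layerRadius (n : ℕ) (p : ℝ) : ℝ := (unitBallVolume n * p) ^ (-(1 / (n : ℝ)))

lemma layerRadius_pos (n : ℕ) {p : ℝ} (hp : 0 < p) : 0 < layerRadius n p :=
  Real.rpow_pos_of_pos (mul_pos (unitBallVolume_pos n) hp) _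

lemma layerRadius_pow {n : ℕ} (hn : 1 ≤ n) {p : ℝ} (hp : 0 < p) :
    layerRadius n p ^ n = (unitBallVolume n * p)⁻¹ := by
  have h0 := mul_pos (unitBallVolume_pos n) hp
  have hn' : (n : ℝ) ≠ 0 := by positivity
  rw [layerRadius, ← Real.rpow_natCast, ← Real.rpow_mul h0.le]
  rw [show -(1 / (n : ℝ)) * n = -1 by field_simp, Real.rpow_neg_one]

lemma volume_ball_eq {n : ℕ} (hn : 1 ≤ n) (x : EuclideanSpace ℝ (Fin n)) {r : ℝ} (hr : 0 ≤ r) :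
    volume (Metric.ball x r) = ENNReal.ofReal (unitBallVolume n * r ^ n) := by
  have : Nonempty (Fin n) := ⟨⟨0, hn⟩⟩
  rw [Measure.addHaar_ball _ _ hr, finrank_euclideanSpace_fin, mul_comm,
    ENNReal.ofReal_mul (unitBallVolume_pos n).le, unitBallVolume, ofReal_measureReal]

lemma volume_layer {n : ℕ} (hn : 1 ≤ n) {p : ℝ} (hp : 0 < p) :
    volume (Metric.ball (0 : EuclideanSpace ℝ (Fin n)) (layerRadius n p))
      = (ENNReal.ofReal p)⁻¹ := by
  rw [volume_ball_eq hn _ (layerRadius_pos n hp).le, layerRadius_pow hn hp, mul_inv,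
    mul_inv_cancel_left₀ (unitBallVolume_pos n).ne', ENNReal.ofReal_inv_of_pos hp]

/-- The density whose layer at mass level `s ∈ (0,1)` has thickness `u s ds` and is carried by the
centred ball of volume `1 / u s`. -/
def stack (n : ℕ) (u : ℝ → ℝ) (x : EuclideanSpace ℝ (Fin n)) : ℝ :=
  ∫ s in Ioo (0 : ℝ) 1,
    (Metric.ball (0 : EuclideanSpace ℝ (Fin n)) (layerRadius n (u s))).indicator (fun _ => u s) x

/-- The functions of the mass variable that occur as slopes of height functions. -/
structure IsSlopeProfile (u : ℝ → ℝ) : Prop where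
  pos : ∀ s, 0 < u s
  measurable : Measurable u
  monotoneOn : MonotoneOn u (Ioo (0 : ℝ) 1)
  integrableOn : IntegrableOn u (Ioo (0 : ℝ) 1)

lemma IsSlopeProfile.interp {u v : ℝ → ℝ} (hu : IsSlopeProfile u) (hv : IsSlopeProfile v)
    {t : ℝ} (ht : t ∈ Icc (0 : ℝ) 1) : IsSlopeProfile (fun s => (1 - t) * u s + t * v s) where
  pos s := by
    rcases ht.1.eq_or_lt with rfl | h
    · simpa using hu.pos s
    · exact add_pos_of_nonneg_of_pos (mul_nonneg (sub_nonneg.2 ht.2) (hu.pos s).le)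
        (mul_pos h (hv.pos s))
  measurable := (hu.measurable.const_mul _).add (hv.measurable.const_mul _)
  monotoneOn s hs s' hs' h := add_le_add
    (mul_le_mul_of_nonneg_left (hu.monotoneOn hs hs' h) (sub_nonneg.2 ht.2))
    (mul_le_mul_of_nonneg_left (hv.monotoneOn hs hs' h) ht.1)
  integrableOn := (hu.integrableOn.const_mul _).add (hv.integrableOn.const_mul _)

section Layers

variable {n : ℕ} {ρ : EuclideanSpace ℝ (Fin n) → ℝ}

lemma norm_lt_layerRadius_iff (hn : 1 ≤ n) {p r : ℝ} (hp : 0 < p) (hr : 0 ≤ r) :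
    r < layerRadius n p ↔ unitBallVolume n * r ^ n < p⁻¹ := by
  rw [← pow_lt_pow_iff_left₀ hr (layerRadius_pos n hp).le (by lia : n ≠ 0),
    layerRadius_pow hn hp, mul_inv, ← div_eq_inv_mul, lt_div_iff₀ (unitBallVolume_pos n), mul_comm]

/-- The superlevel sets of a continuous radially decreasing density are the open balls with the
right volume. -/
lemma mem_layer_iff (hn : 1 ≤ n) (hρ : IsProbDensity ρ) (hc : Continuous ρ)
    (hd : RadiallyDecreasing ρ) {s : ℝ} (hs : s ∈ Ioo (0 : ℝ) 1) (x : EuclideanSpace ℝ (Fin n)) :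
    x ∈ Metric.ball (0 : EuclideanSpace ℝ (Fin n)) (layerRadius n (heightSlope ρ s)) ↔
      heightFunction ρ s < ρ x := by
  set S := {x | heightFunction ρ s < ρ x} with hS
  have hfin : volume S ≠ ⊤ := (volume_superlevel_lt_top hρ (heightFunction_spec hρ hs).1).ne
  rw [mem_ball_zero_iff, norm_lt_layerRadius_iff hn (heightSlope_pos hρ hc s) (norm_nonneg x),
    heightSlope_of_mem hs, inv_inv]
  have hball : ∀ r : ℝ, 0 ≤ r →
      volume.real (Metric.ball (0 : EuclideanSpace ℝ (Fin n)) r) = unitBallVolume n * r ^ n := by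
    intro r hr
    rw [measureReal_def, volume_ball_eq hn _ hr, ENNReal.toReal_ofReal
      (mul_nonneg (unitBallVolume_pos n).le (pow_nonneg hr n))]
  constructor
  · intro h
    by_contra hx
    have hsub : S ⊆ Metric.ball 0 ‖x‖ := by
      intro y hy
      rw [mem_ball_zero_iff]
      by_contra hxy
      exact hx (lt_of_lt_of_le hy (hd x y (not_lt.1 hxy)))
    have := measureReal_mono (μ := volume) hsub measure_ball_lt_top.ne
    rw [hball _ (norm_nonneg x)] at this
    exact absurd h (not_lt.2 this)
  · intro hx
    -- by openness the superlevel set contains a point of strictly larger norm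
    obtain ⟨y, hy, hxy⟩ : ∃ y, heightFunction ρ s < ρ y ∧ ‖x‖ < ‖y‖ := by
      have hopen : IsOpen S := isOpen_lt continuous_const hc
      obtain ⟨ε, hε, hball⟩ := Metric.isOpen_iff.1 hopen x hx
      have : Nonempty (Fin n) := ⟨⟨0, hn⟩⟩
      by_cases h0 : x = 0
      · obtain ⟨e, he⟩ := exists_norm_eq (EuclideanSpace ℝ (Fin n)) (half_pos hε).le
        refine ⟨e, hball ?_, ?_⟩
        · rw [h0, mem_ball_zero_iff, he]; linarith
        · rw [h0, norm_zero, he]; linarith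
      · have hx0 : 0 < ‖x‖ := norm_pos_iff.2 h0
        set δ := ε / (2 * ‖x‖) with hδ
        have hδ0 : 0 < δ := by positivity
        refine ⟨(1 + δ) • x, hball ?_, ?_⟩
        · rw [mem_ball_iff_norm, add_smul, one_smul, add_sub_cancel_left, norm_smul,
            Real.norm_of_nonneg hδ0.le, hδ]
          field_simp
          linarith
        · rw [norm_smul, Real.norm_of_nonneg (by positivity)]
          nlinarith
    have hsub : Metric.ball 0 ‖y‖ ⊆ S := by
      intro z hz
      rw [mem_ball_zero_iff] at hz
      exact lt_of_lt_of_le hy (hd z y hz.le)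
    have := measureReal_mono hsub hfin
    rw [hball _ (norm_nonneg y)] at this
    refine lt_of_lt_of_le ?_ this
    exact mul_lt_mul_of_pos_left (pow_lt_pow_left₀ hxy (norm_nonneg x) (by lia))
      (unitBallVolume_pos n)

lemma exists_heightFunction_eq (hρ : IsProbDensity ρ) (hc : Continuous ρ)
    {x : EuclideanSpace ℝ (Fin n)} {η : ℝ} (hη : 0 < η) (hx : η < ρ x) :
    ∃ s ∈ Ioo (0 : ℝ) 1, heightFunction ρ s = η := by
  have hopen : IsOpen {y | η < ρ y} := isOpen_lt continuous_const hc
  have hpos : 0 < volume {y | η < ρ y} := hopen.measure_pos _ ⟨x, hx⟩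
  have hmem : ∫ y, min (ρ y) η ∈ Ioo (0 : ℝ) 1 := by
    constructor
    · rw [integral_pos_iff_support_of_nonneg (fun y => le_min (hρ.nonneg y) hη.le)
        (hρ.integrable_min hη.le)]
      refine hpos.trans_le (measure_mono fun y hy => ?_)
      exact (lt_min (hη.trans hy) hη).ne'
    · have hint := hρ.integrable.sub (hρ.integrable_min hη.le)
      have : 0 < ∫ y, (ρ y - min (ρ y) η) := by
        rw [integral_pos_iff_support_of_nonneg (fun y => sub_nonneg.2 (min_le_left _ _)) hint]
        refine hpos.trans_le (measure_mono fun y hy => ?_)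
        rw [Function.mem_support, min_eq_right (le_of_lt hy)]
        exact (sub_pos.2 hy).ne'
      rw [integral_sub hρ.integrable (hρ.integrable_min hη.le), hρ.integral_eq_one] at this
      linarith
  exact ⟨_, hmem, (heightFunction_eq_iff hρ hmem hη.le).2 rfl⟩

/-- The layer-cake formula in the mass variable. -/
lemma lintegral_layers (hn : 1 ≤ n) (hρ : IsProbDensity ρ) (hc : Continuous ρ)
    (hd : RadiallyDecreasing ρ) (x : EuclideanSpace ℝ (Fin n)) :
    ∫⁻ s in Ioo (0 : ℝ) 1, (Metric.ball (0 : EuclideanSpace ℝ (Fin n))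
      (layerRadius n (heightSlope ρ s))).indicator
        (fun _ => ENNReal.ofReal (heightSlope ρ s)) x = ENNReal.ofReal (ρ x) := by
  set C := {s | s ∈ Ioo (0 : ℝ) 1 ∧ ¬ ContinuousAt (heightSlope ρ) s} with hCdef
  have hC : C.Countable := countable_discontinuities (heightSlope_monotoneOn hρ hc)
  set I := {s | s ∈ Ioo (0 : ℝ) 1 ∧ heightFunction ρ s < ρ x} with hI
  have hmono : StrictMonoOn (heightFunction ρ) (Ioo (0 : ℝ) 1) :=
    fun s hs s' hs' h => heightFunction_lt hρ hs hs' h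
  have hIm : MeasurableSet I := by
    refine Set.OrdConnected.measurableSet ⟨fun a ha b hb c hcc => ?_⟩
    have hc1 : c ∈ Ioo (0 : ℝ) 1 := ⟨ha.1.1.trans_le hcc.1, hcc.2.trans_lt hb.1.2⟩
    exact ⟨hc1, (hmono.monotoneOn hc1 hb.1 hcc.2).trans_lt hb.2⟩
  have e1 : ∫⁻ s in Ioo (0 : ℝ) 1, (Metric.ball (0 : EuclideanSpace ℝ (Fin n))
      (layerRadius n (heightSlope ρ s))).indicator
        (fun _ => ENNReal.ofReal (heightSlope ρ s)) x
      = ∫⁻ s in I, ENNReal.ofReal (heightSlope ρ s) := by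
    have hII : I = Ioo 0 1 ∩ I := by ext s; simp [hI]
    rw [hII, inter_comm, ← setLIntegral_indicator hIm]
    refine setLIntegral_congr_fun measurableSet_Ioo fun s hs => ?_
    by_cases h : heightFunction ρ s < ρ x
    · rw [indicator_of_mem ((mem_layer_iff hn hρ hc hd hs x).2 h), indicator_of_mem]
      exact ⟨hs, h⟩
    · rw [indicator_of_notMem (fun h' => h ((mem_layer_iff hn hρ hc hd hs x).1 h')),
        indicator_of_notMem]
      exact fun h' => h h'.2
  have e2 : ∫⁻ s in I, ENNReal.ofReal (heightSlope ρ s)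
      = ∫⁻ s in I \ C, ENNReal.ofReal (heightSlope ρ s) * 1 := by
    simp only [mul_one]
    exact setLIntegral_congr (sdiff_null_ae_eq_self (hC.measure_zero _)).symm
  have e3 := lintegral_image_eq_lintegral_deriv_mul_of_monotoneOn (s := I \ C)
    (f := heightFunction ρ) (f' := heightSlope ρ) (hIm.diff hC.measurableSet)
    (fun s hs => ((heightFunction_hasDerivAt hρ hc hs.1.1
      (by by_contra h; exact hs.2 ⟨hs.1.1, h⟩)).hasDerivWithinAt))
    (hmono.monotoneOn.mono fun s hs => hs.1.1) (fun _ => 1)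
  rw [e1, e2, ← e3, setLIntegral_one]
  have himg : heightFunction ρ '' I = Ioo 0 (ρ x) := by
    ext η
    constructor
    · rintro ⟨s, hs, rfl⟩
      exact ⟨(heightFunction_spec hρ hs.1).1, hs.2⟩
    · rintro ⟨h1, h2⟩
      obtain ⟨s, hs, rfl⟩ := exists_heightFunction_eq hρ hc h1 h2
      exact ⟨s, ⟨hs, h2⟩, rfl⟩
  have hdiff : heightFunction ρ '' (I \ C) = Ioo 0 (ρ x) \ heightFunction ρ '' (I ∩ C) := by
    rw [← himg, ← InjOn.image_sdiff_subset (f := heightFunction ρ) (s := I)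
      (hmono.injOn.mono fun s hs => hs.1) inter_subset_left, sdiff_self_inter]
  rw [hdiff, measure_sdiff_null ((hC.mono inter_subset_right).image _ |>.measure_zero _),
    Real.volume_Ioo, sub_zero]

lemma measurable_layerRadius (n : ℕ) : Measurable (layerRadius n) :=
  (measurable_const.mul measurable_id).pow_const _

lemma layer_indicator_eq {β : Type*} [Zero β] (u : ℝ → ℝ) (f : ℝ → β)
    (x : EuclideanSpace ℝ (Fin n)) :
    (fun s => (Metric.ball (0 : EuclideanSpace ℝ (Fin n)) (layerRadius n (u s))).indicator
      (fun _ => f s) x) = {s | ‖x‖ < layerRadius n (u s)}.indicator f := by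
  funext s
  simp [indicator]

lemma IsSlopeProfile.integrableOn_layers {u : ℝ → ℝ} (hu : IsSlopeProfile u)
    (x : EuclideanSpace ℝ (Fin n)) : IntegrableOn (fun s =>
      (Metric.ball (0 : EuclideanSpace ℝ (Fin n)) (layerRadius n (u s))).indicator
        (fun _ => u s) x) (Ioo (0 : ℝ) 1) := by
  rw [layer_indicator_eq]
  exact hu.integrableOn.indicator
    (measurableSet_lt measurable_const ((measurable_layerRadius n).comp hu.measurable))

lemma IsSlopeProfile.stack_nonneg {u : ℝ → ℝ} (hu : IsSlopeProfile u)
    (x : EuclideanSpace ℝ (Fin n)) : 0 ≤ stack n u x :=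
  integral_nonneg fun s => indicator_nonneg (fun _ _ => (hu.pos s).le) x

lemma ofReal_stack {u : ℝ → ℝ} (hu : IsSlopeProfile u) (x : EuclideanSpace ℝ (Fin n)) :
    ENNReal.ofReal (stack n u x) = ∫⁻ s in Ioo (0 : ℝ) 1,
      (Metric.ball (0 : EuclideanSpace ℝ (Fin n)) (layerRadius n (u s))).indicator
        (fun _ => ENNReal.ofReal (u s)) x := by
  rw [stack, ofReal_integral_eq_lintegral_ofReal (hu.integrableOn_layers x)
    (ae_of_all _ fun s => indicator_nonneg (fun _ _ => (hu.pos s).le) x)]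
  refine lintegral_congr fun s => ?_
  by_cases h : x ∈ Metric.ball (0 : EuclideanSpace ℝ (Fin n)) (layerRadius n (u s))
  · simp only [indicator_of_mem h]
  · simp only [indicator_of_notMem h, ENNReal.ofReal_zero]

lemma isSlopeProfile_heightSlope (hn : 1 ≤ n) (hρ : IsProbDensity ρ) (hc : Continuous ρ)
    (hd : RadiallyDecreasing ρ) : IsSlopeProfile (heightSlope ρ) where
  pos := heightSlope_pos hρ hc
  measurable := heightSlope_measurable hρ hc
  monotoneOn := heightSlope_monotoneOn hρ hc
  integrableOn := by
    refine ⟨(heightSlope_measurable hρ hc).aestronglyMeasurable, ?_⟩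
    rw [hasFiniteIntegral_iff_ofReal (ae_of_all _ fun s => (heightSlope_pos hρ hc s).le)]
    -- every layer contains the origin, so that the total thickness is the maximum of the density
    have h := lintegral_layers hn hρ hc hd 0
    have h' : ∀ s, (0 : EuclideanSpace ℝ (Fin n)) ∈ Metric.ball
        (0 : EuclideanSpace ℝ (Fin n)) (layerRadius n (heightSlope ρ s)) := fun s =>
      Metric.mem_ball_self (layerRadius_pos n (heightSlope_pos hρ hc s))
    simp only [indicator_of_mem (h' _)] at h
    rw [h]
    exact ENNReal.ofReal_lt_top

lemma stack_heightSlope (hn : 1 ≤ n) (hρ : IsProbDensity ρ) (hc : Continuous ρ)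
    (hd : RadiallyDecreasing ρ) : stack n (heightSlope ρ) = ρ := by
  have hu := isSlopeProfile_heightSlope hn hρ hc hd
  funext x
  rw [← ENNReal.ofReal_eq_ofReal_iff (hu.stack_nonneg x) (hρ.nonneg x), ofReal_stack hu,
    lintegral_layers hn hρ hc hd]

lemma interp_eq_stack {ρ₀ ρ₁ : EuclideanSpace ℝ (Fin n) → ℝ} (h₀ : IsProbDensity ρ₀)
    (h₁ : IsProbDensity ρ₁) (hc₀ : Continuous ρ₀) (hc₁ : Continuous ρ₁) (t : ℝ) :
    interp ρ₀ ρ₁ t = stack n (fun s => (1 - t) * heightSlope ρ₀ s + t * heightSlope ρ₁ s) := by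
  funext x
  have hC₀ := (countable_discontinuities (heightSlope_monotoneOn h₀ hc₀)).ae_notMem volume
  have hC₁ := (countable_discontinuities (heightSlope_monotoneOn h₁ hc₁)).ae_notMem volume
  refine setIntegral_congr_ae measurableSet_Ioo ?_
  filter_upwards [hC₀, hC₁] with s hs₀ hs₁ hs
  have d₀ := heightFunction_hasDerivAt h₀ hc₀ hs (by by_contra h; exact hs₀ ⟨hs, h⟩)
  have d₁ := heightFunction_hasDerivAt h₁ hc₁ hs (by by_contra h; exact hs₁ ⟨hs, h⟩)
  have d : deriv (interpHeight ρ₀ ρ₁ t) s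
      = (1 - t) * heightSlope ρ₀ s + t * heightSlope ρ₁ s :=
    ((d₀.const_mul (1 - t)).add (d₁.const_mul t)).deriv
  rw [d]
  rfl

end Layers

/-! ### The entropy of a stacked density -/

/-- The height at mass level `s` of the density stacked from `u`, as a function monotone on all of
`ℝ`: the integral of `u` over `(0,1) ∩ (-∞,s)`. -/
def stackHeight (u : ℝ → ℝ) (s : ℝ) : ℝ := ∫ r in Ioo (0 : ℝ) 1 ∩ Iio s, u r

section Entropy

variable {n : ℕ} {u v : ℝ → ℝ}

lemma stackHeight_eq {s : ℝ} (hs : s ∈ Icc (0 : ℝ) 1) :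
    stackHeight u s = ∫ r in (0 : ℝ)..s, u r := by
  rw [stackHeight, intervalIntegral.integral_of_le hs.1, integral_Ioc_eq_integral_Ioo,
    Ioo_inter_Iio, min_eq_right hs.2]

lemma IsSlopeProfile.stackHeight_monotone (hu : IsSlopeProfile u) : Monotone (stackHeight u) := by
  intro a b hab
  refine setIntegral_mono_set (hu.integrableOn.mono_set inter_subset_left)
    (ae_of_all _ fun s => (hu.pos s).le) ?_
  exact (inter_subset_inter_right _ (Iio_subset_Iio hab)).eventuallyLE

lemma IsSlopeProfile.stackHeight_nonneg (hu : IsSlopeProfile u) (s : ℝ) : 0 ≤ stackHeight u s :=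
  integral_nonneg fun s => (hu.pos s).le

lemma IsSlopeProfile.integrableOn_Icc (hu : IsSlopeProfile u) : IntegrableOn u (Icc (0 : ℝ) 1) :=
  (integrableOn_Icc_iff_integrableOn_Ioo (by simp) (by simp)).2 hu.integrableOn

lemma IsSlopeProfile.intervalIntegrable (hu : IsSlopeProfile u) {s : ℝ} (hs : s ∈ Icc (0 : ℝ) 1) :
    IntervalIntegrable u volume 0 s := by
  rw [intervalIntegrable_iff_integrableOn_Icc_of_le hs.1]
  exact hu.integrableOn_Icc.mono_set (Icc_subset_Icc_right hs.2)

lemma IsSlopeProfile.stackHeight_continuousOn (hu : IsSlopeProfile u) :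
    ContinuousOn (stackHeight u) (Icc 0 1) := by
  have h := intervalIntegral.continuousOn_primitive_interval (μ := volume) (f := u)
    (a := 0) (b := 1) (by rw [uIcc_of_le zero_le_one]; exact hu.integrableOn_Icc)
  rw [uIcc_of_le zero_le_one] at h
  exact h.congr fun s hs => stackHeight_eq hs

lemma IsSlopeProfile.stackHeight_hasDerivAt (hu : IsSlopeProfile u) {s : ℝ}
    (hs : s ∈ Ioo (0 : ℝ) 1) (hc : ContinuousAt u s) : HasDerivAt (stackHeight u) (u s) s := by
  have h := intervalIntegral.integral_hasDerivAt_right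
    (hu.intervalIntegrable (Ioo_subset_Icc_self hs))
    (hu.measurable.stronglyMeasurable.stronglyMeasurableAtFilter) hc
  refine h.congr_of_eventuallyEq ?_
  filter_upwards [Ioo_mem_nhds hs.1 hs.2] with r hr
  exact stackHeight_eq (Ioo_subset_Icc_self hr)

/-- The fundamental theorem of calculus for the power `h ^ m` of the stacked height. Its derivative
exists off the countable set of jumps of `u`, which suffices since `h` is continuous. -/
lemma IsSlopeProfile.rpow_stackHeight (hu : IsSlopeProfile u) {m : ℝ} (hm : 2 ≤ m) {σ : ℝ}
    (hσ : σ ∈ Icc (0 : ℝ) 1) :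
    IntegrableOn (fun s => m * stackHeight u s ^ (m - 1) * u s) (Ioo 0 σ) ∧
    ∫ s in Ioo 0 σ, m * stackHeight u s ^ (m - 1) * u s = stackHeight u σ ^ m := by
  have hcont : ContinuousOn (stackHeight u) (Icc 0 σ) :=
    hu.stackHeight_continuousOn.mono (Icc_subset_Icc_right hσ.2)
  have hint : IntervalIntegrable (fun s => m * stackHeight u s ^ (m - 1) * u s) volume 0 σ := by
    refine (hu.intervalIntegrable hσ).continuousOn_mul ?_
    rw [uIcc_of_le hσ.1]
    exact (hcont.rpow_const fun s _ => Or.inr (by linarith)).const_mul m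
  refine ⟨((intervalIntegrable_iff_integrableOn_Ioo_of_le hσ.1).1 hint), ?_⟩
  have h := integral_eq_of_hasDerivAt_off_countable_of_le (fun s => stackHeight u s ^ m)
    (fun s => m * stackHeight u s ^ (m - 1) * u s) hσ.1
    (countable_discontinuities hu.monotoneOn)
    (hcont.rpow_const fun s _ => Or.inr (by linarith)) ?_ hint
  · rw [← integral_Ioc_eq_integral_Ioo, ← intervalIntegral.integral_of_le hσ.1, h,
      stackHeight_eq ⟨le_rfl, zero_le_one⟩, intervalIntegral.integral_same,
      Real.zero_rpow (by linarith), sub_zero]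
  · rintro s ⟨hs, hs'⟩
    have hs1 : s ∈ Ioo (0 : ℝ) 1 := ⟨hs.1, hs.2.trans_le hσ.2⟩
    have hd := (hu.stackHeight_hasDerivAt hs1
      (by by_contra h; exact hs' ⟨hs1, h⟩)).rpow_const (p := m) (Or.inr (by linarith))
    exact hd.congr_deriv (by ring)

lemma layerRadius_antitone {p q : ℝ} (hp : 0 < p) (hpq : p ≤ q) :
    layerRadius n q ≤ layerRadius n p :=
  Real.rpow_le_rpow_of_nonpos (mul_pos (unitBallVolume_pos n) hp)
    (mul_le_mul_of_nonneg_left hpq (unitBallVolume_pos n).le)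
    (neg_nonpos.2 (by positivity))

/-- The layers through a given point are those below some mass level. -/
lemma IsSlopeProfile.exists_level (hu : IsSlopeProfile u) (x : EuclideanSpace ℝ (Fin n)) :
    ∃ σ ∈ Icc (0 : ℝ) 1,
      (Ioo (0 : ℝ) 1 ∩ {s | ‖x‖ < layerRadius n (u s)} : Set ℝ) =ᵐ[volume] Ioo 0 σ := by
  set I := Ioo (0 : ℝ) 1 ∩ {s | ‖x‖ < layerRadius n (u s)} with hI
  have hbdd : BddAbove (insert 0 I) := ⟨1, by
    rintro s (rfl | hs)
    · exact zero_le_one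
    · exact hs.1.2.le⟩
  set σ := sSup (insert 0 I)
  have hσ0 : 0 ≤ σ := le_csSup hbdd (mem_insert _ _)
  have hσ1 : σ ≤ 1 := csSup_le (insert_nonempty _ _) (by
    rintro s (rfl | hs)
    · exact zero_le_one
    · exact hs.1.2.le)
  refine ⟨σ, ⟨hσ0, hσ1⟩, ?_⟩
  have h1 : I ⊆ Ioc 0 σ := fun s hs => ⟨hs.1.1, le_csSup hbdd (mem_insert_of_mem _ hs)⟩
  have h2 : Ioo 0 σ ⊆ I := by
    rintro s ⟨hs0, hs1⟩
    obtain ⟨r, hr, hsr⟩ := exists_lt_of_lt_csSup (insert_nonempty _ _) hs1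
    rcases hr with rfl | hr
    · exact absurd hs0 hsr.not_gt
    · have hs : s ∈ Ioo (0 : ℝ) 1 := ⟨hs0, hsr.trans hr.1.2⟩
      exact ⟨hs, lt_of_lt_of_le hr.2
        (layerRadius_antitone (hu.pos s) (hu.monotoneOn hs hr.1 hsr.le))⟩
  exact (h1.eventuallyLE.trans Ioo_ae_eq_Ioc.symm.le).antisymm h2.eventuallyLE

/-- The layers through `x` are those of mass levels in some interval `(0,σ)`, so that the value of
the stacked density at `x` is the height at `σ`, and its power is an integral over the same
layers. -/
lemma IsSlopeProfile.ofReal_stack_rpow (hu : IsSlopeProfile u) {m : ℝ} (hm : 2 ≤ m)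
    (x : EuclideanSpace ℝ (Fin n)) :
    ENNReal.ofReal (stack n u x ^ m) = ∫⁻ s in Ioo (0 : ℝ) 1,
      (Metric.ball (0 : EuclideanSpace ℝ (Fin n)) (layerRadius n (u s))).indicator
        (fun _ => ENNReal.ofReal (m * stackHeight u s ^ (m - 1) * u s)) x := by
  obtain ⟨σ, hσ, hae⟩ := hu.exists_level x
  have hmeas : MeasurableSet {s | ‖x‖ < layerRadius n (u s)} :=
    measurableSet_lt measurable_const ((measurable_layerRadius n).comp hu.measurable)
  have e1 : stack n u x = stackHeight u σ := by
    rw [stack, layer_indicator_eq, setIntegral_indicator hmeas, setIntegral_congr_set hae,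
      stackHeight, Ioo_inter_Iio, min_eq_right hσ.2]
  obtain ⟨h1, h2⟩ := hu.rpow_stackHeight hm hσ
  rw [e1, ← h2, ofReal_integral_eq_lintegral_ofReal h1 (ae_of_all _ fun s =>
      mul_nonneg (mul_nonneg (by linarith) (Real.rpow_nonneg (hu.stackHeight_nonneg s) _))
        (hu.pos s).le), layer_indicator_eq u
      (fun s => ENNReal.ofReal (m * stackHeight u s ^ (m - 1) * u s)), setLIntegral_indicator hmeas,
      inter_comm, setLIntegral_congr hae]

lemma measurable_layers {f : ℝ → ENNReal} (hu : Measurable u) (hf : Measurable f) :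
    Measurable (fun z : EuclideanSpace ℝ (Fin n) × ℝ =>
      (Metric.ball (0 : EuclideanSpace ℝ (Fin n)) (layerRadius n (u z.2))).indicator
        (fun _ => f z.2) z.1) := by
  have h : MeasurableSet {z : EuclideanSpace ℝ (Fin n) × ℝ | ‖z.1‖ < layerRadius n (u z.2)} :=
    measurableSet_lt measurable_fst.norm
      ((measurable_layerRadius n).comp (hu.comp measurable_snd))
  convert (hf.comp measurable_snd).indicator h using 1
  funext z
  simp [indicator]

/-- In the mass variable the entropy becomes a convex functional of the height function. -/
lemma IsSlopeProfile.entropy_stack (hn : 1 ≤ n) (hu : IsSlopeProfile u) {m : ℝ} (hm : 2 ≤ m) :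
    entropy m (stack n u) = ENNReal.ofReal (1 / (m - 1)) *
      ∫⁻ s in Ioo (0 : ℝ) 1, ENNReal.ofReal (m * stackHeight u s ^ (m - 1)) := by
  have hmeas : Measurable (fun s => ENNReal.ofReal (m * stackHeight u s ^ (m - 1) * u s)) :=
    (((hu.stackHeight_monotone.measurable.pow_const _).const_mul m).mul
      hu.measurable).ennreal_ofReal
  rw [entropy]
  congr 1
  simp_rw [hu.ofReal_stack_rpow hm]
  rw [lintegral_lintegral_swap (measurable_layers hu.measurable hmeas).aemeasurable]
  refine lintegral_congr fun s => ?_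
  rw [lintegral_indicator_const measurableSet_ball, volume_layer hn (hu.pos s),
    ENNReal.ofReal_mul (mul_nonneg (by linarith) (Real.rpow_nonneg (hu.stackHeight_nonneg s) _)),
    mul_assoc, ENNReal.mul_inv_cancel (ENNReal.ofReal_pos.2 (hu.pos s)).ne' ENNReal.ofReal_ne_top,
    mul_one]

lemma IsSlopeProfile.integrableOn_rpow_stackHeight (hu : IsSlopeProfile u) {m : ℝ} (hm : 2 ≤ m) :
    IntegrableOn (fun s => m * stackHeight u s ^ (m - 1)) (Ioo (0 : ℝ) 1) := by
  have : ContinuousOn (fun s => m * stackHeight u s ^ (m - 1)) (Icc (0 : ℝ) 1) :=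
    (hu.stackHeight_continuousOn.rpow_const fun s _ => Or.inr (by linarith)).const_mul m
  exact (this.integrableOn_compact isCompact_Icc).mono_set Ioo_subset_Icc_self

lemma IsSlopeProfile.entropy_stack_eq_ofReal (hn : 1 ≤ n) (hu : IsSlopeProfile u) {m : ℝ}
    (hm : 2 ≤ m) : entropy m (stack n u) =
      ENNReal.ofReal (1 / (m - 1) * ∫ s in Ioo (0 : ℝ) 1, m * stackHeight u s ^ (m - 1)) := by
  rw [hu.entropy_stack hn hm, ENNReal.ofReal_mul (one_div_nonneg.2 (by linarith)),
    ofReal_integral_eq_lintegral_ofReal (hu.integrableOn_rpow_stackHeight hm)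
      (ae_of_all _ fun s => mul_nonneg (by linarith)
        (Real.rpow_nonneg (hu.stackHeight_nonneg s) _))]

lemma IsSlopeProfile.entropy_ne_top (hn : 1 ≤ n) (hu : IsSlopeProfile u) {m : ℝ}
    (hm : 2 ≤ m) : entropy m (stack n u) ≠ ⊤ := by
  rw [hu.entropy_stack_eq_ofReal hn hm]
  exact ENNReal.ofReal_ne_top

lemma stackHeight_interp (hu : IsSlopeProfile u) (hv : IsSlopeProfile v) (t s : ℝ) :
    stackHeight (fun s => (1 - t) * u s + t * v s) s
      = (1 - t) * stackHeight u s + t * stackHeight v s := by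
  rw [stackHeight, integral_add ((hu.integrableOn.mono_set inter_subset_left).const_mul _)
    ((hv.integrableOn.mono_set inter_subset_left).const_mul _), integral_const_mul,
    integral_const_mul]
  rfl

lemma IsSlopeProfile.entropy_interp_le (hn : 1 ≤ n) (hu : IsSlopeProfile u)
    (hv : IsSlopeProfile v) {m : ℝ} (hm : 2 ≤ m) {t : ℝ} (ht : t ∈ Icc (0 : ℝ) 1) :
    (entropy m (stack n fun s => (1 - t) * u s + t * v s)).toReal ≤
      (1 - t) * (entropy m (stack n u)).toReal + t * (entropy m (stack n v)).toReal := by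
  have hm1 : 0 ≤ 1 / (m - 1) := one_div_nonneg.2 (by linarith)
  have hnn : ∀ {w : ℝ → ℝ}, IsSlopeProfile w →
      0 ≤ 1 / (m - 1) * ∫ s in Ioo (0 : ℝ) 1, m * stackHeight w s ^ (m - 1) := fun hw =>
    mul_nonneg hm1 (integral_nonneg fun s => mul_nonneg (by linarith)
      (Real.rpow_nonneg (hw.stackHeight_nonneg s) _))
  have hw := hu.interp hv ht
  rw [hw.entropy_stack_eq_ofReal hn hm, hu.entropy_stack_eq_ofReal hn hm,
    hv.entropy_stack_eq_ofReal hn hm, ENNReal.toReal_ofReal (hnn hw),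
    ENNReal.toReal_ofReal (hnn hu), ENNReal.toReal_ofReal (hnn hv)]
  have h : ∫ s in Ioo (0 : ℝ) 1, m * stackHeight (fun s => (1 - t) * u s + t * v s) s ^ (m - 1)
      ≤ ∫ s in Ioo (0 : ℝ) 1, ((1 - t) * (m * stackHeight u s ^ (m - 1))
        + t * (m * stackHeight v s ^ (m - 1))) := by
    refine integral_mono (hw.integrableOn_rpow_stackHeight hm)
      (((hu.integrableOn_rpow_stackHeight hm).const_mul _).add
        ((hv.integrableOn_rpow_stackHeight hm).const_mul _)) fun s => ?_
    -- this is where the exponent `m ≥ 2` enters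
    have hconv := (convexOn_rpow (p := m - 1) (by linarith)).2 (hu.stackHeight_nonneg s)
      (hv.stackHeight_nonneg s) (sub_nonneg.2 ht.2) ht.1 (by ring)
    simp only [smul_eq_mul] at hconv
    simp only [stackHeight_interp hu hv]
    have := mul_le_mul_of_nonneg_left hconv (show (0 : ℝ) ≤ m by linarith)
    linarith
  rw [integral_add ((hu.integrableOn_rpow_stackHeight hm).const_mul _)
        ((hv.integrableOn_rpow_stackHeight hm).const_mul _), integral_const_mul (1 - t),
    integral_const_mul t] at h
  have := mul_le_mul_of_nonneg_left h hm1
  linarith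

end Entropy

/-! ### Polar coordinates and slices -/

lemma lintegral_fun_norm {n : ℕ} (hn : 1 ≤ n) {g : ℝ → ENNReal} (hg : Measurable g) :
    ∫⁻ z : EuclideanSpace ℝ (Fin n), g ‖z‖ = ENNReal.ofReal (n * unitBallVolume n) *
      ∫⁻ r in Ioi (0 : ℝ), ENNReal.ofReal (r ^ (n - 1)) * g r := by
  have : Nonempty (Fin n) := ⟨⟨0, hn⟩⟩
  set E := EuclideanSpace ℝ (Fin n)
  let μ : Measure E := volume
  calc
    ∫⁻ z : E, g ‖z‖ = ∫⁻ x : ({(0)}ᶜ : Set E), g (‖x.1‖) ∂(μ.comap (↑)) := by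
      rw [lintegral_subtype_comap (measurableSet_singleton (0 : E)).compl (fun x : E => g ‖x‖),
        restrict_compl_singleton]
    _ = ∫⁻ x, g x.2 ∂μ.toSphere.prod (.volumeIoiPow (Module.finrank ℝ E - 1)) := by
      simpa using (μ.measurePreserving_homeomorphUnitSphereProd.lintegral_comp_emb
        (Homeomorph.measurableEmbedding _) (fun p => g (p.2 : ℝ)))
    _ = μ.toSphere univ * ∫⁻ x : Ioi (0 : ℝ), g x ∂.volumeIoiPow (Module.finrank ℝ E - 1) := by
      have hg' : Measurable fun x : Ioi (0 : ℝ) => g x := hg.comp measurable_subtype_coe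
      rw [lintegral_prod (fun x : Metric.sphere (0 : E) 1 × Ioi (0 : ℝ) => g x.2)
        (hg'.comp measurable_snd).aemeasurable]
      dsimp only
      rw [lintegral_const, mul_comm]
    _ = _ := by
      have hg' : Measurable fun x : Ioi (0 : ℝ) => g x := hg.comp measurable_subtype_coe
      rw [μ.toSphere_apply_univ, Measure.volumeIoiPow, lintegral_withDensity_eq_lintegral_mul _
        (measurable_subtype_coe.pow_const _).ennreal_ofReal hg']
      simp only [Pi.mul_apply]
      rw [lintegral_subtype_comap measurableSet_Ioi
        (fun r : ℝ => ENNReal.ofReal (r ^ (Module.finrank ℝ E - 1)) * g r),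
        finrank_euclideanSpace_fin, ENNReal.ofReal_mul (Nat.cast_nonneg n), ENNReal.ofReal_natCast,
        unitBallVolume, ofReal_measureReal]

/-- The volume of a ball of `ℝᵐ` as a function of its squared radius, up to the constant `c_m`;
for `m = 0` this is the indicator function of `(0,∞)`. -/
def sliceVolume (m : ℕ) (c : ℝ) : ℝ := (Ioi (0 : ℝ)).indicator (fun c => √c ^ m) c

lemma sliceVolume_nonneg (m : ℕ) (c : ℝ) : 0 ≤ sliceVolume m c :=
  indicator_nonneg (fun c _ => pow_nonneg (Real.sqrt_nonneg c) m) c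

lemma measurable_sliceVolume (m : ℕ) : Measurable (sliceVolume m) :=
  (Real.continuous_sqrt.measurable.pow_const m).indicator measurableSet_Ioi

lemma sliceVolume_of_pos (m : ℕ) {c : ℝ} (hc : 0 < c) : sliceVolume m c = √c ^ m :=
  indicator_of_mem hc _

lemma sliceVolume_of_nonpos (m : ℕ) {c : ℝ} (hc : c ≤ 0) : sliceVolume m c = 0 :=
  indicator_of_notMem (not_lt.2 hc) _

lemma sliceVolume_sq (m : ℕ) {r : ℝ} (hr : 0 < r) : sliceVolume m (r ^ 2) = r ^ m := by
  rw [sliceVolume_of_pos m (by positivity), Real.sqrt_sq hr.le]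

lemma continuousAt_sliceVolume (m : ℕ) {c : ℝ} (hc : c ≠ 0) : ContinuousAt (sliceVolume m) c := by
  rcases hc.lt_or_gt with h | h
  · refine (continuousAt_const (y := (0 : ℝ))).congr ?_
    filter_upwards [Iio_mem_nhds h] with x hx
    exact (sliceVolume_of_nonpos m (le_of_lt hx)).symm
  · refine (Real.continuous_sqrt.pow m).continuousAt.congr ?_
    filter_upwards [Ioi_mem_nhds h] with x hx
    exact (sliceVolume_of_pos m hx).symm

lemma sliceVolume_mono (m : ℕ) : Monotone (sliceVolume m) := by
  intro a b hab
  rcases le_or_gt a 0 with ha | ha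
  · rw [sliceVolume_of_nonpos m ha]; exact sliceVolume_nonneg m b
  · rw [sliceVolume_of_pos m ha, sliceVolume_of_pos m (ha.trans_le hab)]
    exact pow_le_pow_left₀ (Real.sqrt_nonneg a) (Real.sqrt_le_sqrt hab) m

lemma volume_sum_sq_lt (m : ℕ) (c : ℝ) :
    volume {y : Fin m → ℝ | ∑ i, y i ^ 2 < c}
      = ENNReal.ofReal (unitBallVolume m * sliceVolume m c) := by
  rcases le_or_gt c 0 with hc | hc
  · rw [sliceVolume_of_nonpos m hc, mul_zero, ENNReal.ofReal_zero]
    convert measure_empty (μ := volume)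
    refine eq_empty_of_forall_notMem fun y hy => ?_
    have : 0 ≤ ∑ i, y i ^ 2 := Finset.sum_nonneg fun i _ => sq_nonneg _
    exact absurd (this.trans_lt hy) hc.not_gt
  · have h := (EuclideanSpace.volume_preserving_symm_measurableEquiv_toLp (Fin m)).measure_preimage
      (s := {y : Fin m → ℝ | ∑ i, y i ^ 2 < c}) (measurableSet_lt
        (Finset.measurable_sum _ fun i _ => (measurable_pi_apply i).pow_const 2)
        measurable_const).nullMeasurableSet
    have h2 : (MeasurableEquiv.toLp 2 (Fin m → ℝ)).symm ⁻¹' {y : Fin m → ℝ | ∑ i, y i ^ 2 < c}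
        = Metric.ball (0 : EuclideanSpace ℝ (Fin m)) (√c) := by
      ext y
      rw [mem_ball_zero_iff, Real.lt_sqrt (norm_nonneg y), EuclideanSpace.real_norm_sq_eq]
      rfl
    rw [← h, h2, Measure.addHaar_ball_of_pos _ _ (Real.sqrt_pos.2 hc), finrank_euclideanSpace_fin,
      sliceVolume_of_pos m hc, mul_comm, ENNReal.ofReal_mul (unitBallVolume_pos m).le,
      unitBallVolume, ofReal_measureReal]

/-- The volume of the intersection of two balls in `ℝᵐ⁺¹`, up to the constant `c_m`, by slices
orthogonal to the line through the centres: `a`, `b` are the radii and `r` is the distance of the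
centres. -/
def lensVolume (m : ℕ) (a b r : ℝ) : ℝ :=
  ∫ x : ℝ, sliceVolume m (min (a ^ 2 - x ^ 2) (b ^ 2 - (x - r) ^ 2))

lemma integrable_slice (m : ℕ) (a : ℝ) : Integrable fun x : ℝ => sliceVolume m (a ^ 2 - x ^ 2) := by
  have hm : Measurable fun x : ℝ => sliceVolume m (a ^ 2 - x ^ 2) :=
    (measurable_sliceVolume m).comp (by fun_prop)
  refine Integrable.mono' (g := (Icc (-|a|) |a|).indicator fun _ => |a| ^ m) ?_
    hm.aestronglyMeasurable (ae_of_all _ fun x => ?_)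
  · exact (integrable_indicator_iff measurableSet_Icc).2 (integrableOn_const (by simp))
  · rw [Real.norm_of_nonneg (sliceVolume_nonneg m _)]
    by_cases hx : x ∈ Icc (-|a|) |a|
    · rw [indicator_of_mem hx]
      rcases le_or_gt (a ^ 2 - x ^ 2) 0 with h | h
      · rw [sliceVolume_of_nonpos m h]; positivity
      · rw [sliceVolume_of_pos m h]
        refine pow_le_pow_left₀ (Real.sqrt_nonneg _) ?_ m
        rw [← Real.sqrt_sq_eq_abs]
        exact Real.sqrt_le_sqrt (by nlinarith)
    · rw [indicator_of_notMem hx, sliceVolume_of_nonpos]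
      by_contra h
      push Not at h
      exact hx (abs_le.1 (sq_le_sq.1 (by linarith)))

lemma integrable_lens (m : ℕ) (a b r : ℝ) :
    Integrable fun x : ℝ => sliceVolume m (min (a ^ 2 - x ^ 2) (b ^ 2 - (x - r) ^ 2)) := by
  have hm : Measurable fun x : ℝ => sliceVolume m (min (a ^ 2 - x ^ 2) (b ^ 2 - (x - r) ^ 2)) :=
    (measurable_sliceVolume m).comp (by fun_prop)
  refine (integrable_slice m a).mono' hm.aestronglyMeasurable (ae_of_all _ fun x => ?_)
  rw [Real.norm_of_nonneg (sliceVolume_nonneg m _)]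
  exact sliceVolume_mono m (min_le_left _ _)

lemma volume_ball_inter_axis (m : ℕ) {a b : ℝ} (ha : 0 < a) (hb : 0 < b) (r : ℝ) :
    volume (Metric.ball (0 : EuclideanSpace ℝ (Fin (m + 1))) a ∩
      Metric.ball (EuclideanSpace.single 0 r) b)
      = ENNReal.ofReal (unitBallVolume m * lensVolume m a b r) := by
  set S : Set (ℝ × (Fin m → ℝ)) :=
    {p | ∑ i, p.2 i ^ 2 < min (a ^ 2 - p.1 ^ 2) (b ^ 2 - (p.1 - r) ^ 2)} with hS
  have hSm : MeasurableSet S := by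
    refine measurableSet_lt (Finset.measurable_sum _ fun i _ => ?_) (by fun_prop)
    exact ((measurable_pi_apply i).comp measurable_snd).pow_const 2
  have hmp := ((volume_preserving_piFinSuccAbove (fun _ : Fin (m + 1) => ℝ) 0).comp
    (EuclideanSpace.volume_preserving_symm_measurableEquiv_toLp (Fin (m + 1))))
  have h1 := hmp.measure_preimage hSm.nullMeasurableSet
  have h2 : (MeasurableEquiv.piFinSuccAbove (fun _ : Fin (m + 1) => ℝ) 0 ∘
      (MeasurableEquiv.toLp 2 (Fin (m + 1) → ℝ)).symm) ⁻¹' S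
      = Metric.ball (0 : EuclideanSpace ℝ (Fin (m + 1))) a ∩
        Metric.ball (EuclideanSpace.single 0 r) b := by
    ext x
    have e1 : ‖x‖ ^ 2 = x 0 ^ 2 + ∑ i : Fin m, x i.succ ^ 2 := by
      rw [EuclideanSpace.real_norm_sq_eq, Fin.sum_univ_succ]
    have e2 : ‖x - EuclideanSpace.single 0 r‖ ^ 2 = (x 0 - r) ^ 2 + ∑ i : Fin m, x i.succ ^ 2 := by
      rw [EuclideanSpace.real_norm_sq_eq, Fin.sum_univ_succ]
      simp
    rw [mem_inter_iff, mem_ball_zero_iff, mem_ball_iff_norm,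
      ← pow_lt_pow_iff_left₀ (norm_nonneg x) ha.le two_ne_zero,
      ← pow_lt_pow_iff_left₀ (norm_nonneg (x - _)) hb.le two_ne_zero, e1, e2]
    change (∑ i : Fin m, x i.succ ^ 2 < min (a ^ 2 - x 0 ^ 2) (b ^ 2 - (x 0 - r) ^ 2)) ↔ _
    rw [lt_min_iff]
    constructor <;> rintro ⟨h, h'⟩ <;> constructor <;> linarith
  rw [h2] at h1
  rw [h1, Measure.volume_eq_prod, Measure.prod_apply hSm]
  have h3 : ∀ x : ℝ, volume (Prod.mk x ⁻¹' S) = ENNReal.ofReal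
      (unitBallVolume m * sliceVolume m (min (a ^ 2 - x ^ 2) (b ^ 2 - (x - r) ^ 2))) := fun x =>
    volume_sum_sq_lt m (min (a ^ 2 - x ^ 2) (b ^ 2 - (x - r) ^ 2))
  simp_rw [h3]
  rw [← ofReal_integral_eq_lintegral_ofReal ((integrable_lens m a b r).const_mul _)
    (ae_of_all _ fun x => mul_nonneg (unitBallVolume_pos m).le (sliceVolume_nonneg m _)),
    integral_const_mul]
  rfl

lemma volume_ball_inter (m : ℕ) {a b : ℝ} (ha : 0 < a) (hb : 0 < b)
    (z : EuclideanSpace ℝ (Fin (m + 1))) :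
    volume (Metric.ball (0 : EuclideanSpace ℝ (Fin (m + 1))) a ∩ Metric.ball z b)
      = ENNReal.ofReal (unitBallVolume m * lensVolume m a b ‖z‖) := by
  -- a reflection moves the centre `z` to the first coordinate axis
  set e : EuclideanSpace ℝ (Fin (m + 1)) := EuclideanSpace.single 0 ‖z‖
  have he : ‖z‖ = ‖e‖ := by simp [e]
  set A := Submodule.reflection (Submodule.span ℝ {z - e})ᗮ
  have hA : A z = e := Submodule.reflection_sub he
  have h1 := A.measurePreserving.measure_preimage
    (measurableSet_ball.inter measurableSet_ball : MeasurableSet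
      (Metric.ball (0 : EuclideanSpace ℝ (Fin (m + 1))) a ∩ Metric.ball e b)).nullMeasurableSet
  rw [← volume_ball_inter_axis m ha hb ‖z‖, ← h1]
  congr 1
  ext x
  have h2 : ‖A x - e‖ = ‖x - z‖ := by rw [← hA, ← map_sub, A.norm_map]
  simp only [mem_inter_iff, mem_ball_zero_iff, mem_preimage, A.norm_map]
  rw [mem_ball_iff_norm, mem_ball_iff_norm, h2]

lemma measurable_lensVolume (m : ℕ) (a b : ℝ) : Measurable (lensVolume m a b) := by
  have h : Measurable (Function.uncurry fun r x : ℝ =>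
      sliceVolume m (min (a ^ 2 - x ^ 2) (b ^ 2 - (x - r) ^ 2))) :=
    (measurable_sliceVolume m).comp (by fun_prop)
  exact (h.stronglyMeasurable.integral_prod_right).measurable

lemma lintegral_ball_ball (m : ℕ) {a b : ℝ} (ha : 0 < a) (hb : 0 < b) {g : ℝ → ENNReal}
    (hg : Measurable g) :
    ∫⁻ x in Metric.ball (0 : EuclideanSpace ℝ (Fin (m + 1))) a,
      ∫⁻ y in Metric.ball (0 : EuclideanSpace ℝ (Fin (m + 1))) b, g ‖x - y‖
    = ENNReal.ofReal ((m + 1 : ℕ) * unitBallVolume (m + 1)) *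
      ∫⁻ r in Ioi (0 : ℝ), ENNReal.ofReal (r ^ m) *
        (g r * ENNReal.ofReal (unitBallVolume m * lensVolume m a b r)) := by
  set E := EuclideanSpace ℝ (Fin (m + 1))
  have hin : ∀ x : E, ∫⁻ y in Metric.ball (0 : E) b, g ‖x - y‖
      = ∫⁻ z, (Metric.ball z b).indicator (fun _ => g ‖z‖) x := by
    intro x
    rw [← lintegral_indicator measurableSet_ball,
      ← lintegral_sub_left_eq_self ((Metric.ball (0 : E) b).indicator fun y => g ‖x - y‖) x]
    refine lintegral_congr fun z => ?_
    simp [indicator, dist_eq_norm]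
  have hmeas : Measurable (Function.uncurry fun x z : E =>
      (Metric.ball z b).indicator (fun _ => g ‖z‖) x) := by
    have h : MeasurableSet {p : E × E | ‖p.1 - p.2‖ < b} :=
      measurableSet_lt (measurable_fst.sub measurable_snd).norm measurable_const
    convert (hg.comp (measurable_snd (α := E) (β := E)).norm).indicator h using 1
    funext p
    simp [indicator, Function.uncurry, dist_eq_norm]
  rw [lintegral_congr hin, lintegral_lintegral_swap hmeas.aemeasurable]
  have hz : ∀ z : E, ∫⁻ x in Metric.ball (0 : E) a,
      (Metric.ball z b).indicator (fun _ => g ‖z‖) x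
      = g ‖z‖ * ENNReal.ofReal (unitBallVolume m * lensVolume m a b ‖z‖) := by
    intro z
    rw [lintegral_indicator_const measurableSet_ball, Measure.restrict_apply measurableSet_ball,
      inter_comm, volume_ball_inter m ha hb z]
  rw [lintegral_congr hz]
  exact lintegral_fun_norm (n := m + 1) (by lia)
    (hg.mul ((measurable_lensVolume m a b).const_mul _).ennreal_ofReal)

/-! ### The volume of a lens in terms of the angle of a triangle -/

/-- The volume of the part of a ball of radius `a` beyond a hyperplane at signed distance `ξ` from
the centre, up to the constant `c_m`. -/
def capVolume (m : ℕ) (a ξ : ℝ) : ℝ := ∫ x in Ioi ξ, sliceVolume m (a ^ 2 - x ^ 2)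

lemma capVolume_eq (m : ℕ) (a ξ : ℝ) :
    capVolume m a ξ = capVolume m a 0 - ∫ x in (0 : ℝ)..ξ, sliceVolume m (a ^ 2 - x ^ 2) := by
  have h := intervalIntegral.integral_interval_add_Ioi (a := 0) (b := ξ)
    (integrable_slice m a).integrableOn (integrable_slice m a).integrableOn
  rw [capVolume, capVolume, ← h]
  ring

lemma continuous_capVolume (m : ℕ) (a : ℝ) : Continuous (capVolume m a) := by
  have h : capVolume m a = fun ξ => capVolume m a 0 -
      ∫ x in (0 : ℝ)..ξ, sliceVolume m (a ^ 2 - x ^ 2) := funext fun ξ => capVolume_eq m a ξ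
  rw [h]
  exact continuous_const.sub ((integrable_slice m a).continuous_primitive 0)

lemma hasDerivAt_capVolume (m : ℕ) {a ξ : ℝ} (h : a ^ 2 - ξ ^ 2 ≠ 0) :
    HasDerivAt (capVolume m a) (-sliceVolume m (a ^ 2 - ξ ^ 2)) ξ := by
  have e : capVolume m a = fun ξ => capVolume m a 0 -
      ∫ x in (0 : ℝ)..ξ, sliceVolume m (a ^ 2 - x ^ 2) := funext fun ξ => capVolume_eq m a ξ
  rw [e]
  have hm : Measurable fun x : ℝ => sliceVolume m (a ^ 2 - x ^ 2) :=
    (measurable_sliceVolume m).comp (by fun_prop)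
  refine HasDerivAt.const_sub _ ?_
  refine intervalIntegral.integral_hasDerivAt_right
    ((integrable_slice m a).intervalIntegrable)
    hm.stronglyMeasurable.stronglyMeasurableAtFilter ?_
  exact ContinuousAt.comp (f := fun x : ℝ => a ^ 2 - x ^ 2) (continuousAt_sliceVolume m h)
    (by fun_prop)

/-- The signed distance of the centre of the ball of radius `a` from the radical hyperplane. -/
def radicalDist (a b r : ℝ) : ℝ := (a ^ 2 - b ^ 2 + r ^ 2) / (2 * r)

lemma radicalDist_add (a b : ℝ) {r : ℝ} (hr : r ≠ 0) :
    r - radicalDist a b r = radicalDist b a r := by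
  rw [radicalDist, radicalDist]
  field_simp
  ring

lemma radicalDist_sq (a b : ℝ) {r : ℝ} (hr : r ≠ 0) :
    b ^ 2 - radicalDist b a r ^ 2 = a ^ 2 - radicalDist a b r ^ 2 := by
  rw [radicalDist, radicalDist]
  field_simp
  ring

lemma hasDerivAt_radicalDist (a b : ℝ) {r : ℝ} (hr : r ≠ 0) :
    HasDerivAt (radicalDist a b) (1 / 2 - (a ^ 2 - b ^ 2) / (2 * r ^ 2)) r := by
  have h := (((hasDerivAt_id r).pow 2).const_add (a ^ 2 - b ^ 2)).div
    ((hasDerivAt_id r).const_mul 2) (by simpa using hr)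
  refine h.congr_deriv ?_
  simp only [id, Pi.pow_apply]
  field_simp
  ring

lemma lensVolume_eq (m : ℕ) (a b : ℝ) {r : ℝ} (hr : 0 < r) :
    lensVolume m a b r = capVolume m a (radicalDist a b r) + capVolume m b (radicalDist b a r) := by
  set ξ := radicalDist a b r with hξ
  have h2 : 2 * r * ξ = a ^ 2 - b ^ 2 + r ^ 2 := by
    rw [hξ, radicalDist]; field_simp
  rw [lensVolume, ← integral_add_compl (measurableSet_Ioi (a := ξ)) (integrable_lens m a b r)]
  congr 1
  · refine setIntegral_congr_fun measurableSet_Ioi fun x hx => ?_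
    have hx : ξ < x := hx
    have : 2 * r * ξ < 2 * r * x := mul_lt_mul_of_pos_left hx (by positivity)
    rw [min_eq_left (by nlinarith)]
  · have e1 : ∫ x in (Ioi ξ)ᶜ, sliceVolume m (min (a ^ 2 - x ^ 2) (b ^ 2 - (x - r) ^ 2))
        = ∫ x, ((Ici (r - ξ)).indicator fun y => sliceVolume m (b ^ 2 - y ^ 2)) (r - x) := by
      rw [← integral_indicator measurableSet_Ioi.compl]
      refine integral_congr_ae (ae_of_all _ fun x => ?_)
      by_cases hx : ξ < x
      · have h1 : x ∉ (Ioi ξ)ᶜ := fun h => h hx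
        have h3 : r - x ∉ Ici (r - ξ) := fun h => by have := mem_Ici.1 h; linarith
        simp only [indicator_of_notMem h1, indicator_of_notMem h3]
      · have h1 : x ∈ (Ioi ξ)ᶜ := hx
        push Not at hx
        have h3 : r - x ∈ Ici (r - ξ) := mem_Ici.2 (by linarith)
        have : 2 * r * x ≤ 2 * r * ξ := mul_le_mul_of_nonneg_left hx (by positivity)
        simp only [indicator_of_mem h1, indicator_of_mem h3]
        rw [min_eq_right (by nlinarith)]
        congr 1
        ring
    rw [e1, integral_sub_left_eq_self _ volume r, integral_indicator measurableSet_Ici,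
      integral_Ici_eq_integral_Ioi, hξ, radicalDist_add a b hr.ne']
    rfl

lemma lensVolume_eq_zero (m : ℕ) {a b r : ℝ} (ha : 0 < a) (hb : 0 < b) (hr : a + b ≤ r) :
    lensVolume m a b r = 0 := by
  rw [lensVolume, ← integral_zero ℝ ℝ]
  congr 1
  funext x
  refine sliceVolume_of_nonpos m ?_
  by_contra h
  push Not at h
  obtain ⟨h1, h2⟩ := lt_min_iff.1 h
  have h3 := abs_lt_of_sq_lt_sq' (by linarith : x ^ 2 < a ^ 2) ha.le
  have h4 := abs_lt_of_sq_lt_sq' (by linarith : (x - r) ^ 2 < b ^ 2) hb.le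
  linarith [h3.2, h4.1]

lemma continuousOn_radicalDist (a b : ℝ) : ContinuousOn (radicalDist a b) (Ioi 0) := by
  intro r hr
  exact (hasDerivAt_radicalDist a b (ne_of_gt hr)).continuousAt.continuousWithinAt

lemma measurable_radicalDist (a b : ℝ) : Measurable (radicalDist a b) := by
  unfold radicalDist
  fun_prop

lemma mul_radicalDist (a b : ℝ) {r : ℝ} (hr : r ≠ 0) :
    2 * r * radicalDist a b r = a ^ 2 - b ^ 2 + r ^ 2 := by
  rw [radicalDist]
  field_simp

lemma sliceVolume_radicalDist_le (m : ℕ) (a b r : ℝ) :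
    sliceVolume m (a ^ 2 - radicalDist a b r ^ 2) ≤ sliceVolume m (a ^ 2) :=
  sliceVolume_mono m (by linarith [sq_nonneg (radicalDist a b r)])

lemma sliceVolume_radicalDist_eq_zero (m : ℕ) {a b r : ℝ} (ha : 0 < a) (hb : 0 < b)
    (hr : a + b ≤ r) : sliceVolume m (a ^ 2 - radicalDist a b r ^ 2) = 0 := by
  have hr0 : 0 < r := by linarith
  have h := mul_radicalDist a b hr0.ne'
  have h1 : a ≤ radicalDist a b r := by
    refine le_of_mul_le_mul_left (a := 2 * r) ?_ (by positivity)
    nlinarith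
  exact sliceVolume_of_nonpos m (by nlinarith)

/-- When the centres move apart, the lens shrinks at a rate given by its cross section. -/
lemma lensVolume_eq_integral (m : ℕ) {a b : ℝ} (ha : 0 < a) (hb : 0 < b) {r : ℝ} (hr : 0 < r) :
    ENNReal.ofReal (lensVolume m a b r)
      = ∫⁻ x in Ioi r, ENNReal.ofReal (sliceVolume m (a ^ 2 - radicalDist a b x ^ 2)) := by
  set M := max r (a + b) with hM
  have hrM : r ≤ M := le_max_left _ _
  set f : ℝ → ℝ := fun x => sliceVolume m (a ^ 2 - radicalDist a b x ^ 2) with hf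
  have hfm : Measurable f := (measurable_sliceVolume m).comp
    (measurable_const.sub ((measurable_radicalDist a b).pow_const 2))
  have hint : IntegrableOn f (Ioc r M) := by
    refine Measure.integrableOn_of_bounded (M := sliceVolume m (a ^ 2)) (by simp)
      hfm.aestronglyMeasurable (ae_of_all _ fun x => ?_)
    rw [Real.norm_of_nonneg (sliceVolume_nonneg m _)]
    exact sliceVolume_radicalDist_le m a b x
  have hcont : ContinuousOn (lensVolume m a b) (Icc r M) := by
    have hsub : Icc r M ⊆ Ioi 0 := fun x hx => hr.trans_le hx.1
    refine ContinuousOn.congr (f := fun x => capVolume m a (radicalDist a b x)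
      + capVolume m b (radicalDist b a x)) ?_ fun x hx => lensVolume_eq m a b (hsub hx)
    exact ((continuous_capVolume m a).comp_continuousOn
        ((continuousOn_radicalDist a b).mono hsub)).add
      ((continuous_capVolume m b).comp_continuousOn ((continuousOn_radicalDist b a).mono hsub))
  -- the distances at which the spheres touch are exceptional
  set T : Set ℝ := {a + b, a - b, b - a, -(a + b)} with hT
  have hderiv : ∀ x ∈ Ioo r M \ T, HasDerivAt (lensVolume m a b) (-f x) x := by
    rintro x ⟨hx, hxT⟩
    have hx0 : 0 < x := hr.trans hx.1
    have hne : a ^ 2 - radicalDist a b x ^ 2 ≠ 0 := by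
      intro h0
      have h1 := mul_radicalDist a b hx0.ne'
      have h2 : (x - (a + b)) * (x - (a - b)) * (x - (b - a)) * (x - -(a + b)) = 0 := by
        have : (2 * x) ^ 2 * (a ^ 2 - radicalDist a b x ^ 2) = 0 := by rw [h0, mul_zero]
        have h3 : (2 * x * radicalDist a b x) ^ 2 = (a ^ 2 - b ^ 2 + x ^ 2) ^ 2 := by rw [h1]
        linear_combination -h3 - this
      simp only [mul_eq_zero, sub_eq_zero] at h2
      refine hxT ?_
      simp only [hT, mem_insert_iff, mem_singleton_iff]
      tauto
    have hne' : b ^ 2 - radicalDist b a x ^ 2 ≠ 0 := by rwa [radicalDist_sq a b hx0.ne']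
    have d1 := (hasDerivAt_capVolume m hne).comp x (hasDerivAt_radicalDist a b hx0.ne')
    have d2 := (hasDerivAt_capVolume m hne').comp x (hasDerivAt_radicalDist b a hx0.ne')
    rw [radicalDist_sq a b hx0.ne'] at d2
    have d := (d1.add d2).congr_of_eventuallyEq (f₁ := lensVolume m a b) (by
      filter_upwards [Ioi_mem_nhds hx0] with y hy
      exact lensVolume_eq m a b hy)
    refine d.congr_deriv ?_
    simp only [hf]
    field_simp
    ring
  have hftc := integral_eq_of_hasDerivAt_off_countable_of_le (lensVolume m a b) (fun x => -f x) hrM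
    (s := T) (by simp [hT]) hcont hderiv
    ((intervalIntegrable_iff_integrableOn_Ioc_of_le hrM).2 hint).neg
  rw [intervalIntegral.integral_neg, lensVolume_eq_zero m ha hb (le_max_right r (a + b)), zero_sub,
    neg_inj, intervalIntegral.integral_of_le hrM] at hftc
  rw [← hftc, ofReal_integral_eq_lintegral_ofReal hint
    (ae_of_all _ fun x => sliceVolume_nonneg m _), ← Ioc_union_Ioi_eq_Ioi hrM,
    lintegral_union measurableSet_Ioi (Ioc_disjoint_Ioi le_rfl)]
  rw [setLIntegral_congr_fun (g := fun _ => 0) measurableSet_Ioi, lintegral_zero, add_zero]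
  intro x hx
  simp only
  rw [sliceVolume_radicalDist_eq_zero m ha hb ((le_max_right r (a + b)).trans (le_of_lt hx)),
    ENNReal.ofReal_zero]

/-- The third side of a triangle with sides `a`, `b` and angle `φ` between them. -/
def thirdSide (a b φ : ℝ) : ℝ := √(a ^ 2 + b ^ 2 - 2 * a * b * Real.cos φ)

lemma thirdSide_arg_pos {a b φ : ℝ} (ha : 0 < a) (hb : 0 < b) (hφ : φ ∈ Ioc 0 Real.pi) :
    0 < a ^ 2 + b ^ 2 - 2 * a * b * Real.cos φ := by
  have h1 : Real.cos φ < 1 := by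
    rw [← Real.cos_zero]
    exact Real.strictAntiOn_cos ⟨le_rfl, Real.pi_pos.le⟩ ⟨hφ.1.le, hφ.2⟩ hφ.1
  nlinarith [mul_pos ha hb, sq_nonneg (a - b)]

lemma thirdSide_pos {a b φ : ℝ} (ha : 0 < a) (hb : 0 < b) (hφ : φ ∈ Ioc 0 Real.pi) :
    0 < thirdSide a b φ := Real.sqrt_pos.2 (thirdSide_arg_pos ha hb hφ)

lemma thirdSide_sq {a b φ : ℝ} (ha : 0 < a) (hb : 0 < b) (hφ : φ ∈ Ioc 0 Real.pi) :
    thirdSide a b φ ^ 2 = a ^ 2 + b ^ 2 - 2 * a * b * Real.cos φ :=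
  Real.sq_sqrt (thirdSide_arg_pos ha hb hφ).le

lemma continuous_thirdSide (a b : ℝ) : Continuous (thirdSide a b) := by
  unfold thirdSide
  fun_prop

lemma hasDerivAt_thirdSide {a b φ : ℝ} (ha : 0 < a) (hb : 0 < b) (hφ : φ ∈ Ioc 0 Real.pi) :
    HasDerivAt (thirdSide a b) (a * b * Real.sin φ / thirdSide a b φ) φ := by
  have h := (((Real.hasDerivAt_cos φ).const_mul (2 * a * b)).const_sub (a ^ 2 + b ^ 2)).sqrt
    (thirdSide_arg_pos ha hb hφ).ne'
  refine h.congr_deriv ?_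
  rw [thirdSide]
  have := (Real.sqrt_pos.2 (thirdSide_arg_pos ha hb hφ)).ne'
  field_simp

lemma thirdSide_injOn {a b : ℝ} (ha : 0 < a) (hb : 0 < b) :
    InjOn (thirdSide a b) (Ioo 0 Real.pi) := by
  intro φ hφ ψ hψ h
  have h2 : thirdSide a b φ ^ 2 = thirdSide a b ψ ^ 2 := by rw [h]
  rw [thirdSide_sq ha hb (Ioo_subset_Ioc_self hφ),
    thirdSide_sq ha hb (Ioo_subset_Ioc_self hψ)] at h2
  have h3 : (2 * a * b) * Real.cos φ = (2 * a * b) * Real.cos ψ := by linarith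
  exact Real.injOn_cos (Ioo_subset_Icc_self hφ) (Ioo_subset_Icc_self hψ)
    (mul_left_cancel₀ (by positivity) h3)

lemma sq_sub_radicalDist_thirdSide {a b φ : ℝ} (ha : 0 < a) (hb : 0 < b)
    (hφ : φ ∈ Ioc 0 Real.pi) :
    a ^ 2 - radicalDist a b (thirdSide a b φ) ^ 2
      = (a * b * Real.sin φ / thirdSide a b φ) ^ 2 := by
  have h0 := (thirdSide_pos ha hb hφ).ne'
  have h1 := thirdSide_sq ha hb hφ
  have h2 := mul_radicalDist a b h0
  have h3 : radicalDist a b (thirdSide a b φ)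
      = a * (a - b * Real.cos φ) / thirdSide a b φ := by
    rw [eq_div_iff h0]
    linarith
  have h4 := Real.sin_sq_add_cos_sq φ
  rw [h3]
  field_simp
  rw [h1]
  linear_combination (-(b ^ 2)) * h4

/-- The volume of a lens as an integral over the angle between two radii of the spheres. -/
lemma lensVolume_eq_angle (m : ℕ) {a b : ℝ} (ha : 0 < a) (hb : 0 < b) {r : ℝ} (hr : 0 < r) :
    ENNReal.ofReal (lensVolume m a b r)
      = ∫⁻ φ in Ioo 0 Real.pi, (Iio (thirdSide a b φ)).indicator (fun _ =>
          ENNReal.ofReal ((a * b * Real.sin φ / thirdSide a b φ) ^ (m + 1))) r := by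
  rw [lensVolume_eq_integral m ha hb hr]
  set J := {φ | φ ∈ Ioo 0 Real.pi ∧ r < thirdSide a b φ} with hJ
  have hJm : MeasurableSet J :=
    measurableSet_Ioo.inter
      (measurableSet_lt measurable_const (continuous_thirdSide a b).measurable)
  have e1 : ∫⁻ x in Ioi r, ENNReal.ofReal (sliceVolume m (a ^ 2 - radicalDist a b x ^ 2))
      = ∫⁻ x in thirdSide a b '' J,
        ENNReal.ofReal (sliceVolume m (a ^ 2 - radicalDist a b x ^ 2)) := by
    symm
    have himg : MeasurableSet (thirdSide a b '' J) :=
      hJm.image_of_continuousOn_injOn (continuous_thirdSide a b).continuousOn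
        ((thirdSide_injOn ha hb).mono fun φ hφ => hφ.1)
    rw [← lintegral_indicator himg, ← lintegral_indicator measurableSet_Ioi]
    refine lintegral_congr fun x => ?_
    by_cases hxJ : x ∈ thirdSide a b '' J
    · have hx : x ∈ Ioi r := by
        obtain ⟨φ, hφ, rfl⟩ := hxJ
        exact hφ.2
      rw [indicator_of_mem hxJ, indicator_of_mem hx]
    by_cases hx : x ∈ Ioi r
    · rw [indicator_of_mem hx, indicator_of_notMem hxJ]
      have hx0 : 0 < x := hr.trans hx
      rw [eq_comm, ENNReal.ofReal_eq_zero, sliceVolume_of_nonpos m]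
      by_contra hc
      push Not at hc
      refine hxJ ?_
      -- a point where the cross section is nonempty is the side of a nondegenerate triangle
      set c := (a ^ 2 + b ^ 2 - x ^ 2) / (2 * a * b) with hcdef
      have hc1 : 2 * a * b * c = a ^ 2 + b ^ 2 - x ^ 2 := by
        rw [hcdef]; field_simp
      have hrad := mul_radicalDist a b hx0.ne'
      have hc2 : c ^ 2 < 1 := by
        have h1 : 0 < (2 * x) ^ 2 * (a ^ 2 - radicalDist a b x ^ 2) := by positivity
        have h2 : (2 * x * radicalDist a b x) ^ 2 = (a ^ 2 - b ^ 2 + x ^ 2) ^ 2 := by rw [hrad]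
        have h3 : (2 * a * b * c) ^ 2 = (a ^ 2 + b ^ 2 - x ^ 2) ^ 2 := by rw [hc1]
        have h4 : (2 * a * b) ^ 2 * c ^ 2 < (2 * a * b) ^ 2 * 1 := by nlinarith
        exact lt_of_mul_lt_mul_left h4 (by positivity)
      have hc3 := abs_lt.1 ((sq_lt_one_iff_abs_lt_one c).1 hc2)
      have hcos : Real.cos (Real.arccos c) = c := Real.cos_arccos hc3.1.le hc3.2.le
      have hside : thirdSide a b (Real.arccos c) = x := by
        rw [thirdSide, hcos, hc1, sub_sub_cancel, Real.sqrt_sq hx0.le]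
      refine ⟨Real.arccos c, ⟨⟨Real.arccos_pos.2 hc3.2, ?_⟩, by rw [hside]; exact hx⟩, hside⟩
      exact lt_of_le_of_ne (Real.arccos_le_pi c) fun h =>
        absurd (Real.arccos_eq_pi.1 h) (not_le.2 hc3.1)
    · rw [indicator_of_notMem hx, indicator_of_notMem hxJ]
  -- substitute the third side for the distance
  rw [e1, lintegral_image_eq_lintegral_abs_deriv_mul hJm
    (fun φ hφ => (hasDerivAt_thirdSide ha hb (Ioo_subset_Ioc_self hφ.1)).hasDerivWithinAt)
    ((thirdSide_injOn ha hb).mono fun φ hφ => hφ.1)]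
  have hJJ : J = {φ | r < thirdSide a b φ} ∩ Ioo 0 Real.pi := by
    ext φ; simp [hJ, and_comm]
  have e2 : ∀ φ, (Iio (thirdSide a b φ)).indicator (fun _ =>
      ENNReal.ofReal ((a * b * Real.sin φ / thirdSide a b φ) ^ (m + 1))) r
      = {φ | r < thirdSide a b φ}.indicator (fun φ =>
      ENNReal.ofReal ((a * b * Real.sin φ / thirdSide a b φ) ^ (m + 1))) φ := by
    intro φ
    simp [indicator]
  rw [lintegral_congr e2, setLIntegral_indicator
    (measurableSet_lt measurable_const (continuous_thirdSide a b).measurable), ← hJJ]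
  refine setLIntegral_congr_fun hJm fun φ hφ => ?_
  have hφ' := Ioo_subset_Ioc_self hφ.1
  have hpos : 0 < a * b * Real.sin φ / thirdSide a b φ :=
    div_pos (mul_pos (mul_pos ha hb) (Real.sin_pos_of_mem_Ioo hφ.1)) (thirdSide_pos ha hb hφ')
  rw [sq_sub_radicalDist_thirdSide ha hb hφ', sliceVolume_sq m hpos, abs_of_pos hpos,
    ← ENNReal.ofReal_mul hpos.le, pow_succ']

/-- The double integral over two concentric balls of a function of the distance reduces to averages
of that function over centred balls, the radius being the third side of a triangle whose angle
between the radii has density proportional to `sinⁿ`. -/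
lemma lintegral_ball_ball_eq_angle (m : ℕ) {a b : ℝ} (ha : 0 < a) (hb : 0 < b) {g : ℝ → ENNReal}
    (hg : Measurable g) :
    ∫⁻ x in Metric.ball (0 : EuclideanSpace ℝ (Fin (m + 1))) a,
      ∫⁻ y in Metric.ball (0 : EuclideanSpace ℝ (Fin (m + 1))) b, g ‖x - y‖
    = ENNReal.ofReal ((m + 1 : ℕ) * unitBallVolume (m + 1) * unitBallVolume m) *
      ∫⁻ φ in Ioo 0 Real.pi, ENNReal.ofReal ((a * b * Real.sin φ / thirdSide a b φ) ^ (m + 1)) *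
        ∫⁻ r in Ioo 0 (thirdSide a b φ), ENNReal.ofReal (r ^ m) * g r := by
  have hgm : Measurable fun r : ℝ => ENNReal.ofReal (r ^ m) * g r :=
    (measurable_id.pow_const m).ennreal_ofReal.mul hg
  rw [lintegral_ball_ball m ha hb hg, ENNReal.ofReal_mul
    (mul_nonneg (Nat.cast_nonneg _) (unitBallVolume_pos (m + 1)).le), mul_assoc]
  congr 1
  set A : ℝ → ENNReal := fun φ => ENNReal.ofReal ((a * b * Real.sin φ / thirdSide a b φ) ^ (m + 1))
  have hA : Measurable A := by
    refine Measurable.ennreal_ofReal (Measurable.pow_const (Measurable.div ?_ ?_) _)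
    · exact (Real.measurable_sin.const_mul _)
    · exact (continuous_thirdSide a b).measurable
  have hS : MeasurableSet {p : ℝ × ℝ | p.1 < thirdSide a b p.2} :=
    measurableSet_lt measurable_fst ((continuous_thirdSide a b).measurable.comp measurable_snd)
  have hmeas : Measurable (Function.uncurry fun r φ : ℝ =>
      ENNReal.ofReal (r ^ m) * g r * (Iio (thirdSide a b φ)).indicator (fun _ => A φ) r) := by
    have h := (hA.comp (measurable_snd (α := ℝ) (β := ℝ))).indicator hS
    refine (hgm.comp measurable_fst).mul ?_
    convert h using 1
    funext p
    simp [indicator]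
  have hA2 : ∀ r : ℝ, Measurable fun φ => (Iio (thirdSide a b φ)).indicator (fun _ => A φ) r := by
    intro r
    have h := hA.indicator (measurableSet_lt (measurable_const (a := r))
      (continuous_thirdSide a b).measurable)
    convert h using 1
    funext φ
    simp [indicator]
  have e1 : ∫⁻ r in Ioi (0 : ℝ), ENNReal.ofReal (r ^ m) *
      (g r * ENNReal.ofReal (unitBallVolume m * lensVolume m a b r))
      = ∫⁻ r in Ioi (0 : ℝ), ENNReal.ofReal (unitBallVolume m) *
        ∫⁻ φ in Ioo 0 Real.pi, ENNReal.ofReal (r ^ m) * g r *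
          (Iio (thirdSide a b φ)).indicator (fun _ => A φ) r := by
    refine setLIntegral_congr_fun measurableSet_Ioi fun r hr => ?_
    rw [lintegral_const_mul _ (hA2 r), ENNReal.ofReal_mul (unitBallVolume_pos m).le,
      lensVolume_eq_angle m ha hb hr]
    ring
  have hmeas' : Measurable fun r : ℝ => ∫⁻ φ in Ioo 0 Real.pi,
      ENNReal.ofReal (r ^ m) * g r * (Iio (thirdSide a b φ)).indicator (fun _ => A φ) r :=
    hmeas.lintegral_prod_right'
  rw [e1, lintegral_const_mul _ hmeas', lintegral_lintegral_swap hmeas.aemeasurable]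
  congr 1
  refine lintegral_congr fun φ => ?_
  rw [← lintegral_const_mul _ hgm]
  have : Ioo 0 (thirdSide a b φ) = Iio (thirdSide a b φ) ∩ Ioi 0 := by
    ext x; simp [and_comm]
  rw [this, ← setLIntegral_indicator measurableSet_Iio]
  refine lintegral_congr fun r => ?_
  by_cases h : r < thirdSide a b φ
  · rw [indicator_of_mem (mem_Iio.2 h), indicator_of_mem (mem_Iio.2 h), mul_comm]
  · rw [indicator_of_notMem (by simpa using h), indicator_of_notMem (by simpa using h), mul_zero]

/-! ### Radial means of an increasing profile -/

/-- A continuously differentiable, strictly increasing radial profile that is integrable near the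
origin of `ℝᵐ⁺¹`. -/
structure IsRadialProfile (m : ℕ) (w : ℝ → ℝ) : Prop where
  differentiableAt : ∀ r, 0 < r → DifferentiableAt ℝ w r
  continuousOn_deriv : ContinuousOn (deriv w) (Ioi 0)
  deriv_pos : ∀ r, 0 < r → 0 < deriv w r
  integrableOn : ∀ R, 0 < R → IntegrableOn (fun r => r ^ m * w r) (Ioo 0 R)

/-- The mean of the radial function with profile `w` over a centred ball of radius `R` in `ℝᵐ⁺¹`,
up to a constant factor. -/
def radialMean (m : ℕ) (w : ℝ → ℝ) (R : ℝ) : ℝ := (∫ r in Ioo 0 R, r ^ m * w r) / R ^ (m + 1)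

/-- The quantity `Rⁿ w(R) - n ∫₀ᴿ rⁿ⁻¹ w(r) dr = ∫₀ᴿ rⁿ w'(r) dr`, where `n = m + 1`; it governs
the growth of the radial mean. -/
def radialExcess (m : ℕ) (w : ℝ → ℝ) (R : ℝ) : ℝ :=
  R ^ (m + 1) * w R - (m + 1) * ∫ r in Ioo 0 R, r ^ m * w r

section Profile

variable {m : ℕ} {w : ℝ → ℝ}

lemma IsRadialProfile.continuousOn (hw : IsRadialProfile m w) : ContinuousOn w (Ioi 0) :=
  fun r hr => (hw.differentiableAt r hr).continuousAt.continuousWithinAt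

lemma IsRadialProfile.strictMonoOn (hw : IsRadialProfile m w) : StrictMonoOn w (Ioi 0) :=
  strictMonoOn_of_deriv_pos (convex_Ioi 0) hw.continuousOn fun r hr =>
    hw.deriv_pos r (by simpa using hr)

lemma IsRadialProfile.hasDerivAt_integral (hw : IsRadialProfile m w) {R : ℝ} (hR : 0 < R) :
    HasDerivAt (fun R => ∫ r in Ioo 0 R, r ^ m * w r) (R ^ m * w R) R := by
  have hcont : ContinuousOn (fun r => r ^ m * w r) (Ioi 0) :=
    (continuousOn_pow m).mul hw.continuousOn
  have h := intervalIntegral.integral_hasDerivAt_right (f := fun r => r ^ m * w r) (a := 0) (b := R)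
    ((intervalIntegrable_iff_integrableOn_Ioo_of_le hR.le).2 (hw.integrableOn R hR))
    (hcont.stronglyMeasurableAtFilter isOpen_Ioi R hR)
    (hcont.continuousAt (Ioi_mem_nhds hR))
  refine h.congr_of_eventuallyEq ?_
  filter_upwards [Ioi_mem_nhds hR] with r hr
  rw [intervalIntegral.integral_of_le (le_of_lt hr), integral_Ioc_eq_integral_Ioo]

lemma IsRadialProfile.hasDerivAt_radialMean (hw : IsRadialProfile m w) {R : ℝ} (hR : 0 < R) :
    HasDerivAt (radialMean m w) (radialExcess m w R / R ^ (m + 2)) R := by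
  have h := (hw.hasDerivAt_integral hR).div (hasDerivAt_pow (m + 1) R) (pow_pos hR _).ne'
  refine h.congr_deriv ?_
  rw [radialExcess]
  simp only [Nat.add_sub_cancel, Nat.cast_add, Nat.cast_one]
  field_simp
  ring

lemma IsRadialProfile.hasDerivAt_radialExcess (hw : IsRadialProfile m w) {R : ℝ} (hR : 0 < R) :
    HasDerivAt (radialExcess m w) (R ^ (m + 1) * deriv w R) R := by
  have h := ((hasDerivAt_pow (m + 1) R).mul (hw.differentiableAt R hR).hasDerivAt).sub
    ((hw.hasDerivAt_integral hR).const_mul ((m : ℝ) + 1))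
  refine h.congr_deriv ?_
  simp only [Nat.add_sub_cancel, Nat.cast_add, Nat.cast_one]
  ring

lemma IsRadialProfile.radialExcess_nonneg (hw : IsRadialProfile m w) {R : ℝ} (hR : 0 < R) :
    0 ≤ radialExcess m w R := by
  have h1 : ∫ r in Ioo 0 R, r ^ m * w r ≤ ∫ r in Ioo 0 R, r ^ m * w R := by
    refine setIntegral_mono_on (hw.integrableOn R hR) ?_ measurableSet_Ioo fun r hr => ?_
    · exact ((by fun_prop : Continuous fun r : ℝ => r ^ m * w R).integrableOn_Icc).mono_set
        Ioo_subset_Icc_self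
    · exact mul_le_mul_of_nonneg_left (hw.strictMonoOn hr.1 hR hr.2).le (pow_nonneg hr.1.le m)
  have h2 : ∫ r in Ioo 0 R, r ^ m * w R = R ^ (m + 1) / (m + 1) * w R := by
    rw [integral_mul_const, ← integral_Ioc_eq_integral_Ioo, ← intervalIntegral.integral_of_le hR.le,
      integral_pow]
    simp
  rw [h2] at h1
  have h3 : ((m : ℝ) + 1) * ∫ r in Ioo 0 R, r ^ m * w r
      ≤ (m + 1) * (R ^ (m + 1) / (m + 1) * w R) :=
    mul_le_mul_of_nonneg_left h1 (by positivity)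
  have h4 : ((m : ℝ) + 1) * (R ^ (m + 1) / (m + 1) * w R) = R ^ (m + 1) * w R := by field_simp
  rw [radialExcess]
  linarith

end Profile

/-! ### Differentiation under the integral sign -/

lemma hasDerivAt_intervalIntegral_of_continuousOn {g g' : ℝ → ℝ → ℝ} {U : Set ℝ} {α β : ℝ}
    (hU : IsOpen U) (hαβ : α ≤ β)
    (hg : ContinuousOn (Function.uncurry g) (U ×ˢ Icc α β))
    (hg' : ContinuousOn (Function.uncurry g') (U ×ˢ Icc α β))
    (hd : ∀ t ∈ U, ∀ φ ∈ Icc α β, HasDerivAt (fun t => g t φ) (g' t φ) t) {t : ℝ} (ht : t ∈ U) :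
    HasDerivAt (fun t => ∫ φ in α..β, g t φ) (∫ φ in α..β, g' t φ) t := by
  obtain ⟨ε, hε, hball⟩ := Metric.nhds_basis_closedBall.mem_iff.1 (hU.mem_nhds ht)
  have hsec : ∀ {f : ℝ → ℝ → ℝ}, ContinuousOn (Function.uncurry f) (U ×ˢ Icc α β) →
      ∀ s ∈ U, ContinuousOn (f s) (Icc α β) := by
    intro f hf s hs
    exact hf.comp (f := fun φ => (s, φ)) (by fun_prop) fun φ hφ => ⟨hs, hφ⟩
  have hmeas : ∀ {f : ℝ → ℝ → ℝ}, ContinuousOn (Function.uncurry f) (U ×ˢ Icc α β) →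
      ∀ s ∈ U, AEStronglyMeasurable (f s) (volume.restrict (uIoc α β)) := by
    intro f hf s hs
    rw [uIoc_of_le hαβ]
    exact ((hsec hf s hs).mono Ioc_subset_Icc_self).aestronglyMeasurable measurableSet_Ioc
  have hcomp : IsCompact (Metric.closedBall t ε ×ˢ Icc α β) :=
    (isCompact_closedBall t ε).prod isCompact_Icc
  obtain ⟨C, hC⟩ := hcomp.exists_bound_of_continuousOn (hg'.mono (prod_mono hball le_rfl))
  have h := intervalIntegral.hasDerivAt_integral_of_dominated_loc_of_deriv_le
    (μ := volume) (F := g) (F' := g') (x₀ := t) (a := α) (b := β) (s := Metric.closedBall t ε)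
    (bound := fun _ => C) (Metric.closedBall_mem_nhds t hε)
    (by filter_upwards [hU.mem_nhds ht] with s hs using hmeas hg s hs)
    ((hsec hg t ht).intervalIntegrable_of_Icc hαβ) (hmeas hg' t ht)
    (ae_of_all _ fun φ hφ s hs => hC (s, φ) ⟨hs, by
      rw [uIoc_of_le hαβ] at hφ; exact Ioc_subset_Icc_self hφ⟩)
    intervalIntegrable_const
    (ae_of_all _ fun φ hφ s hs => hd s (hball hs) φ (by
      rw [uIoc_of_le hαβ] at hφ; exact Ioc_subset_Icc_self hφ))
  exact h.2

/-! ### Two balls whose reciprocal volumes vary linearly -/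

/-- Radii of two balls depending on a time parameter, with logarithmic derivatives `l` and `k`. The
equation for `l` and `k` says that the reciprocals of the volumes in `ℝᵐ⁺¹` are affine functions. -/
structure IsRadiusFlow (m : ℕ) (U : Set ℝ) (a b l k : ℝ → ℝ) : Prop where
  a_pos : ∀ t ∈ U, 0 < a t
  b_pos : ∀ t ∈ U, 0 < b t
  deriv_a : ∀ t ∈ U, HasDerivAt a (l t * a t) t
  deriv_b : ∀ t ∈ U, HasDerivAt b (k t * b t) t
  deriv_l : ∀ t ∈ U, HasDerivAt l ((m + 1) * l t ^ 2) t
  deriv_k : ∀ t ∈ U, HasDerivAt k ((m + 1) * k t ^ 2) t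

/-- The time derivative of the squared third side. -/
def sideSqRate (a b l k : ℝ → ℝ) (t φ : ℝ) : ℝ :=
  2 * l t * a t ^ 2 + 2 * k t * b t ^ 2 - 2 * (l t + k t) * (a t * b t) * Real.cos φ

/-- The nonnegative part of the second time derivative of the angular integrand. -/
def convexityDensity (m : ℕ) (w : ℝ → ℝ) (a b l k : ℝ → ℝ) (t φ : ℝ) : ℝ :=
  deriv w (thirdSide (a t) (b t) φ) / thirdSide (a t) (b t) φ ^ 3 * Real.sin φ ^ (m + 1) *
    (sideSqRate a b l k t φ ^ 2 / 4 + (l t - k t) ^ 2 * (a t * b t) ^ 2 * Real.sin φ ^ 2)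

/-- The quantity whose angular derivative is the remaining part of the second time derivative of the
angular integrand. -/
def convexityFlux (m : ℕ) (w : ℝ → ℝ) (a b l k : ℝ → ℝ) (t φ : ℝ) : ℝ :=
  radialExcess m w (thirdSide (a t) (b t) φ) * ((l t - k t) ^ 2 * (a t * b t)) *
    Real.sin φ ^ (m + 2) / thirdSide (a t) (b t) φ ^ (m + 3)

/-- The angular derivative of `convexityFlux`. -/
def convexityFluxDeriv (m : ℕ) (w : ℝ → ℝ) (a b l k : ℝ → ℝ) (t φ : ℝ) : ℝ :=
  deriv w (thirdSide (a t) (b t) φ) / thirdSide (a t) (b t) φ ^ 3 * Real.sin φ ^ (m + 1) *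
    ((l t - k t) ^ 2 * (a t * b t) ^ 2 * Real.sin φ ^ 2) +
  radialExcess m w (thirdSide (a t) (b t) φ) * ((l t - k t) ^ 2 * (a t * b t)) *
    Real.sin φ ^ (m + 1) * ((m + 2) * Real.cos φ * thirdSide (a t) (b t) φ ^ 2
      - (m + 3) * (a t * b t) * Real.sin φ ^ 2) / thirdSide (a t) (b t) φ ^ (m + 5)

section Flow

variable {m : ℕ} {w : ℝ → ℝ} {U : Set ℝ} {a b l k : ℝ → ℝ}

lemma IsRadiusFlow.side_pos (hf : IsRadiusFlow m U a b l k) {t φ : ℝ} (ht : t ∈ U)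
    (hφ : φ ∈ Ioc 0 Real.pi) : 0 < thirdSide (a t) (b t) φ :=
  thirdSide_pos (hf.a_pos t ht) (hf.b_pos t ht) hφ

lemma IsRadiusFlow.hasDerivAt_flux (hf : IsRadiusFlow m U a b l k) (hw : IsRadialProfile m w)
    {t φ : ℝ} (ht : t ∈ U) (hφ : φ ∈ Ioc 0 Real.pi) :
    HasDerivAt (convexityFlux m w a b l k t) (convexityFluxDeriv m w a b l k t φ) φ := by
  have hR := hf.side_pos ht hφ
  have dR := hasDerivAt_thirdSide (hf.a_pos t ht) (hf.b_pos t ht) hφ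
  have dZ := (hw.hasDerivAt_radialExcess hR).comp φ dR
  have h := ((dZ.mul_const ((l t - k t) ^ 2 * (a t * b t))).mul
    ((Real.hasDerivAt_sin φ).pow (m + 2))).div (dR.pow (m + 3)) (pow_pos hR _).ne'
  refine h.congr_deriv ?_
  rw [convexityFluxDeriv]
  simp only [Function.comp, Pi.mul_apply, Pi.pow_apply]
  set R := thirdSide (a t) (b t) φ
  push_cast
  field_simp
  ring

lemma IsRadiusFlow.hasDerivAt_side (hf : IsRadiusFlow m U a b l k) {t φ : ℝ} (ht : t ∈ U)
    (hφ : φ ∈ Ioc 0 Real.pi) : HasDerivAt (fun t => thirdSide (a t) (b t) φ)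
      (sideSqRate a b l k t φ / (2 * thirdSide (a t) (b t) φ)) t := by
  have ha := hf.deriv_a t ht
  have hb := hf.deriv_b t ht
  have h := (((ha.pow 2).add (hb.pow 2)).sub (((ha.const_mul 2).mul hb).mul_const
    (Real.cos φ))).sqrt
    (thirdSide_arg_pos (hf.a_pos t ht) (hf.b_pos t ht) hφ).ne'
  refine h.congr_deriv ?_
  rw [sideSqRate]
  change _ / (2 * thirdSide (a t) (b t) φ) = _
  congr 1
  push_cast
  ring

lemma IsRadiusFlow.hasDerivAt_sideSqRate (hf : IsRadiusFlow m U a b l k) {t : ℝ} (ht : t ∈ U)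
    (φ : ℝ) : HasDerivAt (fun t => sideSqRate a b l k t φ)
      (2 * (m + 3) * (l t ^ 2 * a t ^ 2 + k t ^ 2 * b t ^ 2) - 2 * Real.cos φ * (a t * b t) *
        ((m + 1) * (l t ^ 2 + k t ^ 2) + (l t + k t) ^ 2)) t := by
  have ha := hf.deriv_a t ht
  have hb := hf.deriv_b t ht
  have hl := hf.deriv_l t ht
  have hk := hf.deriv_k t ht
  have h := (((hl.const_mul 2).mul (ha.pow 2)).add ((hk.const_mul 2).mul (hb.pow 2))).sub
    ((((hl.add hk).const_mul 2).mul (ha.mul hb)).mul_const (Real.cos φ))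
  refine h.congr_deriv ?_
  push_cast [Pi.pow_apply, Pi.mul_apply, Pi.add_apply]
  ring

/-- The angular integrand of the mean interaction of two balls. -/
def meanIntegrand (m : ℕ) (w : ℝ → ℝ) (a b : ℝ → ℝ) (t φ : ℝ) : ℝ :=
  Real.sin φ ^ (m + 1) * radialMean m w (thirdSide (a t) (b t) φ)

/-- The time derivative of `meanIntegrand`. -/
def meanIntegrandDeriv (m : ℕ) (w : ℝ → ℝ) (a b l k : ℝ → ℝ) (t φ : ℝ) : ℝ :=
  Real.sin φ ^ (m + 1) * (radialExcess m w (thirdSide (a t) (b t) φ) * sideSqRate a b l k t φ /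
    (2 * thirdSide (a t) (b t) φ ^ (m + 3)))

lemma IsRadiusFlow.hasDerivAt_meanIntegrand (hf : IsRadiusFlow m U a b l k)
    (hw : IsRadialProfile m w) {t φ : ℝ} (ht : t ∈ U) (hφ : φ ∈ Ioc 0 Real.pi) :
    HasDerivAt (fun t => meanIntegrand m w a b t φ) (meanIntegrandDeriv m w a b l k t φ) t := by
  have hR := hf.side_pos ht hφ
  have h := (((hw.hasDerivAt_radialMean hR).comp t (hf.hasDerivAt_side ht hφ))).const_mul
    (Real.sin φ ^ (m + 1))
  refine h.congr_deriv ?_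
  rw [meanIntegrandDeriv]
  field_simp
  ring

/-- The second time derivative of the angular integrand is nonnegative up to an angular
derivative. -/
lemma IsRadiusFlow.hasDerivAt_meanIntegrandDeriv (hf : IsRadiusFlow m U a b l k)
    (hw : IsRadialProfile m w) {t φ : ℝ} (ht : t ∈ U) (hφ : φ ∈ Ioc 0 Real.pi) :
    HasDerivAt (fun t => meanIntegrandDeriv m w a b l k t φ)
      (convexityDensity m w a b l k t φ - convexityFluxDeriv m w a b l k t φ) t := by
  have hR := hf.side_pos ht hφ
  have dR := hf.hasDerivAt_side ht hφ
  have dZ := (hw.hasDerivAt_radialExcess hR).comp t dR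
  have h := (((dZ.mul (hf.hasDerivAt_sideSqRate ht φ)).div ((dR.pow (m + 3)).const_mul 2)
    (mul_ne_zero two_ne_zero (pow_pos hR _).ne'))).const_mul (Real.sin φ ^ (m + 1))
  refine h.congr_deriv ?_
  have hsq := thirdSide_sq (hf.a_pos t ht) (hf.b_pos t ht) hφ
  have hsc := Real.sin_sq_add_cos_sq φ
  rw [convexityDensity, convexityFluxDeriv]
  simp only [Function.comp, Pi.mul_apply, Pi.pow_apply]
  set R := thirdSide (a t) (b t) φ with hRdef
  set Z := radialExcess m w R
  set V := deriv w R
  -- by the law of cosines, the terms containing the excess `Z` combine to the flux derivative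
  have key : R ^ 2 * (2 * (m + 3) * (l t ^ 2 * a t ^ 2 + k t ^ 2 * b t ^ 2) -
      2 * Real.cos φ * (a t * b t) * ((m + 1) * (l t ^ 2 + k t ^ 2) + (l t + k t) ^ 2))
      - (m + 3) / 2 * sideSqRate a b l k t φ ^ 2
      = -(2 * ((l t - k t) ^ 2 * (a t * b t)) * ((m + 2) * Real.cos φ * R ^ 2
      - (m + 3) * (a t * b t) * Real.sin φ ^ 2)) := by
    rw [hsq, sideSqRate]
    have hs : Real.sin φ ^ 2 = 1 - Real.cos φ ^ 2 := by linarith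
    rw [hs]
    ring
  set D2 := 2 * (m + 3) * (l t ^ 2 * a t ^ 2 + k t ^ 2 * b t ^ 2) -
      2 * Real.cos φ * (a t * b t) * ((m + 1) * (l t ^ 2 + k t ^ 2) + (l t + k t) ^ 2)
  set D1 := sideSqRate a b l k t φ
  set Q := (l t - k t) ^ 2 * (a t * b t)
  set B := ((m : ℝ) + 2) * Real.cos φ * R ^ 2 - (m + 3) * (a t * b t) * Real.sin φ ^ 2
  simp only [show m + 3 - 1 = m + 2 by lia]
  have e1 : R ^ 2 * D2 = (m + 3) / 2 * D1 ^ 2 - 2 * Q * B := by linarith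
  have e2 : D2 = ((m + 3) / 2 * D1 ^ 2 - 2 * Q * B) / R ^ 2 := by
    rw [← e1]; field_simp
  rw [e2]
  push_cast
  field_simp
  ring

end Flow

/-! ### Strict convexity of the mean interaction of two balls -/

section Flow

variable {m : ℕ} {w : ℝ → ℝ} {U : Set ℝ} {a b l k : ℝ → ℝ} {δ : ℝ}

lemma continuousOn_comp_fst {f : ℝ → ℝ} {S : Set ℝ} (hc : ∀ t ∈ U, ContinuousAt f t) :
    ContinuousOn (fun z : ℝ × ℝ => f z.1) (U ×ˢ S) := by
  have h : ContinuousOn f U := fun t ht => (hc t ht).continuousWithinAt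
  exact h.comp continuousOn_fst fun z hz => hz.1

lemma IsRadiusFlow.continuousOn_side (hf : IsRadiusFlow m U a b l k) (δ : ℝ) :
    ContinuousOn (fun z : ℝ × ℝ => thirdSide (a z.1) (b z.1) z.2) (U ×ˢ Icc δ Real.pi) := by
  have ha := continuousOn_comp_fst (S := Icc δ Real.pi) fun t ht => (hf.deriv_a t ht).continuousAt
  have hb := continuousOn_comp_fst (S := Icc δ Real.pi) fun t ht => (hf.deriv_b t ht).continuousAt
  have key : ∀ (A B : ℝ × ℝ → ℝ) (S : Set (ℝ × ℝ)), ContinuousOn A S → ContinuousOn B S →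
      ContinuousOn (fun z => thirdSide (A z) (B z) z.2) S := by
    intro A B S hA hB
    unfold thirdSide
    fun_prop
  exact key _ _ _ ha hb

lemma IsRadiusFlow.continuousOn_comp_side (hf : IsRadiusFlow m U a b l k) (hδ : 0 < δ) {f : ℝ → ℝ}
    (hc : ∀ R, 0 < R → ContinuousAt f R) :
    ContinuousOn (fun z : ℝ × ℝ => f (thirdSide (a z.1) (b z.1) z.2)) (U ×ˢ Icc δ Real.pi) := by
  have h : ContinuousOn f (Ioi 0) := fun R hR => (hc R hR).continuousWithinAt
  exact h.comp (hf.continuousOn_side δ) fun z hz =>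
    hf.side_pos hz.1 ⟨hδ.trans_le hz.2.1, hz.2.2⟩

lemma IsRadiusFlow.continuousOn_sideSqRate (hf : IsRadiusFlow m U a b l k) (δ : ℝ) :
    ContinuousOn (fun z : ℝ × ℝ => sideSqRate a b l k z.1 z.2) (U ×ˢ Icc δ Real.pi) := by
  have ha := continuousOn_comp_fst (S := Icc δ Real.pi) fun t ht => (hf.deriv_a t ht).continuousAt
  have hb := continuousOn_comp_fst (S := Icc δ Real.pi) fun t ht => (hf.deriv_b t ht).continuousAt
  have hl := continuousOn_comp_fst (S := Icc δ Real.pi) fun t ht => (hf.deriv_l t ht).continuousAt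
  have hk := continuousOn_comp_fst (S := Icc δ Real.pi) fun t ht => (hf.deriv_k t ht).continuousAt
  have key : ∀ (A B L K : ℝ × ℝ → ℝ) (S : Set (ℝ × ℝ)), ContinuousOn A S → ContinuousOn B S →
      ContinuousOn L S → ContinuousOn K S → ContinuousOn (fun z => 2 * L z * A z ^ 2 +
        2 * K z * B z ^ 2 - 2 * (L z + K z) * (A z * B z) * Real.cos z.2) S := by
    intro A B L K S hA hB hL hK
    fun_prop
  exact key _ _ _ _ _ ha hb hl hk

lemma IsRadiusFlow.continuousOn_relativeRate (hf : IsRadiusFlow m U a b l k) (δ : ℝ) (i : ℕ) :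
    ContinuousOn (fun z : ℝ × ℝ => (l z.1 - k z.1) ^ 2 * (a z.1 * b z.1) ^ i)
      (U ×ˢ Icc δ Real.pi) := by
  have ha := continuousOn_comp_fst (S := Icc δ Real.pi) fun t ht => (hf.deriv_a t ht).continuousAt
  have hb := continuousOn_comp_fst (S := Icc δ Real.pi) fun t ht => (hf.deriv_b t ht).continuousAt
  have hl := continuousOn_comp_fst (S := Icc δ Real.pi) fun t ht => (hf.deriv_l t ht).continuousAt
  have hk := continuousOn_comp_fst (S := Icc δ Real.pi) fun t ht => (hf.deriv_k t ht).continuousAt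
  exact ((hl.sub hk).pow 2).mul ((ha.mul hb).pow i)

lemma IsRadiusFlow.continuousOn_meanIntegrand (hf : IsRadiusFlow m U a b l k)
    (hw : IsRadialProfile m w) (hδ : 0 < δ) :
    ContinuousOn (Function.uncurry (meanIntegrand m w a b)) (U ×ˢ Icc δ Real.pi) := by
  have h := hf.continuousOn_comp_side hδ fun R hR => (hw.hasDerivAt_radialMean hR).continuousAt
  unfold meanIntegrand Function.uncurry
  fun_prop

lemma IsRadiusFlow.continuousOn_meanIntegrandDeriv (hf : IsRadiusFlow m U a b l k)
    (hw : IsRadialProfile m w) (hδ : 0 < δ) :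
    ContinuousOn (Function.uncurry (meanIntegrandDeriv m w a b l k)) (U ×ˢ Icc δ Real.pi) := by
  have h1 := hf.continuousOn_comp_side hδ fun R hR => (hw.hasDerivAt_radialExcess hR).continuousAt
  have h2 := hf.continuousOn_sideSqRate δ
  have h3 := hf.continuousOn_side δ
  unfold meanIntegrandDeriv Function.uncurry
  refine ContinuousOn.mul (by fun_prop) (ContinuousOn.div (by fun_prop) (by fun_prop) ?_)
  intro z hz
  have := hf.side_pos hz.1 ⟨hδ.trans_le hz.2.1, hz.2.2⟩
  positivity

lemma IsRadiusFlow.continuousOn_weight (hf : IsRadiusFlow m U a b l k)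
    (hw : IsRadialProfile m w) (hδ : 0 < δ) :
    ContinuousOn (fun z : ℝ × ℝ => deriv w (thirdSide (a z.1) (b z.1) z.2) /
      thirdSide (a z.1) (b z.1) z.2 ^ 3 * Real.sin z.2 ^ (m + 1)) (U ×ˢ Icc δ Real.pi) := by
  have h1 := hf.continuousOn_comp_side hδ fun R hR =>
    hw.continuousOn_deriv.continuousAt (Ioi_mem_nhds hR)
  refine ContinuousOn.mul (ContinuousOn.div h1 ((hf.continuousOn_side δ).pow 3) fun z hz => ?_)
    (by fun_prop)
  exact (pow_pos (hf.side_pos hz.1 ⟨hδ.trans_le hz.2.1, hz.2.2⟩) 3).ne'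

lemma IsRadiusFlow.continuousOn_density (hf : IsRadiusFlow m U a b l k)
    (hw : IsRadialProfile m w) (hδ : 0 < δ) :
    ContinuousOn (Function.uncurry (convexityDensity m w a b l k)) (U ×ˢ Icc δ Real.pi) := by
  have hs : ContinuousOn (fun z : ℝ × ℝ => Real.sin z.2 ^ 2) (U ×ˢ Icc δ Real.pi) := by fun_prop
  exact (hf.continuousOn_weight hw hδ).mul ((((hf.continuousOn_sideSqRate δ).pow 2).div_const 4).add
    ((hf.continuousOn_relativeRate δ 2).mul hs))

lemma IsRadiusFlow.continuousOn_fluxDeriv (hf : IsRadiusFlow m U a b l k)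
    (hw : IsRadialProfile m w) (hδ : 0 < δ) :
    ContinuousOn (Function.uncurry (convexityFluxDeriv m w a b l k)) (U ×ˢ Icc δ Real.pi) := by
  have ha := continuousOn_comp_fst (S := Icc δ Real.pi) fun t ht => (hf.deriv_a t ht).continuousAt
  have hb := continuousOn_comp_fst (S := Icc δ Real.pi) fun t ht => (hf.deriv_b t ht).continuousAt
  have h2 := hf.continuousOn_comp_side hδ fun R hR => (hw.hasDerivAt_radialExcess hR).continuousAt
  have h3 := hf.continuousOn_side δ
  have hs : ∀ i : ℕ, ContinuousOn (fun z : ℝ × ℝ => Real.sin z.2 ^ i) (U ×ˢ Icc δ Real.pi) :=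
    fun i => by fun_prop
  have hc : ContinuousOn (fun z : ℝ × ℝ => ((m : ℝ) + 2) * Real.cos z.2) (U ×ˢ Icc δ Real.pi) := by
    fun_prop
  have hq := hf.continuousOn_relativeRate δ 1
  simp only [pow_one] at hq
  refine ((hf.continuousOn_weight hw hδ).mul ((hf.continuousOn_relativeRate δ 2).mul (hs 2))).add
    ((((h2.mul hq).mul (hs (m + 1))).mul ((hc.mul (h3.pow 2)).sub
      ((continuousOn_const.mul (ha.mul hb)).mul (hs 2)))).div (h3.pow (m + 5)) fun z hz => ?_)
  exact (pow_pos (hf.side_pos hz.1 ⟨hδ.trans_le hz.2.1, hz.2.2⟩) (m + 5)).ne'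

lemma IsRadiusFlow.density_nonneg (hf : IsRadiusFlow m U a b l k) (hw : IsRadialProfile m w)
    {t φ : ℝ} (ht : t ∈ U) (hφ : φ ∈ Ioc 0 Real.pi) : 0 ≤ convexityDensity m w a b l k t φ := by
  have hR := hf.side_pos ht hφ
  have h1 := hw.deriv_pos _ hR
  have h2 := Real.sin_nonneg_of_mem_Icc ⟨hφ.1.le, hφ.2⟩
  unfold convexityDensity
  positivity

lemma IsRadiusFlow.density_pos (hf : IsRadiusFlow m U a b l k) (hw : IsRadialProfile m w)
    {t φ : ℝ} (ht : t ∈ U) (hφ : φ ∈ Ioo 0 Real.pi) (hne : l t ≠ 0 ∨ k t ≠ 0) :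
    0 < convexityDensity m w a b l k t φ := by
  have hφ' := Ioo_subset_Ioc_self hφ
  have hR := hf.side_pos ht hφ'
  have h1 := hw.deriv_pos _ hR
  have h2 := Real.sin_pos_of_mem_Ioo hφ
  have ha := hf.a_pos t ht
  have hb := hf.b_pos t ht
  unfold convexityDensity
  refine mul_pos (by positivity) ?_
  by_cases hlk : l t = k t
  · -- equal logarithmic rates: the triangle is dilated, and its third side changes
    have h3 : sideSqRate a b l k t φ = 2 * l t * thirdSide (a t) (b t) φ ^ 2 := by
      rw [thirdSide_sq ha hb hφ', sideSqRate, ← hlk]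
      ring
    have hl : l t ≠ 0 := by
      rcases hne with h | h
      · exact h
      · rwa [hlk]
    have h4 : sideSqRate a b l k t φ ≠ 0 := by
      rw [h3]
      exact mul_ne_zero (mul_ne_zero two_ne_zero hl) (pow_pos hR 2).ne'
    have : 0 < sideSqRate a b l k t φ ^ 2 := by positivity
    nlinarith [sq_nonneg ((l t - k t) * (a t * b t) * Real.sin φ)]
  · have h5 : 0 < (l t - k t) ^ 2 := by
      have := sub_ne_zero.2 hlk
      positivity
    positivity

lemma IsRadiusFlow.flux_nonneg (hf : IsRadiusFlow m U a b l k) (hw : IsRadialProfile m w)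
    {t φ : ℝ} (ht : t ∈ U) (hφ : φ ∈ Ioc 0 Real.pi) : 0 ≤ convexityFlux m w a b l k t φ := by
  have hR := hf.side_pos ht hφ
  have h1 := hw.radialExcess_nonneg hR
  have h2 := Real.sin_nonneg_of_mem_Icc ⟨hφ.1.le, hφ.2⟩
  have ha := hf.a_pos t ht
  have hb := hf.b_pos t ht
  unfold convexityFlux
  positivity

lemma flux_pi (t : ℝ) : convexityFlux m w a b l k t Real.pi = 0 := by
  simp [convexityFlux]

lemma continuousOn_section {f : ℝ → ℝ → ℝ} {S : Set ℝ}
    (hf : ContinuousOn (Function.uncurry f) (U ×ˢ S)) {t : ℝ} (ht : t ∈ U) :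
    ContinuousOn (f t) S :=
  hf.comp (f := fun φ => (t, φ)) (by fun_prop) fun φ hφ => ⟨ht, hφ⟩

/-- The mean interaction without the angles below `δ`; for positive `δ` the third side stays away
from zero, where the profile may be singular. -/
def truncatedMean (m : ℕ) (w : ℝ → ℝ) (a b : ℝ → ℝ) (δ t : ℝ) : ℝ :=
  ∫ φ in δ..Real.pi, meanIntegrand m w a b t φ

lemma IsRadiusFlow.hasDerivAt_truncatedMean (hf : IsRadiusFlow m U a b l k) (hU : IsOpen U)
    (hw : IsRadialProfile m w) (hδ : δ ∈ Ioc 0 Real.pi) {t : ℝ} (ht : t ∈ U) :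
    HasDerivAt (truncatedMean m w a b δ)
      (∫ φ in δ..Real.pi, meanIntegrandDeriv m w a b l k t φ) t :=
  hasDerivAt_intervalIntegral_of_continuousOn hU hδ.2 (hf.continuousOn_meanIntegrand hw hδ.1)
    (hf.continuousOn_meanIntegrandDeriv hw hδ.1)
    (fun _ ht _ hφ => hf.hasDerivAt_meanIntegrand hw ht ⟨hδ.1.trans_le hφ.1, hφ.2⟩) ht

/-- The angular derivative integrates to a boundary term: the flux vanishes at the angle `π`, and
the flux at `δ` enters with the favourable sign. -/
lemma IsRadiusFlow.hasDerivAt_truncatedMeanDeriv (hf : IsRadiusFlow m U a b l k) (hU : IsOpen U)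
    (hw : IsRadialProfile m w) (hδ : δ ∈ Ioc 0 Real.pi) {t : ℝ} (ht : t ∈ U) :
    HasDerivAt (fun t => ∫ φ in δ..Real.pi, meanIntegrandDeriv m w a b l k t φ)
      ((∫ φ in δ..Real.pi, convexityDensity m w a b l k t φ) +
        convexityFlux m w a b l k t δ) t := by
  have hcd := hf.continuousOn_density hw hδ.1
  have hcf := hf.continuousOn_fluxDeriv hw hδ.1
  have h := hasDerivAt_intervalIntegral_of_continuousOn hU hδ.2
    (hf.continuousOn_meanIntegrandDeriv hw hδ.1) (g' := fun t φ =>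
      convexityDensity m w a b l k t φ - convexityFluxDeriv m w a b l k t φ) (hcd.sub hcf)
    (fun _ ht _ hφ => hf.hasDerivAt_meanIntegrandDeriv hw ht ⟨hδ.1.trans_le hφ.1, hφ.2⟩) ht
  refine h.congr_deriv ?_
  rw [intervalIntegral.integral_sub
    ((continuousOn_section hcd ht).intervalIntegrable_of_Icc hδ.2)
    ((continuousOn_section hcf ht).intervalIntegrable_of_Icc hδ.2),
    intervalIntegral.integral_eq_sub_of_hasDerivAt (f := convexityFlux m w a b l k t)
    (fun φ hφ => ?_) ((continuousOn_section hcf ht).intervalIntegrable_of_Icc hδ.2), flux_pi]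
  · ring
  · rw [uIcc_of_le hδ.2] at hφ
    exact hf.hasDerivAt_flux hw ht ⟨hδ.1.trans_le hφ.1, hφ.2⟩

/-- The second time derivative of the truncated means is bounded below uniformly in the
truncation. -/
lemma IsRadiusFlow.exists_lower_bound (hf : IsRadiusFlow m U a b l k) (hI : Icc 0 1 ⊆ U)
    (hw : IsRadialProfile m w) (hne : ∀ t ∈ Icc (0 : ℝ) 1, l t ≠ 0 ∨ k t ≠ 0) :
    ∃ κ > 0, ∀ δ ∈ Ioc 0 (Real.pi / 2), ∀ t ∈ Icc (0 : ℝ) 1,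
      κ ≤ (∫ φ in δ..Real.pi, convexityDensity m w a b l k t φ)
        + convexityFlux m w a b l k t δ := by
  have hpi := Real.pi_pos
  -- away from the angles `0` and `π` the density has a positive minimum by compactness
  set β := 3 * Real.pi / 4
  have hcomp : IsCompact (Icc (0 : ℝ) 1 ×ˢ Icc (Real.pi / 2) β) := isCompact_Icc.prod isCompact_Icc
  have hβ : Real.pi / 2 < β ∧ β < Real.pi := 
    ⟨by simp only [β]; linarith, by simp only [β]; linarith⟩
  have hcont := (hf.continuousOn_density hw (half_pos hpi)).mono
    (prod_mono hI (Icc_subset_Icc_right hβ.2.le))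
  obtain ⟨z, hz, hmin⟩ := hcomp.exists_isMinOn
    ⟨(0, Real.pi / 2), ⟨by simp, left_mem_Icc.2 hβ.1.le⟩⟩ hcont
  have hc0 : 0 < convexityDensity m w a b l k z.1 z.2 := hf.density_pos hw (hI hz.1)
    ⟨(half_pos hpi).trans_le hz.2.1, hz.2.2.trans_lt hβ.2⟩ (hne _ hz.1)
  have hmin' : ∀ t ∈ Icc (0 : ℝ) 1, ∀ φ ∈ Icc (Real.pi / 2) β,
      convexityDensity m w a b l k z.1 z.2 ≤ convexityDensity m w a b l k t φ :=
    fun t ht φ hφ => isMinOn_iff.1 hmin (t, φ) ⟨ht, hφ⟩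
  generalize convexityDensity m w a b l k z.1 z.2 = c at hc0 hmin'
  refine ⟨c * (β - Real.pi / 2), mul_pos hc0 (sub_pos.2 hβ.1), fun δ hδ t ht => ?_⟩
  have hδπ : δ ≤ Real.pi := hδ.2.trans (by linarith)
  have hflux := hf.flux_nonneg hw (hI ht) (φ := δ) ⟨hδ.1, hδπ⟩
  have hcs := continuousOn_section (hf.continuousOn_density hw hδ.1) (hI ht)
  have h1 : ∫ φ in (Real.pi / 2)..β, c
      ≤ ∫ φ in (Real.pi / 2)..β, convexityDensity m w a b l k t φ := by
    refine intervalIntegral.integral_mono_on hβ.1.le intervalIntegrable_const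
      ((hcs.mono (Icc_subset_Icc hδ.2 hβ.2.le)).intervalIntegrable_of_Icc hβ.1.le) fun φ hφ => ?_
    exact hmin' t ht φ hφ
  have h2 : ∫ φ in (Real.pi / 2)..β, convexityDensity m w a b l k t φ
      ≤ ∫ φ in δ..Real.pi, convexityDensity m w a b l k t φ := by
    refine intervalIntegral.integral_mono_interval hδ.2 hβ.1.le hβ.2.le ?_
      (hcs.intervalIntegrable_of_Icc hδπ)
    refine (ae_restrict_mem measurableSet_Ioc).mono fun φ hφ => ?_
    exact hf.density_nonneg hw (hI ht) ⟨hδ.1.trans hφ.1, hφ.2⟩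
  rw [intervalIntegral.integral_const, smul_eq_mul, mul_comm] at h1
  linarith

lemma IsRadiusFlow.truncatedMean_le (hf : IsRadiusFlow m U a b l k) (hU : IsOpen U)
    (hI : Icc 0 1 ⊆ U) (hw : IsRadialProfile m w) {κ : ℝ} (hδ : δ ∈ Ioc 0 (Real.pi / 2))
    (hκ : ∀ t ∈ Icc (0 : ℝ) 1, κ ≤ (∫ φ in δ..Real.pi, convexityDensity m w a b l k t φ)
        + convexityFlux m w a b l k t δ) {t : ℝ} (ht : t ∈ Icc (0 : ℝ) 1) :
    truncatedMean m w a b δ t ≤ (1 - t) * truncatedMean m w a b δ 0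
      + t * truncatedMean m w a b δ 1 - κ / 2 * (t * (1 - t)) := by
  have hδ' : δ ∈ Ioc 0 Real.pi := ⟨hδ.1, hδ.2.trans (by linarith [Real.pi_pos])⟩
  -- subtracting a parabola leaves a convex function
  set G : ℝ → ℝ := fun t => truncatedMean m w a b δ t - κ / 2 * t ^ 2 with hG
  have d1 : ∀ t ∈ U, HasDerivAt G
      ((∫ φ in δ..Real.pi, meanIntegrandDeriv m w a b l k t φ) - κ * t) t := by
    intro t ht
    refine ((hf.hasDerivAt_truncatedMean hU hw hδ' ht).sub
      ((hasDerivAt_pow 2 t).const_mul (κ / 2))).congr_deriv ?_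
    push_cast
    ring
  have d2 : ∀ t ∈ U, HasDerivAt (deriv G) ((∫ φ in δ..Real.pi, convexityDensity m w a b l k t φ)
        + convexityFlux m w a b l k t δ - κ) t := by
    intro t ht
    have h := (hf.hasDerivAt_truncatedMeanDeriv hU hw hδ' ht).sub ((hasDerivAt_id t).const_mul κ)
    refine (h.congr_of_eventuallyEq ?_).congr_deriv (by ring)
    filter_upwards [hU.mem_nhds ht] with s hs
    exact (d1 s hs).deriv
  have hint : interior (Icc (0 : ℝ) 1) ⊆ U := interior_subset.trans hI
  have hconv : ConvexOn ℝ (Icc (0 : ℝ) 1) G := by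
    refine convexOn_of_deriv2_nonneg (convex_Icc 0 1)
      (fun t ht => (d1 t (hI ht)).continuousAt.continuousWithinAt)
      (fun t ht => (d1 t (hint ht)).differentiableAt.differentiableWithinAt)
      (fun t ht => (d2 t (hint ht)).differentiableAt.differentiableWithinAt) fun t ht => ?_
    have : deriv^[2] G t = deriv (deriv G) t := rfl
    rw [this, (d2 t (hint ht)).deriv]
    linarith [hκ t (interior_subset ht)]
  have h := hconv.2 (left_mem_Icc.2 zero_le_one) (right_mem_Icc.2 zero_le_one)
    (sub_nonneg.2 ht.2) ht.1 (by ring)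
  simp only [smul_eq_mul, mul_zero, mul_one, zero_add, hG] at h
  linarith

/-- The mean interaction is strictly convex along every nonconstant flow of radii: the quantitative
convexity of the truncated means survives the limit in which the truncation is removed. -/
lemma IsRadiusFlow.mean_lt (hf : IsRadiusFlow m U a b l k) (hU : IsOpen U)
    (hI : Icc 0 1 ⊆ U) (hw : IsRadialProfile m w)
    (hne : ∀ t ∈ Icc (0 : ℝ) 1, l t ≠ 0 ∨ k t ≠ 0)
    (hint : ∀ t ∈ Icc (0 : ℝ) 1, IntegrableOn (meanIntegrand m w a b t) (Ioo 0 Real.pi))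
    {t : ℝ} (ht : t ∈ Ioo (0 : ℝ) 1) :
    ∫ φ in Ioo 0 Real.pi, meanIntegrand m w a b t φ <
      (1 - t) * (∫ φ in Ioo 0 Real.pi, meanIntegrand m w a b 0 φ)
        + t * ∫ φ in Ioo 0 Real.pi, meanIntegrand m w a b 1 φ := by
  have hpi := Real.pi_pos
  obtain ⟨κ, hκ0, hκ⟩ := hf.exists_lower_bound hI hw hne
  have hlim : ∀ t ∈ Icc (0 : ℝ) 1, Tendsto (fun δ => truncatedMean m w a b δ t) (𝓝[>] 0)
      (𝓝 (∫ φ in Ioo 0 Real.pi, meanIntegrand m w a b t φ)) := by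
    intro t ht
    have h1 : IntegrableOn (meanIntegrand m w a b t) (uIcc 0 Real.pi) := by
      rw [uIcc_of_le hpi.le]
      exact (integrableOn_Icc_iff_integrableOn_Ioo (by simp) (by simp)).2 (hint t ht)
    have h2 := intervalIntegral.continuousOn_primitive_interval_left h1
    rw [uIcc_of_le hpi.le] at h2
    have h3 := h2 0 (left_mem_Icc.2 hpi.le)
    have h4 : Tendsto (fun δ => truncatedMean m w a b δ t) (𝓝[>] 0)
        (𝓝 (∫ φ in (0 : ℝ)..Real.pi, meanIntegrand m w a b t φ)) := by
      refine Tendsto.mono_left h3 ?_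
      rw [← nhdsWithin_Ioo_eq_nhdsGT hpi]
      exact nhdsWithin_mono _ Ioo_subset_Icc_self
    rwa [intervalIntegral.integral_of_le hpi.le, integral_Ioc_eq_integral_Ioo] at h4
  have h0 := hlim 0 (left_mem_Icc.2 zero_le_one)
  have h1 := hlim 1 (right_mem_Icc.2 zero_le_one)
  have hle := le_of_tendsto_of_tendsto (hlim t (Ioo_subset_Icc_self ht))
    (((h0.const_mul (1 - t)).add (h1.const_mul t)).sub_const (κ / 2 * (t * (1 - t)))) (by
      filter_upwards [Ioo_mem_nhdsGT (half_pos hpi)] with δ hδ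
      exact hf.truncatedMean_le hU hI hw (Ioo_subset_Ioc_self hδ)
        (hκ δ (Ioo_subset_Ioc_self hδ)) (Ioo_subset_Icc_self ht))
  have : 0 < κ / 2 * (t * (1 - t)) :=
    mul_pos (half_pos hκ0) (mul_pos ht.1 (sub_pos.2 ht.2))
  linarith

end Flow

/-- The mean interaction of two centred balls with reciprocal volumes `p` and `q`, up to a constant
factor. -/
def ballInteraction (m : ℕ) (w : ℝ → ℝ) (p q : ℝ) : ℝ :=
  ∫ φ in Ioo 0 Real.pi, Real.sin φ ^ (m + 1) *
    radialMean m w (thirdSide (layerRadius (m + 1) p) (layerRadius (m + 1) q) φ)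

lemma hasDerivAt_layerRadius (m : ℕ) {p₀ p₁ t : ℝ} (hp : 0 < (1 - t) * p₀ + t * p₁) :
    HasDerivAt (fun t => layerRadius (m + 1) ((1 - t) * p₀ + t * p₁))
      (-((p₁ - p₀) / ((m + 1) * ((1 - t) * p₀ + t * p₁))) *
        layerRadius (m + 1) ((1 - t) * p₀ + t * p₁)) t := by
  have hκ := unitBallVolume_pos (m + 1)
  have h1 : HasDerivAt (fun t : ℝ => unitBallVolume (m + 1) * ((1 - t) * p₀ + t * p₁))
      (unitBallVolume (m + 1) * (p₁ - p₀)) t := by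
    refine (((((hasDerivAt_id t).const_sub 1).mul_const p₀).add
      ((hasDerivAt_id t).mul_const p₁)).const_mul _).congr_deriv ?_
    ring
  have h := h1.rpow_const (p := -(1 / ((m + 1 : ℕ) : ℝ))) (Or.inl (mul_pos hκ hp).ne')
  refine h.congr_deriv ?_
  rw [Real.rpow_sub_one (mul_pos hκ hp).ne', layerRadius]
  push_cast
  field_simp

lemma hasDerivAt_logRate (m : ℕ) {p₀ p₁ t : ℝ} (hp : 0 < (1 - t) * p₀ + t * p₁) :
    HasDerivAt (fun t => -((p₁ - p₀) / ((m + 1) * ((1 - t) * p₀ + t * p₁))))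
      ((m + 1) * (-((p₁ - p₀) / ((m + 1) * ((1 - t) * p₀ + t * p₁)))) ^ 2) t := by
  have h1 : HasDerivAt (fun t : ℝ => ((m : ℝ) + 1) * ((1 - t) * p₀ + t * p₁))
      (((m : ℝ) + 1) * (p₁ - p₀)) t := by
    refine (((((hasDerivAt_id t).const_sub 1).mul_const p₀).add
      ((hasDerivAt_id t).mul_const p₁)).const_mul _).congr_deriv ?_
    ring
  have hm : (0 : ℝ) < m + 1 := by positivity
  refine (((hasDerivAt_const t (p₁ - p₀)).div h1 (mul_pos hm hp).ne').neg).congr_deriv ?_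
  field_simp
  ring

/-- The mean interaction of two centred balls is a strictly convex function of their reciprocal
volumes. -/
theorem IsRadialProfile.ballInteraction_lt {m : ℕ} {w : ℝ → ℝ} (hw : IsRadialProfile m w)
    (hint : ∀ p q, 0 < p → 0 < q → IntegrableOn (fun φ => Real.sin φ ^ (m + 1) *
      radialMean m w (thirdSide (layerRadius (m + 1) p) (layerRadius (m + 1) q) φ)) (Ioo 0 Real.pi))
    {p₀ q₀ p₁ q₁ t : ℝ} (hp₀ : 0 < p₀) (hq₀ : 0 < q₀) (hp₁ : 0 < p₁) (hq₁ : 0 < q₁)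
    (hne : p₀ ≠ p₁ ∨ q₀ ≠ q₁) (ht : t ∈ Ioo (0 : ℝ) 1) :
    ballInteraction m w ((1 - t) * p₀ + t * p₁) ((1 - t) * q₀ + t * q₁) <
      (1 - t) * ballInteraction m w p₀ q₀ + t * ballInteraction m w p₁ q₁ := by
  set U : Set ℝ := {t | 0 < (1 - t) * p₀ + t * p₁ ∧ 0 < (1 - t) * q₀ + t * q₁} with hUdef
  have hopen : ∀ x y : ℝ, IsOpen {t : ℝ | 0 < (1 - t) * x + t * y} := fun x y =>
    isOpen_lt continuous_const (by fun_prop)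
  have hU : IsOpen U := (hopen p₀ p₁).inter (hopen q₀ q₁)
  have hpos : ∀ {x y : ℝ}, 0 < x → 0 < y → ∀ t ∈ Icc (0 : ℝ) 1, 0 < (1 - t) * x + t * y := by
    intro x y hx hy t ht
    rcases ht.1.eq_or_lt with rfl | h
    · simpa using hx
    · exact add_pos_of_nonneg_of_pos (mul_nonneg (sub_nonneg.2 ht.2) hx.le) (mul_pos h hy)
  have hI : Icc 0 1 ⊆ U := fun t ht => ⟨hpos hp₀ hp₁ t ht, hpos hq₀ hq₁ t ht⟩
  have hf : IsRadiusFlow m U (fun t => layerRadius (m + 1) ((1 - t) * p₀ + t * p₁))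
      (fun t => layerRadius (m + 1) ((1 - t) * q₀ + t * q₁))
      (fun t => -((p₁ - p₀) / ((m + 1) * ((1 - t) * p₀ + t * p₁))))
      (fun t => -((q₁ - q₀) / ((m + 1) * ((1 - t) * q₀ + t * q₁)))) :=
    { a_pos := fun t ht => layerRadius_pos _ ht.1
      b_pos := fun t ht => layerRadius_pos _ ht.2
      deriv_a := fun t ht => hasDerivAt_layerRadius m ht.1
      deriv_b := fun t ht => hasDerivAt_layerRadius m ht.2
      deriv_l := fun t ht => hasDerivAt_logRate m ht.1
      deriv_k := fun t ht => hasDerivAt_logRate m ht.2 }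
  have hm : (0 : ℝ) < m + 1 := by positivity
  have h := hf.mean_lt hU hI hw (fun t ht => hne.imp
      (fun h => neg_ne_zero.2 (div_ne_zero (sub_ne_zero.2 h.symm) (mul_pos hm (hI ht).1).ne'))
      (fun h => neg_ne_zero.2 (div_ne_zero (sub_ne_zero.2 h.symm) (mul_pos hm (hI ht).2).ne')))
    (fun t ht => hint _ _ (hI ht).1 (hI ht).2) ht
  simp only [meanIntegrand, sub_zero, one_mul, zero_mul, add_zero, sub_self, zero_add] at h
  exact h

/-! ### The radial profile of the potential -/

section Potential

variable {m : ℕ} {W : EuclideanSpace ℝ (Fin (m + 1)) → ℝ} {w : ℝ → ℝ}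

lemma IsAttractivePotential.contDiffOn (hW : IsAttractivePotential W w) :
    ContDiffOn ℝ ∞ w (Ioi 0) := by
  set e : EuclideanSpace ℝ (Fin (m + 1)) := EuclideanSpace.single 0 1
  have he : ‖e‖ = 1 := by simp [e]
  have he0 : e ≠ 0 := norm_ne_zero_iff.1 (by rw [he]; exact one_ne_zero)
  have h : ContDiffOn ℝ ∞ (fun r : ℝ => W (r • e)) (Ioi 0) :=
    hW.smooth.comp (f := fun r : ℝ => r • e) (contDiff_id.smul contDiff_const).contDiffOn
      fun r hr => smul_ne_zero (ne_of_gt hr) he0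
  refine h.congr fun r hr => ?_
  rw [hW.radial _ (smul_ne_zero (ne_of_gt hr) he0), norm_smul, he, mul_one,
    Real.norm_of_nonneg (le_of_lt hr)]

lemma IsAttractivePotential.differentiableAt (hW : IsAttractivePotential W w) {r : ℝ} (hr : 0 < r) :
    DifferentiableAt ℝ w r :=
  (hW.contDiffOn.differentiableOn (by simp)).differentiableAt (Ioi_mem_nhds hr)

lemma IsAttractivePotential.strictMonoOn (hW : IsAttractivePotential W w) :
    StrictMonoOn w (Ioi 0) :=
  strictMonoOn_of_deriv_pos (convex_Ioi 0) hW.contDiffOn.continuousOn fun r hr =>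
    hW.deriv_pos r (by simpa using hr)

/-- The profile is bounded below, up to a locally integrable negative power at the origin. -/
lemma IsAttractivePotential.exists_lower_bound (hW : IsAttractivePotential W w)
    (hw : SingularityBound (m + 1) w) : ∃ A B k : ℝ, 0 ≤ A ∧ 0 ≤ B ∧ -((m : ℝ) + 1) < k ∧
      (∀ r ∈ Ioo (0 : ℝ) 1, -(A + B * r ^ k) ≤ w r) ∧ ∀ r, 1 ≤ r → -A ≤ w r := by
  obtain ⟨k, C, hk, hC, hb⟩ := hw
  -- a smaller exponent is allowed, and a negative one avoids the logarithmic case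
  set j : ℝ := min k (-(1 / 2)) with hj
  have hj0 : j < 0 := (min_le_right _ _).trans_lt (by norm_num)
  have hjm : -((m : ℝ) + 1) < j := by
    refine lt_min (by push_cast at hk; exact hk) ?_
    have : (0 : ℝ) ≤ m := Nat.cast_nonneg m
    linarith
  have hanti : AntitoneOn (fun r => w r - C / j * r ^ j) (Ioc 0 1) := by
    have hd : ∀ r, 0 < r → HasDerivAt (fun r => w r - C / j * r ^ j)
        (deriv w r - C * r ^ (j - 1)) r := by
      intro r hr
      refine ((hW.differentiableAt hr).hasDerivAt.sub
        ((Real.hasDerivAt_rpow_const (Or.inl hr.ne')).const_mul (C / j))).congr_deriv ?_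
      rw [← mul_assoc, div_mul_cancel₀ C hj0.ne]
    refine antitoneOn_of_deriv_nonpos (convex_Ioc 0 1)
      (fun r hr => (hd r hr.1).continuousAt.continuousWithinAt)
      (fun r hr => ?_) (fun r hr => ?_)
    · rw [interior_Ioc] at hr
      exact (hd r hr.1).differentiableAt.differentiableWithinAt
    · rw [interior_Ioc] at hr
      rw [(hd r hr.1).deriv, sub_nonpos]
      refine (hb r hr).trans (mul_le_mul_of_nonneg_left ?_ hC.le)
      exact Real.rpow_le_rpow_of_exponent_ge hr.1 hr.2.le (by linarith [min_le_left k (-(1 / 2))])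
  refine ⟨|w 1|, -(C / j), j, abs_nonneg _, ?_, hjm, fun r hr => ?_, fun r hr => ?_⟩
  · rw [neg_nonneg]
    exact div_nonpos_of_nonneg_of_nonpos hC.le hj0.le
  · have h := hanti (Ioo_subset_Ioc_self hr) (right_mem_Ioc.2 zero_lt_one) hr.2.le
    simp only [Real.one_rpow, mul_one] at h
    have h1 : C / j ≤ 0 := div_nonpos_of_nonneg_of_nonpos hC.le hj0.le
    linarith [neg_abs_le (w 1)]
  · have h := hW.strictMonoOn.monotoneOn (mem_Ioi.2 one_pos) (mem_Ioi.2 (by linarith)) hr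
    linarith [neg_abs_le (w 1)]

lemma integrableOn_pow_mul_rpow {k : ℝ} (hk : -((m : ℝ) + 1) < k) {R : ℝ} (hR : 0 < R) :
    IntegrableOn (fun r : ℝ => r ^ m * r ^ k) (Ioo 0 R) := by
  have h := (intervalIntegrable_iff_integrableOn_Ioo_of_le hR.le).1
    (intervalIntegral.intervalIntegrable_rpow' (a := 0) (b := R) (r := m + k) (by linarith))
  refine h.congr_fun (fun r hr => ?_) measurableSet_Ioo
  dsimp only
  rw [Real.rpow_add hr.1, Real.rpow_natCast]

lemma IsAttractivePotential.isRadialProfile (hW : IsAttractivePotential W w)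
    (hw : SingularityBound (m + 1) w) : IsRadialProfile m w where
  differentiableAt r hr := hW.differentiableAt hr
  continuousOn_deriv := hW.contDiffOn.continuousOn_deriv_of_isOpen isOpen_Ioi (by simp)
  deriv_pos := hW.deriv_pos
  integrableOn R hR := by
    obtain ⟨A, B, k, hA, hB, hk, h1, h2⟩ := hW.exists_lower_bound hw
    have hcont : ContinuousOn (fun r => r ^ m * w r) (Ioo 0 R) :=
      (continuousOn_pow m).mul (hW.contDiffOn.continuousOn.mono fun r hr => hr.1)
    have hg : IntegrableOn (fun r : ℝ => (A + |w R|) * r ^ m + B * (r ^ m * r ^ k)) (Ioo 0 R) := by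
      refine Integrable.add ?_ ((integrableOn_pow_mul_rpow hk hR).const_mul B)
      exact ((by fun_prop : Continuous fun r : ℝ => (A + |w R|) * r ^ m).integrableOn_Icc).mono_set
        Ioo_subset_Icc_self
    refine Integrable.mono' hg (hcont.aestronglyMeasurable measurableSet_Ioo) ?_
    filter_upwards [ae_restrict_mem measurableSet_Ioo] with r hr
    have hrm : 0 ≤ r ^ m := pow_nonneg hr.1.le m
    have hrk : 0 ≤ B * r ^ k := mul_nonneg hB (Real.rpow_nonneg hr.1.le k)
    have hup : w r ≤ w R := (hW.strictMonoOn hr.1 hR hr.2).le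
    have hlow : -(A + B * r ^ k) ≤ w r := by
      rcases lt_or_ge r 1 with h | h
      · exact h1 r ⟨hr.1, h⟩
      · linarith [h2 r h]
    rw [norm_mul, Real.norm_of_nonneg hrm, Real.norm_eq_abs]
    have : |w r| ≤ A + |w R| + B * r ^ k := by
      rw [abs_le]
      constructor
      · linarith [abs_nonneg (w R)]
      · linarith [le_abs_self (w R)]
    calc r ^ m * |w r| ≤ r ^ m * (A + |w R| + B * r ^ k) := mul_le_mul_of_nonneg_left this hrm
      _ = _ := by ring

end Potential

/-! ### The interaction of stacked densities -/

/-- The mean of a nonnegative radial kernel over two centred balls of volumes `1 / p` and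
`1 / q`. -/
def pairMean (n : ℕ) (g : ℝ → ENNReal) (p q : ℝ) : ENNReal :=
  ENNReal.ofReal p * ∫⁻ x in Metric.ball (0 : EuclideanSpace ℝ (Fin n)) (layerRadius n p),
    ENNReal.ofReal q * ∫⁻ y in Metric.ball (0 : EuclideanSpace ℝ (Fin n)) (layerRadius n q),
      g ‖x - y‖

section Kernel

variable {n : ℕ} {u : ℝ → ℝ} {g : ℝ → ENNReal}

/-- Integration against a stacked density, layer by layer. -/
lemma IsSlopeProfile.lintegral_stack_mul (hu : IsSlopeProfile u)
    {f : EuclideanSpace ℝ (Fin n) → ENNReal} (hf : Measurable f) :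
    ∫⁻ x, ENNReal.ofReal (stack n u x) * f x = ∫⁻ s in Ioo (0 : ℝ) 1, ENNReal.ofReal (u s) *
      ∫⁻ x in Metric.ball (0 : EuclideanSpace ℝ (Fin n)) (layerRadius n (u s)), f x := by
  have hm : Measurable fun z : EuclideanSpace ℝ (Fin n) × ℝ =>
      (Metric.ball (0 : EuclideanSpace ℝ (Fin n)) (layerRadius n (u z.2))).indicator
        (fun _ => ENNReal.ofReal (u z.2)) z.1 :=
    measurable_layers hu.measurable hu.measurable.ennreal_ofReal
  have e1 : ∀ x, ENNReal.ofReal (stack n u x) * f x = ∫⁻ s in Ioo (0 : ℝ) 1,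
      (Metric.ball (0 : EuclideanSpace ℝ (Fin n)) (layerRadius n (u s))).indicator
        (fun _ => ENNReal.ofReal (u s)) x * f x := by
    intro x
    have hx : Measurable fun s =>
        (Metric.ball (0 : EuclideanSpace ℝ (Fin n)) (layerRadius n (u s))).indicator
          (fun _ => ENNReal.ofReal (u s)) x := by
      have h := hm.comp (measurable_prodMk_left (x := x))
      exact h
    rw [ofReal_stack hu, lintegral_mul_const _ hx]
  rw [lintegral_congr e1, lintegral_lintegral_swap (hm.mul (hf.comp measurable_fst)).aemeasurable]
  refine lintegral_congr fun s => ?_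
  rw [← lintegral_const_mul _ hf, ← lintegral_indicator measurableSet_ball]
  refine lintegral_congr fun x => ?_
  by_cases h : x ∈ Metric.ball (0 : EuclideanSpace ℝ (Fin n)) (layerRadius n (u s))
  · simp only [indicator_of_mem h]
  · simp only [indicator_of_notMem h, zero_mul]

lemma measurable_layer_potential (hu : Measurable u) (hg : Measurable g) :
    Measurable (fun z : EuclideanSpace ℝ (Fin n) × ℝ => ENNReal.ofReal (u z.2) *
      ∫⁻ y in Metric.ball (0 : EuclideanSpace ℝ (Fin n)) (layerRadius n (u z.2)), g ‖z.1 - y‖) := by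
  refine (hu.comp measurable_snd).ennreal_ofReal.mul ?_
  have hS : MeasurableSet {p : (EuclideanSpace ℝ (Fin n) × ℝ) × EuclideanSpace ℝ (Fin n) |
      ‖p.2‖ < layerRadius n (u p.1.2)} :=
    measurableSet_lt measurable_snd.norm
      ((measurable_layerRadius n).comp (hu.comp (measurable_snd.comp measurable_fst)))
  have hG : Measurable fun p : (EuclideanSpace ℝ (Fin n) × ℝ) × EuclideanSpace ℝ (Fin n) =>
      g ‖p.1.1 - p.2‖ :=
    hg.comp ((measurable_fst.comp measurable_fst).sub measurable_snd).norm
  have hI := (hG.indicator hS).lintegral_prod_right' (ν := volume)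
  convert hI using 1
  funext z
  rw [← lintegral_indicator measurableSet_ball]
  refine lintegral_congr fun y => ?_
  simp [indicator]

lemma measurable_pairMean (hu : Measurable u) (hg : Measurable g) :
    Measurable (fun z : ℝ × ℝ => pairMean n g (u z.1) (u z.2)) := by
  have h := measurable_layer_potential (n := n) hu hg
  unfold pairMean
  refine (hu.comp measurable_fst).ennreal_ofReal.mul ?_
  have hS : MeasurableSet {p : (ℝ × ℝ) × EuclideanSpace ℝ (Fin n) |
      ‖p.2‖ < layerRadius n (u p.1.1)} :=
    measurableSet_lt measurable_snd.norm
      ((measurable_layerRadius n).comp (hu.comp (measurable_fst.comp measurable_fst)))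
  have hG : Measurable fun p : (ℝ × ℝ) × EuclideanSpace ℝ (Fin n) =>
      ENNReal.ofReal (u p.1.2) *
      ∫⁻ y in Metric.ball (0 : EuclideanSpace ℝ (Fin n)) (layerRadius n (u p.1.2)), g ‖p.2 - y‖ :=
    h.comp (measurable_snd.prodMk (measurable_snd.comp measurable_fst))
  have hI := (hG.indicator hS).lintegral_prod_right' (ν := volume)
  convert hI using 1
  funext z
  rw [← lintegral_indicator measurableSet_ball]
  refine lintegral_congr fun y => ?_
  simp [indicator]

/-- The interaction of a stacked density with itself is the double integral over the mass variable
of the mean interactions of its layers. -/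
lemma IsSlopeProfile.lintegral_interaction (hu : IsSlopeProfile u) (hg : Measurable g) :
    ∫⁻ x : EuclideanSpace ℝ (Fin n), ∫⁻ y : EuclideanSpace ℝ (Fin n),
      ENNReal.ofReal (stack n u x) * (ENNReal.ofReal (stack n u y) * g ‖x - y‖)
    = ∫⁻ z : ℝ × ℝ, pairMean n g (u z.1) (u z.2)
        ∂((volume.restrict (Ioo (0 : ℝ) 1)).prod (volume.restrict (Ioo (0 : ℝ) 1))) := by
  have hpot := measurable_layer_potential (n := n) hu.measurable hg
  have hgx : ∀ x : EuclideanSpace ℝ (Fin n),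
      Measurable fun y : EuclideanSpace ℝ (Fin n) => g ‖x - y‖ := fun x =>
    hg.comp (measurable_const.sub measurable_id).norm
  have e1 : ∀ x : EuclideanSpace ℝ (Fin n), ∫⁻ y : EuclideanSpace ℝ (Fin n),
      ENNReal.ofReal (stack n u x) * (ENNReal.ofReal (stack n u y) * g ‖x - y‖)
      = ENNReal.ofReal (stack n u x) * ∫⁻ r in Ioo (0 : ℝ) 1, ENNReal.ofReal (u r) *
        ∫⁻ y in Metric.ball (0 : EuclideanSpace ℝ (Fin n)) (layerRadius n (u r)), g ‖x - y‖ := by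
    intro x
    rw [lintegral_const_mul' _ _ ENNReal.ofReal_ne_top, hu.lintegral_stack_mul (hgx x)]
  rw [lintegral_congr e1, hu.lintegral_stack_mul hpot.lintegral_prod_right',
    lintegral_prod _ (measurable_pairMean hu.measurable hg).aemeasurable]
  refine lintegral_congr fun s => ?_
  unfold pairMean
  dsimp only
  rw [lintegral_const_mul' _ _ ENNReal.ofReal_ne_top,
    lintegral_lintegral_swap hpot.aemeasurable]

end Kernel

/-! ### Positive and negative parts of the interaction kernel -/

/-- The positive part of the profile `w` on `(0,∞)`, extended by zero. -/
def posKernel (w : ℝ → ℝ) (r : ℝ) : ENNReal := ENNReal.ofReal ((Ioi (0 : ℝ)).indicator w r)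

/-- The negative part of the profile `w` on `(0,∞)`, extended by zero. -/
def negKernel (w : ℝ → ℝ) (r : ℝ) : ENNReal := ENNReal.ofReal (-(Ioi (0 : ℝ)).indicator w r)

lemma posKernel_of_pos (w : ℝ → ℝ) {r : ℝ} (hr : 0 < r) : posKernel w r = ENNReal.ofReal (w r) := by
  rw [posKernel, indicator_of_mem (mem_Ioi.2 hr)]

lemma negKernel_of_pos (w : ℝ → ℝ) {r : ℝ} (hr : 0 < r) :
    negKernel w r = ENNReal.ofReal (-w r) := by
  rw [negKernel, indicator_of_mem (mem_Ioi.2 hr)]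

lemma posKernel_zero (w : ℝ → ℝ) : posKernel w 0 = 0 := by simp [posKernel]

lemma negKernel_zero (w : ℝ → ℝ) : negKernel w 0 = 0 := by simp [negKernel]

lemma measurable_indicator_profile {w : ℝ → ℝ} (hw : ContinuousOn w (Ioi 0)) :
    Measurable ((Ioi (0 : ℝ)).indicator w) := by
  rw [← piecewise_eq_indicator]
  exact hw.measurable_piecewise continuousOn_const measurableSet_Ioi

lemma measurable_posKernel {w : ℝ → ℝ} (hw : ContinuousOn w (Ioi 0)) : Measurable (posKernel w) :=
  (measurable_indicator_profile hw).ennreal_ofReal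

lemma measurable_negKernel {w : ℝ → ℝ} (hw : ContinuousOn w (Ioi 0)) : Measurable (negKernel w) :=
  (measurable_indicator_profile hw).neg.ennreal_ofReal

lemma pairMean_le {n : ℕ} (hn : 1 ≤ n) {g : ℝ → ENNReal} {p q : ℝ} (hp : 0 < p) {D : ENNReal}
    (h : ∀ x ∈ Metric.ball (0 : EuclideanSpace ℝ (Fin n)) (layerRadius n p),
      ENNReal.ofReal q *
        ∫⁻ y in Metric.ball (0 : EuclideanSpace ℝ (Fin n)) (layerRadius n q), g ‖x - y‖ ≤ D) :
    pairMean n g p q ≤ D := by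
  calc pairMean n g p q
      ≤ ENNReal.ofReal p *
        ∫⁻ _ in Metric.ball (0 : EuclideanSpace ℝ (Fin n)) (layerRadius n p), D :=
        mul_le_mul_right (setLIntegral_mono measurable_const h) _
    _ = D := by
        rw [setLIntegral_const, volume_layer hn hp, mul_comm D, ← mul_assoc,
          ENNReal.mul_inv_cancel (ENNReal.ofReal_pos.2 hp).ne' ENNReal.ofReal_ne_top, one_mul]

lemma pairMean_posKernel_ne_top {n : ℕ} (hn : 1 ≤ n) {w : ℝ → ℝ} (hw : StrictMonoOn w (Ioi 0))
    {p q : ℝ} (hp : 0 < p) (hq : 0 < q) : pairMean n (posKernel w) p q ≠ ⊤ := by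
  have ha := layerRadius_pos n hp
  have hb := layerRadius_pos n hq
  refine ne_top_of_le_ne_top ENNReal.ofReal_ne_top
    (pairMean_le hn hp (D := ENNReal.ofReal (w (layerRadius n p + layerRadius n q))) fun x hx => ?_)
  calc ENNReal.ofReal q *
        ∫⁻ y in Metric.ball (0 : EuclideanSpace ℝ (Fin n)) (layerRadius n q), posKernel w ‖x - y‖
      ≤ ENNReal.ofReal q * ∫⁻ _ in Metric.ball (0 : EuclideanSpace ℝ (Fin n)) (layerRadius n q),
          ENNReal.ofReal (w (layerRadius n p + layerRadius n q)) := by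
        refine mul_le_mul_right (setLIntegral_mono measurable_const fun y hy => ?_) _
        rcases (norm_nonneg (x - y)).eq_or_lt with h | h
        · rw [← h, posKernel_zero]
          exact zero_le
        · rw [posKernel_of_pos w h]
          have : ‖x - y‖ < layerRadius n p + layerRadius n q :=
            (norm_sub_le x y).trans_lt
              (add_lt_add (mem_ball_zero_iff.1 hx) (mem_ball_zero_iff.1 hy))
          exact ENNReal.ofReal_le_ofReal (hw h (mem_Ioi.2 (add_pos ha hb)) this).le
    _ = _ := by
        rw [setLIntegral_const, volume_layer hn hq, mul_comm _ (ENNReal.ofReal q)⁻¹, ← mul_assoc,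
          ENNReal.mul_inv_cancel (ENNReal.ofReal_pos.2 hq).ne' ENNReal.ofReal_ne_top, one_mul]

section Bounds

variable {m : ℕ} {W : EuclideanSpace ℝ (Fin (m + 1)) → ℝ} {w : ℝ → ℝ}

/-- The negative part of the potential is the sum of a bounded and an integrable function, so its
mean over two layers is controlled by the height of one of them. -/
lemma IsAttractivePotential.exists_pairMean_negKernel_le (hW : IsAttractivePotential W w)
    (hw : SingularityBound (m + 1) w) : ∃ D c : ENNReal, D ≠ ⊤ ∧ c ≠ ⊤ ∧
      ∀ p q : ℝ, 0 < p → 0 < q → pairMean (m + 1) (negKernel w) p q ≤ D + c * ENNReal.ofReal q := by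
  obtain ⟨A, B, k, hA, hB, hk, h1, h2⟩ := hW.exists_lower_bound hw
  set h : ℝ → ENNReal := (Ioo (0 : ℝ) 1).indicator fun r => ENNReal.ofReal (B * r ^ k) with hh
  have hhm : Measurable h := (by fun_prop : Measurable fun r : ℝ =>
    ENNReal.ofReal (B * r ^ k)).indicator measurableSet_Ioo
  have hle : ∀ r, 0 ≤ r → negKernel w r ≤ ENNReal.ofReal A + h r := by
    intro r hr
    rcases hr.eq_or_lt with rfl | hr
    · rw [negKernel_zero]
      exact zero_le
    rw [negKernel_of_pos w hr]
    rcases lt_or_ge r 1 with hr1 | hr1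
    · rw [hh, indicator_of_mem (show r ∈ Ioo (0 : ℝ) 1 from ⟨hr, hr1⟩),
        ← ENNReal.ofReal_add hA (mul_nonneg hB (Real.rpow_nonneg hr.le k))]
      exact ENNReal.ofReal_le_ofReal (by linarith [h1 r ⟨hr, hr1⟩])
    · exact (ENNReal.ofReal_le_ofReal (by linarith [h2 r hr1])).trans le_self_add
  refine ⟨ENNReal.ofReal A, ∫⁻ z : EuclideanSpace ℝ (Fin (m + 1)), h ‖z‖, ENNReal.ofReal_ne_top, ?_,
    fun p q hp hq => ?_⟩
  · rw [lintegral_fun_norm (Nat.le_add_left 1 m) hhm]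
    refine ENNReal.mul_ne_top ENNReal.ofReal_ne_top ?_
    have hint := ((integrableOn_pow_mul_rpow hk one_pos).const_mul B).lintegral_lt_top
    refine ne_top_of_le_ne_top hint.ne ?_
    rw [← lintegral_indicator measurableSet_Ioo, ← lintegral_indicator measurableSet_Ioi]
    refine lintegral_mono fun r => ?_
    by_cases hr : r ∈ Ioo (0 : ℝ) 1
    · rw [indicator_of_mem hr, indicator_of_mem (mem_Ioi.2 hr.1), hh, indicator_of_mem hr,
        Nat.add_sub_cancel, ← ENNReal.ofReal_mul (pow_nonneg hr.1.le m)]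
      exact ENNReal.ofReal_le_ofReal (le_of_eq (by ring))
    · rw [indicator_of_notMem hr]
      by_cases hr' : r ∈ Ioi (0 : ℝ)
      · rw [indicator_of_mem hr', hh, indicator_of_notMem hr, mul_zero]
      · rw [indicator_of_notMem hr']
  · refine pairMean_le (Nat.le_add_left 1 m) hp fun x _ => ?_
    have hmx : Measurable fun y : EuclideanSpace ℝ (Fin (m + 1)) => h ‖x - y‖ :=
      hhm.comp (measurable_const.sub measurable_id).norm
    calc ENNReal.ofReal q * ∫⁻ y in Metric.ball (0 : EuclideanSpace ℝ (Fin (m + 1)))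
            (layerRadius (m + 1) q), negKernel w ‖x - y‖
        ≤ ENNReal.ofReal q * ∫⁻ y in Metric.ball (0 : EuclideanSpace ℝ (Fin (m + 1)))
            (layerRadius (m + 1) q), (ENNReal.ofReal A + h ‖x - y‖) :=
          mul_le_mul_right (lintegral_mono fun y => hle _ (norm_nonneg _)) _
      _ = ENNReal.ofReal A + ENNReal.ofReal q * ∫⁻ y in Metric.ball
            (0 : EuclideanSpace ℝ (Fin (m + 1))) (layerRadius (m + 1) q), h ‖x - y‖ := by
          rw [lintegral_add_left measurable_const, setLIntegral_const,
            volume_layer (Nat.le_add_left 1 m) hq, mul_add, mul_comm _ (ENNReal.ofReal q)⁻¹,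
            ← mul_assoc, ENNReal.mul_inv_cancel (ENNReal.ofReal_pos.2 hq).ne' ENNReal.ofReal_ne_top,
            one_mul]
      _ ≤ ENNReal.ofReal A + ENNReal.ofReal q *
            ∫⁻ y : EuclideanSpace ℝ (Fin (m + 1)), h ‖x - y‖ := by
          gcongr
          exact Measure.restrict_le_self
      _ = _ := by
          rw [lintegral_sub_left_eq_self (fun z : EuclideanSpace ℝ (Fin (m + 1)) => h ‖z‖) x,
            mul_comm (ENNReal.ofReal q)]

end Bounds

/-! ### The mean interaction of two layers as an angular integral -/

/-- The constant relating the mean interaction of two layers to the angular integral. -/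
def angleConst (m : ℕ) : ℝ := (m + 1 : ℕ) * unitBallVolume m / unitBallVolume (m + 1)

lemma angleConst_pos (m : ℕ) : 0 < angleConst m :=
  div_pos (mul_pos (by positivity) (unitBallVolume_pos m)) (unitBallVolume_pos (m + 1))

/-- The angular density of the mean interaction of two layers with kernel `g`. -/
def angleDensity (m : ℕ) (g : ℝ → ENNReal) (a b φ : ℝ) : ENNReal :=
  ENNReal.ofReal ((Real.sin φ / thirdSide a b φ) ^ (m + 1)) *
    ∫⁻ r in Ioo 0 (thirdSide a b φ), ENNReal.ofReal (r ^ m) * g r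

lemma measurable_angleDensity (m : ℕ) {g : ℝ → ENNReal} (hg : Measurable g) (a b : ℝ) :
    Measurable (angleDensity m g a b) := by
  have hR : Measurable (thirdSide a b) := (continuous_thirdSide a b).measurable
  refine ((Real.measurable_sin.div hR).pow_const _).ennreal_ofReal.mul ?_
  have hS : MeasurableSet {z : ℝ × ℝ | 0 < z.2 ∧ z.2 < thirdSide a b z.1} :=
    (measurableSet_lt measurable_const measurable_snd).inter
      (measurableSet_lt measurable_snd (hR.comp measurable_fst))
  have hG : Measurable fun z : ℝ × ℝ => ENNReal.ofReal (z.2 ^ m) * g z.2 :=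
    (measurable_snd.pow_const m).ennreal_ofReal.mul (hg.comp measurable_snd)
  have hI := (hG.indicator hS).lintegral_prod_right' (ν := volume)
  convert hI using 1
  funext φ
  rw [← lintegral_indicator measurableSet_Ioo]
  refine lintegral_congr fun r => ?_
  simp [indicator]

lemma pairMean_eq_angle (m : ℕ) {g : ℝ → ENNReal} (hg : Measurable g) {p q : ℝ} (hp : 0 < p)
    (hq : 0 < q) : pairMean (m + 1) g p q = ENNReal.ofReal (angleConst m) *
      ∫⁻ φ in Ioo 0 Real.pi,
        angleDensity m g (layerRadius (m + 1) p) (layerRadius (m + 1) q) φ := by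
  have ha := layerRadius_pos (m + 1) hp
  have hb := layerRadius_pos (m + 1) hq
  have hpa := layerRadius_pow (Nat.le_add_left 1 m) hp
  have hqb := layerRadius_pow (Nat.le_add_left 1 m) hq
  set a := layerRadius (m + 1) p
  set b := layerRadius (m + 1) q
  have hκ := unitBallVolume_pos (m + 1)
  have e : ∀ φ : ℝ, ENNReal.ofReal ((a * b * Real.sin φ / thirdSide a b φ) ^ (m + 1)) *
      ∫⁻ r in Ioo 0 (thirdSide a b φ), ENNReal.ofReal (r ^ m) * g r
      = ENNReal.ofReal ((a * b) ^ (m + 1)) * angleDensity m g a b φ := by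
    intro φ
    rw [angleDensity, ← mul_assoc, ← ENNReal.ofReal_mul (by positivity), ← mul_pow, mul_div_assoc]
  rw [pairMean, lintegral_const_mul' _ _ ENNReal.ofReal_ne_top,
    lintegral_ball_ball_eq_angle m ha hb hg, lintegral_congr e,
    lintegral_const_mul' _ _ ENNReal.ofReal_ne_top, ← mul_assoc, ← mul_assoc, ← mul_assoc,
    ← ENNReal.ofReal_mul hp.le, ← ENNReal.ofReal_mul (by positivity),
    ← ENNReal.ofReal_mul
      (mul_nonneg (by positivity) (mul_nonneg (by positivity) (unitBallVolume_pos m).le))]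
  congr 2
  rw [mul_pow, hpa, hqb, angleConst]
  field_simp

section Difference

variable {m : ℕ} {w : ℝ → ℝ}

lemma lintegral_posKernel (m : ℕ) (w : ℝ → ℝ) (R : ℝ) :
    ∫⁻ r in Ioo 0 R, ENNReal.ofReal (r ^ m) * posKernel w r
      = ∫⁻ r in Ioo 0 R, ENNReal.ofReal (r ^ m * w r) := by
  refine setLIntegral_congr_fun measurableSet_Ioo fun r hr => ?_
  rw [posKernel_of_pos w hr.1, ← ENNReal.ofReal_mul (pow_nonneg hr.1.le m)]

lemma lintegral_negKernel (m : ℕ) (w : ℝ → ℝ) (R : ℝ) :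
    ∫⁻ r in Ioo 0 R, ENNReal.ofReal (r ^ m) * negKernel w r
      = ∫⁻ r in Ioo 0 R, ENNReal.ofReal (-(r ^ m * w r)) := by
  refine setLIntegral_congr_fun measurableSet_Ioo fun r hr => ?_
  rw [negKernel_of_pos w hr.1, ← ENNReal.ofReal_mul (pow_nonneg hr.1.le m), mul_neg]

lemma angleDensity_sub (hw : IsRadialProfile m w) {a b φ : ℝ} (ha : 0 < a) (hb : 0 < b)
    (hφ : φ ∈ Ioo 0 Real.pi) :
    (angleDensity m (posKernel w) a b φ).toReal - (angleDensity m (negKernel w) a b φ).toReal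
      = Real.sin φ ^ (m + 1) * radialMean m w (thirdSide a b φ) := by
  have hR := thirdSide_pos ha hb ⟨hφ.1, hφ.2.le⟩
  have hs : 0 ≤ (Real.sin φ / thirdSide a b φ) ^ (m + 1) :=
    pow_nonneg (div_nonneg (Real.sin_pos_of_mem_Ioo hφ).le hR.le) _
  rw [angleDensity, angleDensity, lintegral_posKernel, lintegral_negKernel, ENNReal.toReal_mul,
    ENNReal.toReal_mul, ENNReal.toReal_ofReal hs, ← mul_sub,
    ← integral_eq_lintegral_pos_part_sub_lintegral_neg_part (hw.integrableOn _ hR), radialMean,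
    div_pow]
  field_simp

variable {p q : ℝ}

lemma lintegral_angleDensity_ne_top {g : ℝ → ENNReal} (hg : Measurable g)
    (hp : 0 < p) (hq : 0 < q) (h : pairMean (m + 1) g p q ≠ ⊤) :
    (∫⁻ φ in Ioo 0 Real.pi,
      angleDensity m g (layerRadius (m + 1) p) (layerRadius (m + 1) q) φ) ≠ ⊤ := by
  intro htop
  rw [pairMean_eq_angle m hg hp hq, htop,
    ENNReal.mul_top (ENNReal.ofReal_pos.2 (angleConst_pos m)).ne'] at h
  exact h rfl

lemma integrableOn_sin_pow_mul_radialMean (hw : IsRadialProfile m w) (hp : 0 < p) (hq : 0 < q)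
    (hfp : pairMean (m + 1) (posKernel w) p q ≠ ⊤) (hfn : pairMean (m + 1) (negKernel w) p q ≠ ⊤) :
    IntegrableOn (fun φ => Real.sin φ ^ (m + 1) *
      radialMean m w (thirdSide (layerRadius (m + 1) p) (layerRadius (m + 1) q) φ))
      (Ioo 0 Real.pi) := by
  have mp := measurable_posKernel hw.continuousOn
  have mn := measurable_negKernel hw.continuousOn
  have jp := integrable_toReal_of_lintegral_ne_top
    (measurable_angleDensity m mp _ _).aemeasurable (lintegral_angleDensity_ne_top mp hp hq hfp)
  have jn := integrable_toReal_of_lintegral_ne_top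
    (measurable_angleDensity m mn _ _).aemeasurable (lintegral_angleDensity_ne_top mn hp hq hfn)
  refine IntegrableOn.congr_fun (jp.sub jn) (fun φ hφ => ?_) measurableSet_Ioo
  exact angleDensity_sub hw (layerRadius_pos _ hp) (layerRadius_pos _ hq) hφ

/-- The real mean interaction is recovered from its positive and negative parts. -/
lemma pairMean_sub (hw : IsRadialProfile m w) (hp : 0 < p) (hq : 0 < q)
    (hfp : pairMean (m + 1) (posKernel w) p q ≠ ⊤) (hfn : pairMean (m + 1) (negKernel w) p q ≠ ⊤) :
    (pairMean (m + 1) (posKernel w) p q).toReal - (pairMean (m + 1) (negKernel w) p q).toReal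
      = angleConst m * ballInteraction m w p q := by
  have mp := measurable_posKernel hw.continuousOn
  have mn := measurable_negKernel hw.continuousOn
  have ap := (measurable_angleDensity m mp (layerRadius (m + 1) p)
    (layerRadius (m + 1) q)).aemeasurable (μ := volume.restrict (Ioo 0 Real.pi))
  have an := (measurable_angleDensity m mn (layerRadius (m + 1) p)
    (layerRadius (m + 1) q)).aemeasurable (μ := volume.restrict (Ioo 0 Real.pi))
  have lp := lintegral_angleDensity_ne_top mp hp hq hfp
  have ln := lintegral_angleDensity_ne_top mn hp hq hfn
  rw [pairMean_eq_angle m mp hp hq, pairMean_eq_angle m mn hp hq, ENNReal.toReal_mul,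
    ENNReal.toReal_mul, ENNReal.toReal_ofReal (angleConst_pos m).le, ← mul_sub,
    ← integral_toReal ap (ae_lt_top' ap lp), ← integral_toReal an (ae_lt_top' an ln),
    ← integral_sub (integrable_toReal_of_lintegral_ne_top ap lp)
      (integrable_toReal_of_lintegral_ne_top an ln), ballInteraction]
  congr 1
  exact setIntegral_congr_fun measurableSet_Ioo fun φ hφ =>
    angleDensity_sub hw (layerRadius_pos _ hp) (layerRadius_pos _ hq) hφ

end Difference

/-! ### Strict convexity of the interaction energy -/

/-- The uniform measure on the square `(0,1)²` of pairs of mass variables. -/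
def massSquare : Measure (ℝ × ℝ) :=
  (volume.restrict (Ioo (0 : ℝ) 1)).prod (volume.restrict (Ioo (0 : ℝ) 1))

/-- The interaction of the density stacked from the slopes `u` with itself, for a nonnegative radial
kernel `g`. -/
def profileInteraction (n : ℕ) (g : ℝ → ENNReal) (u : ℝ → ℝ) : ENNReal :=
  ∫⁻ z, pairMean n g (u z.1) (u z.2) ∂massSquare

section Interaction

variable {m : ℕ} {W : EuclideanSpace ℝ (Fin (m + 1)) → ℝ} {w : ℝ → ℝ} {u v : ℝ → ℝ}

lemma IsSlopeProfile.profileInteraction_negKernel_ne_top (hu : IsSlopeProfile u)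
    (hW : IsAttractivePotential W w) (hw : SingularityBound (m + 1) w) :
    profileInteraction (m + 1) (negKernel w) u ≠ ⊤ := by
  obtain ⟨D, c, hD, hc, hle⟩ := hW.exists_pairMean_negKernel_le hw
  have hmu : Measurable fun s => ENNReal.ofReal (u s) := hu.measurable.ennreal_ofReal
  have hI : (∫⁻ s in Ioo (0 : ℝ) 1, (D + c * ENNReal.ofReal (u s))) ≠ ⊤ := by
    rw [lintegral_add_left measurable_const, lintegral_const_mul _ hmu, setLIntegral_const]
    exact ENNReal.add_ne_top.2 ⟨ENNReal.mul_ne_top hD (by simp),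
      ENNReal.mul_ne_top hc hu.integrableOn.lintegral_lt_top.ne⟩
  refine ne_top_of_le_ne_top (ENNReal.mul_ne_top hI (b := volume (Ioo (0 : ℝ) 1)) (by simp)) ?_
  calc profileInteraction (m + 1) (negKernel w) u
      ≤ ∫⁻ z, (D + c * ENNReal.ofReal (u z.2)) ∂massSquare :=
        lintegral_mono fun z => hle _ _ (hu.pos _) (hu.pos _)
    _ = _ := by
        have hm : Measurable fun z : ℝ × ℝ => D + c * ENNReal.ofReal (u z.2) :=
          measurable_const.add ((hmu.comp measurable_snd).const_mul c)
        rw [massSquare, lintegral_prod _ hm.aemeasurable]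
        dsimp only
        rw [setLIntegral_const]

/-- The mean of the potential over two layers. -/
def meanPotential (m : ℕ) (w : ℝ → ℝ) (p q : ℝ) : ℝ :=
  (pairMean (m + 1) (posKernel w) p q).toReal - (pairMean (m + 1) (negKernel w) p q).toReal

lemma IsAttractivePotential.pairMean_negKernel_ne_top (hW : IsAttractivePotential W w)
    (hw : SingularityBound (m + 1) w) {p q : ℝ} (hp : 0 < p) (hq : 0 < q) :
    pairMean (m + 1) (negKernel w) p q ≠ ⊤ := by
  obtain ⟨D, c, hD, hc, hle⟩ := hW.exists_pairMean_negKernel_le hw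
  exact ne_top_of_le_ne_top (ENNReal.add_ne_top.2
    ⟨hD, ENNReal.mul_ne_top hc ENNReal.ofReal_ne_top⟩) (hle p q hp hq)

lemma IsAttractivePotential.meanPotential_lt (hW : IsAttractivePotential W w)
    (hw : SingularityBound (m + 1) w) {p₀ q₀ p₁ q₁ t : ℝ} (hp₀ : 0 < p₀) (hq₀ : 0 < q₀)
    (hp₁ : 0 < p₁) (hq₁ : 0 < q₁) (hne : p₀ ≠ p₁ ∨ q₀ ≠ q₁) (ht : t ∈ Ioo (0 : ℝ) 1) :
    meanPotential m w ((1 - t) * p₀ + t * p₁) ((1 - t) * q₀ + t * q₁) <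
      (1 - t) * meanPotential m w p₀ q₀ + t * meanPotential m w p₁ q₁ := by
  have hr := hW.isRadialProfile hw
  have fp : ∀ p q, 0 < p → 0 < q → pairMean (m + 1) (posKernel w) p q ≠ ⊤ := fun p q hp hq =>
    pairMean_posKernel_ne_top (Nat.le_add_left 1 m) hW.strictMonoOn hp hq
  have fn : ∀ p q, 0 < p → 0 < q → pairMean (m + 1) (negKernel w) p q ≠ ⊤ := fun p q hp hq =>
    hW.pairMean_negKernel_ne_top hw hp hq
  have e : ∀ p q, 0 < p → 0 < q →
      meanPotential m w p q = angleConst m * ballInteraction m w p q := fun p q hp hq =>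
    pairMean_sub hr hp hq (fp p q hp hq) (fn p q hp hq)
  have hpos : ∀ {x y : ℝ}, 0 < x → 0 < y → 0 < (1 - t) * x + t * y := fun hx hy =>
    add_pos (mul_pos (sub_pos.2 ht.2) hx) (mul_pos ht.1 hy)
  have h := hr.ballInteraction_lt (fun p q hp hq => integrableOn_sin_pow_mul_radialMean hr hp hq
    (fp p q hp hq) (fn p q hp hq)) hp₀ hq₀ hp₁ hq₁ hne ht
  rw [e _ _ (hpos hp₀ hp₁) (hpos hq₀ hq₁), e _ _ hp₀ hq₀, e _ _ hp₁ hq₁]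
  have := mul_lt_mul_of_pos_left h (angleConst_pos m)
  linarith

lemma IsAttractivePotential.meanPotential_le (hW : IsAttractivePotential W w)
    (hw : SingularityBound (m + 1) w) {p₀ q₀ p₁ q₁ t : ℝ} (hp₀ : 0 < p₀) (hq₀ : 0 < q₀)
    (hp₁ : 0 < p₁) (hq₁ : 0 < q₁) (ht : t ∈ Ioo (0 : ℝ) 1) :
    meanPotential m w ((1 - t) * p₀ + t * p₁) ((1 - t) * q₀ + t * q₁) ≤
      (1 - t) * meanPotential m w p₀ q₀ + t * meanPotential m w p₁ q₁ := by
  by_cases hne : p₀ ≠ p₁ ∨ q₀ ≠ q₁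
  · exact (hW.meanPotential_lt hw hp₀ hq₀ hp₁ hq₁ hne ht).le
  · push Not at hne
    obtain ⟨rfl, rfl⟩ := hne
    rw [show (1 - t) * p₀ + t * p₀ = p₀ by ring, show (1 - t) * q₀ + t * q₀ = q₀ by ring]
    exact le_of_eq (by ring)

/-- Finiteness of the positive part of the interaction energy is preserved by interpolation: the
convex combination bounds the positive part up to the negative part, which is always finite. -/
lemma IsAttractivePotential.profileInteraction_interp_ne_top (hW : IsAttractivePotential W w)
    (hw : SingularityBound (m + 1) w) (hu : IsSlopeProfile u) (hv : IsSlopeProfile v) {t : ℝ}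
    (ht : t ∈ Ioo (0 : ℝ) 1) (hfu : profileInteraction (m + 1) (posKernel w) u ≠ ⊤)
    (hfv : profileInteraction (m + 1) (posKernel w) v ≠ ⊤) :
    profileInteraction (m + 1) (posKernel w) (fun s => (1 - t) * u s + t * v s) ≠ ⊤ := by
  have hU := hu.interp hv ⟨ht.1.le, ht.2.le⟩
  have hcont := (hW.isRadialProfile hw).continuousOn
  have mp := measurable_posKernel hcont
  have hN := hU.profileInteraction_negKernel_ne_top hW hw
  set U : ℝ → ℝ := fun s => (1 - t) * u s + t * v s with hUdef
  have fp : ∀ p q, 0 < p → 0 < q → pairMean (m + 1) (posKernel w) p q ≠ ⊤ := fun p q hp hq =>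
    pairMean_posKernel_ne_top (Nat.le_add_left 1 m) hW.strictMonoOn hp hq
  have fn : ∀ p q, 0 < p → 0 < q → pairMean (m + 1) (negKernel w) p q ≠ ⊤ := fun p q hp hq =>
    hW.pairMean_negKernel_ne_top hw hp hq
  have hle : ∀ z : ℝ × ℝ, pairMean (m + 1) (posKernel w) (U z.1) (U z.2) ≤
      pairMean (m + 1) (posKernel w) (u z.1) (u z.2) +
        pairMean (m + 1) (posKernel w) (v z.1) (v z.2) +
        pairMean (m + 1) (negKernel w) (U z.1) (U z.2) := by
    intro z
    have h := hW.meanPotential_le hw (hu.pos z.1) (hu.pos z.2) (hv.pos z.1) (hv.pos z.2) ht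
    have f1 := fp _ _ (hu.pos z.1) (hu.pos z.2)
    have f2 := fp _ _ (hv.pos z.1) (hv.pos z.2)
    have f3 := fn _ _ (hU.pos z.1) (hU.pos z.2)
    rw [← ENNReal.toReal_le_toReal (fp _ _ (hU.pos z.1) (hU.pos z.2))
      (ENNReal.add_ne_top.2 ⟨ENNReal.add_ne_top.2 ⟨f1, f2⟩, f3⟩),
      ENNReal.toReal_add (ENNReal.add_ne_top.2 ⟨f1, f2⟩) f3, ENNReal.toReal_add f1 f2]
    simp only [meanPotential] at h
    have e1 : (1 - t) * (pairMean (m + 1) (posKernel w) (u z.1) (u z.2)).toReal ≤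
        (pairMean (m + 1) (posKernel w) (u z.1) (u z.2)).toReal :=
      mul_le_of_le_one_left ENNReal.toReal_nonneg (by linarith [ht.1])
    have e2 : t * (pairMean (m + 1) (posKernel w) (v z.1) (v z.2)).toReal ≤
        (pairMean (m + 1) (posKernel w) (v z.1) (v z.2)).toReal :=
      mul_le_of_le_one_left ENNReal.toReal_nonneg ht.2.le
    have e3 : 0 ≤ (1 - t) * (pairMean (m + 1) (negKernel w) (u z.1) (u z.2)).toReal :=
      mul_nonneg (by linarith [ht.2]) ENNReal.toReal_nonneg
    have e4 : 0 ≤ t * (pairMean (m + 1) (negKernel w) (v z.1) (v z.2)).toReal :=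
      mul_nonneg ht.1.le ENNReal.toReal_nonneg
    linarith
  refine ne_top_of_le_ne_top (ENNReal.add_ne_top.2 ⟨ENNReal.add_ne_top.2 ⟨hfu, hfv⟩, hN⟩) ?_
  have mu := measurable_pairMean (n := m + 1) hu.measurable mp
  have mv := measurable_pairMean (n := m + 1) hv.measurable mp
  have muv : Measurable fun z : ℝ × ℝ => pairMean (m + 1) (posKernel w) (u z.1) (u z.2) +
      pairMean (m + 1) (posKernel w) (v z.1) (v z.2) := mu.add mv
  rw [profileInteraction, profileInteraction, profileInteraction, profileInteraction,
    ← lintegral_add_left mu, ← lintegral_add_left muv]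
  exact lintegral_mono hle

lemma IsSlopeProfile.integrable_meanPotential (hu : IsSlopeProfile u)
    (hW : IsAttractivePotential W w) (hw : SingularityBound (m + 1) w)
    (hfu : profileInteraction (m + 1) (posKernel w) u ≠ ⊤) :
    Integrable (fun z : ℝ × ℝ => meanPotential m w (u z.1) (u z.2)) massSquare ∧
      ∫ z, meanPotential m w (u z.1) (u z.2) ∂massSquare =
        (profileInteraction (m + 1) (posKernel w) u).toReal -
          (profileInteraction (m + 1) (negKernel w) u).toReal := by
  have hcont := (hW.isRadialProfile hw).continuousOn
  have ap := (measurable_pairMean (n := m + 1) hu.measurable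
    (measurable_posKernel hcont)).aemeasurable (μ := massSquare)
  have an := (measurable_pairMean (n := m + 1) hu.measurable
    (measurable_negKernel hcont)).aemeasurable (μ := massSquare)
  have ln := hu.profileInteraction_negKernel_ne_top hW hw
  have jp := integrable_toReal_of_lintegral_ne_top ap hfu
  have jn := integrable_toReal_of_lintegral_ne_top an ln
  refine ⟨jp.sub jn, ?_⟩
  simp only [meanPotential]
  rw [integral_sub jp jn, integral_toReal ap (ae_lt_top' ap hfu),
    integral_toReal an (ae_lt_top' an ln), profileInteraction, profileInteraction]

/-- The interaction energy is strictly convex along linear interpolations of slopes. -/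
lemma IsAttractivePotential.profileInteraction_interp_lt (hW : IsAttractivePotential W w)
    (hw : SingularityBound (m + 1) w) (hu : IsSlopeProfile u) (hv : IsSlopeProfile v) {t : ℝ}
    (ht : t ∈ Ioo (0 : ℝ) 1) (hfu : profileInteraction (m + 1) (posKernel w) u ≠ ⊤)
    (hfv : profileInteraction (m + 1) (posKernel w) v ≠ ⊤)
    (hne : ¬ u =ᵐ[volume.restrict (Ioo (0 : ℝ) 1)] v) :
    (profileInteraction (m + 1) (posKernel w) (fun s => (1 - t) * u s + t * v s)).toReal -
      (profileInteraction (m + 1) (negKernel w) (fun s => (1 - t) * u s + t * v s)).toReal <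
    (1 - t) * ((profileInteraction (m + 1) (posKernel w) u).toReal -
      (profileInteraction (m + 1) (negKernel w) u).toReal) +
    t * ((profileInteraction (m + 1) (posKernel w) v).toReal -
      (profileInteraction (m + 1) (negKernel w) v).toReal) := by
  obtain ⟨iU, eU⟩ := (hu.interp hv ⟨ht.1.le, ht.2.le⟩).integrable_meanPotential hW hw
    (hW.profileInteraction_interp_ne_top hw hu hv ht hfu hfv)
  obtain ⟨iu, eu⟩ := hu.integrable_meanPotential hW hw hfu
  obtain ⟨iv, ev⟩ := hv.integrable_meanPotential hW hw hfv
  have hle : (fun z : ℝ × ℝ => meanPotential m w ((1 - t) * u z.1 + t * v z.1)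
      ((1 - t) * u z.2 + t * v z.2)) ≤ᵐ[massSquare] fun z =>
      (1 - t) * meanPotential m w (u z.1) (u z.2) + t * meanPotential m w (v z.1) (v z.2) :=
    ae_of_all _ fun z =>
      hW.meanPotential_le hw (hu.pos z.1) (hu.pos z.2) (hv.pos z.1) (hv.pos z.2) ht
  have iuv := (iu.const_mul (1 - t)).add (iv.const_mul t)
  rw [← eU, ← eu, ← ev, ← integral_const_mul, ← integral_const_mul,
    ← integral_add (iu.const_mul _) (iv.const_mul _)]
  refine lt_of_le_of_ne (integral_mono_ae iU iuv hle) fun heq => hne ?_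
  have hae := (integral_eq_iff_of_ae_le iU iuv hle).1 heq
  have hsnd : ∀ᵐ z : ℝ × ℝ ∂massSquare, u z.2 = v z.2 := by
    filter_upwards [hae] with z hz
    by_contra hc
    exact (hW.meanPotential_lt hw (hu.pos z.1) (hu.pos z.2) (hv.pos z.1) (hv.pos z.2)
      (Or.inr hc) ht).ne hz
  have hν : NeZero (volume.restrict (Ioo (0 : ℝ) 1)) :=
    ⟨fun h => by simp [Measure.restrict_eq_zero] at h⟩
  obtain ⟨s, hs⟩ := (Measure.ae_ae_of_ae_prod hsnd).exists
  exact hs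

end Interaction

/-! ### The free energy of stacked densities -/

section Energy

variable {m : ℕ} {W : EuclideanSpace ℝ (Fin (m + 1)) → ℝ} {w : ℝ → ℝ} {u v : ℝ → ℝ}

lemma IsSlopeProfile.lintegral_potential (hu : IsSlopeProfile u) (hW : IsAttractivePotential W w) :
    (∫⁻ x, ∫⁻ y, ENNReal.ofReal (stack (m + 1) u x * (W (x - y) * stack (m + 1) u y)))
        = profileInteraction (m + 1) (posKernel w) u ∧
      (∫⁻ x, ∫⁻ y, ENNReal.ofReal (-(stack (m + 1) u x * (W (x - y) * stack (m + 1) u y))))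
        = profileInteraction (m + 1) (negKernel w) u := by
  have hcont := hW.contDiffOn.continuousOn
  rw [profileInteraction, profileInteraction, massSquare,
    ← hu.lintegral_interaction (measurable_posKernel hcont),
    ← hu.lintegral_interaction (measurable_negKernel hcont)]
  -- the value of the potential at the origin only matters on the diagonal, which is a null set
  have hy : ∀ x : EuclideanSpace ℝ (Fin (m + 1)), ∀ᵐ y : EuclideanSpace ℝ (Fin (m + 1)),
      0 < ‖x - y‖ ∧ W (x - y) = w ‖x - y‖ := by
    intro x
    filter_upwards [compl_mem_ae_iff.2 (measure_singleton x)] with y hy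
    have : x - y ≠ 0 := sub_ne_zero.2 fun h => hy h.symm
    exact ⟨norm_pos_iff.2 this, hW.radial _ this⟩
  refine ⟨lintegral_congr fun x => lintegral_congr_ae ?_,
    lintegral_congr fun x => lintegral_congr_ae ?_⟩
  · filter_upwards [hy x] with y hxy
    rw [posKernel_of_pos w hxy.1, ← ENNReal.ofReal_mul (hu.stack_nonneg y),
      ← ENNReal.ofReal_mul (hu.stack_nonneg x), hxy.2, mul_comm (w _)]
  · filter_upwards [hy x] with y hxy
    rw [negKernel_of_pos w hxy.1, ← ENNReal.ofReal_mul (hu.stack_nonneg y),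
      ← ENNReal.ofReal_mul (hu.stack_nonneg x), hxy.2, mul_comm (w _), mul_neg, mul_neg]

lemma IsSlopeProfile.freeEnergy_eq (hu : IsSlopeProfile u) (hW : IsAttractivePotential W w)
    (l : ℝ) : freeEnergy l W (stack (m + 1) u) = (entropy l (stack (m + 1) u) : EReal) +
      ((1 / 2 : ℝ) : EReal) * ((profileInteraction (m + 1) (posKernel w) u : EReal) -
        (profileInteraction (m + 1) (negKernel w) u : EReal)) := by
  obtain ⟨h1, h2⟩ := hu.lintegral_potential hW
  rw [freeEnergy, interactionEnergy, h1, h2]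

lemma IsSlopeProfile.freeEnergy_eq_top (hu : IsSlopeProfile u) (hW : IsAttractivePotential W w)
    (hw : SingularityBound (m + 1) w) (l : ℝ)
    (h : profileInteraction (m + 1) (posKernel w) u = ⊤) :
    freeEnergy l W (stack (m + 1) u) = ⊤ := by
  have hN := hu.profileInteraction_negKernel_ne_top hW hw
  rw [hu.freeEnergy_eq hW, h, ← ENNReal.ofReal_toReal hN]
  rw [EReal.coe_ennreal_ofReal, EReal.coe_ennreal_top, EReal.top_sub_coe,
    EReal.coe_mul_top_of_pos (by norm_num)]
  exact EReal.add_top_of_ne_bot (EReal.coe_ennreal_ne_bot _)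

lemma IsSlopeProfile.freeEnergy_eq_coe (hu : IsSlopeProfile u) (hW : IsAttractivePotential W w)
    (hw : SingularityBound (m + 1) w) {l : ℝ} (hl : 2 ≤ l)
    (h : profileInteraction (m + 1) (posKernel w) u ≠ ⊤) :
    freeEnergy l W (stack (m + 1) u) = (((entropy l (stack (m + 1) u)).toReal +
      1 / 2 * ((profileInteraction (m + 1) (posKernel w) u).toReal -
        (profileInteraction (m + 1) (negKernel w) u).toReal) : ℝ) : EReal) := by
  have hN := hu.profileInteraction_negKernel_ne_top hW hw
  have hS := hu.entropy_ne_top (Nat.le_add_left 1 m) hl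
  rw [hu.freeEnergy_eq hW, EReal.coe_add, EReal.coe_mul, EReal.coe_sub,
    EReal.coe_ennreal_toReal hS, EReal.coe_ennreal_toReal h, EReal.coe_ennreal_toReal hN]

lemma IsSlopeProfile.freeEnergy_ne_bot (hu : IsSlopeProfile u) (hW : IsAttractivePotential W w)
    (hw : SingularityBound (m + 1) w) {l : ℝ} (hl : 2 ≤ l) :
    freeEnergy l W (stack (m + 1) u) ≠ ⊥ := by
  by_cases h : profileInteraction (m + 1) (posKernel w) u = ⊤
  · rw [hu.freeEnergy_eq_top hW hw l h]
    exact top_ne_bot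
  · rw [hu.freeEnergy_eq_coe hW hw hl h]
    exact EReal.coe_ne_bot _

lemma IsSlopeProfile.freeEnergy_ne_top_iff (hu : IsSlopeProfile u) (hW : IsAttractivePotential W w)
    (hw : SingularityBound (m + 1) w) {l : ℝ} (hl : 2 ≤ l) :
    freeEnergy l W (stack (m + 1) u) ≠ ⊤ ↔ profileInteraction (m + 1) (posKernel w) u ≠ ⊤ := by
  refine ⟨fun h h' => h (hu.freeEnergy_eq_top hW hw l h'), fun h => ?_⟩
  rw [hu.freeEnergy_eq_coe hW hw hl h]
  exact EReal.coe_ne_top _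

lemma IsAttractivePotential.freeEnergy_interp_ne_top (hW : IsAttractivePotential W w)
    (hw : SingularityBound (m + 1) w) {l : ℝ} (hl : 2 ≤ l) (hu : IsSlopeProfile u)
    (hv : IsSlopeProfile v) {t : ℝ} (ht : t ∈ Ioo (0 : ℝ) 1)
    (hfu : freeEnergy l W (stack (m + 1) u) ≠ ⊤) (hfv : freeEnergy l W (stack (m + 1) v) ≠ ⊤) :
    freeEnergy l W (stack (m + 1) fun s => (1 - t) * u s + t * v s) ≠ ⊤ := by
  rw [hu.freeEnergy_ne_top_iff hW hw hl] at hfu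
  rw [hv.freeEnergy_ne_top_iff hW hw hl] at hfv
  rw [(hu.interp hv ⟨ht.1.le, ht.2.le⟩).freeEnergy_ne_top_iff hW hw hl]
  exact hW.profileInteraction_interp_ne_top hw hu hv ht hfu hfv

lemma IsAttractivePotential.freeEnergy_interp_lt (hW : IsAttractivePotential W w)
    (hw : SingularityBound (m + 1) w) {l : ℝ} (hl : 2 ≤ l) (hu : IsSlopeProfile u)
    (hv : IsSlopeProfile v) {t : ℝ} (ht : t ∈ Ioo (0 : ℝ) 1)
    (hfu : freeEnergy l W (stack (m + 1) u) ≠ ⊤) (hfv : freeEnergy l W (stack (m + 1) v) ≠ ⊤)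
    (hne : ¬ u =ᵐ[volume.restrict (Ioo (0 : ℝ) 1)] v) :
    (freeEnergy l W (stack (m + 1) fun s => (1 - t) * u s + t * v s)).toReal <
      (1 - t) * (freeEnergy l W (stack (m + 1) u)).toReal +
        t * (freeEnergy l W (stack (m + 1) v)).toReal := by
  have ht' : t ∈ Icc (0 : ℝ) 1 := ⟨ht.1.le, ht.2.le⟩
  have hU := hu.interp hv ht'
  rw [hu.freeEnergy_ne_top_iff hW hw hl] at hfu
  rw [hv.freeEnergy_ne_top_iff hW hw hl] at hfv
  rw [hU.freeEnergy_eq_coe hW hw hl (hW.profileInteraction_interp_ne_top hw hu hv ht hfu hfv),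
    hu.freeEnergy_eq_coe hW hw hl hfu, hv.freeEnergy_eq_coe hW hw hl hfv,
    EReal.toReal_coe, EReal.toReal_coe, EReal.toReal_coe]
  have h1 := IsSlopeProfile.entropy_interp_le (Nat.le_add_left 1 m) hu hv hl ht'
  have h2 := hW.profileInteraction_interp_lt hw hu hv ht hfu hfv hne
  linarith

lemma stack_congr_ae (n : ℕ) (h : u =ᵐ[volume.restrict (Ioo (0 : ℝ) 1)] v) :
    stack n u = stack n v := by
  funext x
  refine integral_congr_ae ?_
  filter_upwards [h] with s hs
  rw [hs]

end Energy

end HeightInterp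

end

open HeightInterp

theorem theorem2p5 (n : ℕ) (hn : 1 ≤ n) (m : ℝ) (hm : 2 ≤ m)
    (W : EuclideanSpace ℝ (Fin n) → ℝ) (w : ℝ → ℝ)
    (hW : HeightInterp.IsAttractivePotential W w) (hw : HeightInterp.SingularityBound n w)
    (ρ₀ ρ₁ : EuclideanSpace ℝ (Fin n) → ℝ)
    (h₀ : HeightInterp.IsProbDensity ρ₀) (h₁ : HeightInterp.IsProbDensity ρ₁)
    (hc₀ : Continuous ρ₀) (hc₁ : Continuous ρ₁)
    (hd₀ : HeightInterp.RadiallyDecreasing ρ₀) (hd₁ : HeightInterp.RadiallyDecreasing ρ₁)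
    (hne : ρ₀ ≠ ρ₁) :
    -- the energy never takes the value `-∞` along the curve
    (∀ t ∈ Set.Ioo (0 : ℝ) 1,
      HeightInterp.freeEnergy m W (HeightInterp.interp ρ₀ ρ₁ t) ≠ ⊥) ∧
    -- strict convexity on `(0,1)` as a function with values in `(-∞,+∞]`: the set of times of
    -- finite energy is convex, and the energy is strictly convex on it
    StrictConvexOn ℝ
      {t ∈ Set.Ioo (0 : ℝ) 1 | HeightInterp.freeEnergy m W (HeightInterp.interp ρ₀ ρ₁ t) ≠ ⊤}
      (fun t => (HeightInterp.freeEnergy m W (HeightInterp.interp ρ₀ ρ₁ t)).toReal) ∧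
    -- if the two densities have finite energy, then so does every density in between
    (HeightInterp.freeEnergy m W ρ₀ ≠ ⊤ → HeightInterp.freeEnergy m W ρ₁ ≠ ⊤ →
      ∀ t ∈ Set.Ioo (0 : ℝ) 1,
        HeightInterp.freeEnergy m W (HeightInterp.interp ρ₀ ρ₁ t) ≠ ⊤) := by
  obtain ⟨d, rfl⟩ : ∃ d, n = d + 1 := ⟨n - 1, by omega⟩
  have hu := isSlopeProfile_heightSlope hn h₀ hc₀ hd₀
  have hv := isSlopeProfile_heightSlope hn h₁ hc₁ hd₁
  have e₀ := stack_heightSlope hn h₀ hc₀ hd₀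
  have e₁ := stack_heightSlope hn h₁ hc₁ hd₁
  simp only [interp_eq_stack h₀ h₁ hc₀ hc₁]
  set u := heightSlope ρ₀
  set v := heightSlope ρ₁
  have hU : ∀ t ∈ Set.Ioo (0 : ℝ) 1, IsSlopeProfile fun s => (1 - t) * u s + t * v s :=
    fun t ht => hu.interp hv ⟨ht.1.le, ht.2.le⟩
  have hcomb : ∀ {x y a b : ℝ}, a + b = 1 → (fun s => (1 - (a • x + b • y)) * u s +
      (a • x + b • y) * v s) = fun s => (1 - b) * ((1 - x) * u s + x * v s) +
        b * ((1 - y) * u s + y * v s) := by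
    intro x y a b hab
    obtain rfl : a = 1 - b := by linarith
    funext s
    simp only [smul_eq_mul]
    ring
  have hmem : ∀ {x y a b : ℝ}, x ∈ Set.Ioo (0 : ℝ) 1 → y ∈ Set.Ioo (0 : ℝ) 1 → 0 < a → 0 < b →
      a + b = 1 → a • x + b • y ∈ Set.Ioo (0 : ℝ) 1 := fun hx hy ha hb hab =>
    convex_Ioo 0 1 hx hy ha.le hb.le hab
  refine ⟨fun t ht => (hU t ht).freeEnergy_ne_bot hW hw hm, ⟨?_, ?_⟩, fun hf₀ hf₁ t ht => ?_⟩
  · rw [convex_iff_forall_pos]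
    intro x hx y hy a b ha hb hab
    refine ⟨hmem hx.1 hy.1 ha hb hab, ?_⟩
    rw [hcomb hab]
    exact hW.freeEnergy_interp_ne_top hw hm (hU x hx.1) (hU y hy.1) ⟨hb, by linarith⟩ hx.2 hy.2
  · intro x hx y hy hxy a b ha hb hab
    have h := hW.freeEnergy_interp_lt hw hm (hU x hx.1) (hU y hy.1) (t := b) ⟨hb, by linarith⟩
      hx.2 hy.2 fun hae => hne ?_
    · rw [← hcomb hab, show 1 - b = a by linarith] at h
      exact h
    · -- two interpolated slope profiles can only agree if the two given ones do
      rw [← e₀, ← e₁]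
      refine stack_congr_ae _ ?_
      filter_upwards [hae] with s hs
      have : (x - y) * (v s - u s) = 0 := by linear_combination hs
      rcases mul_eq_zero.1 this with h | h
      · exact absurd (sub_eq_zero.1 h) hxy
      · exact (sub_eq_zero.1 h).symm
  · rw [← e₀] at hf₀
    rw [← e₁] at hf₁
    exact hW.freeEnergy_interp_ne_top hw hm hu hv ht hf₀ hf₁
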